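/- Work over $\mathbb{C}$. Let $K_0[\mathrm{Var}_{\mathbb C}]$ be the Grothendieck ring of complex varieties (separated schemes of finite type over $\mathbb C$; relations $[X]=[X_{\mathrm{red}}]$ and $[X]=[U]+[X\setminus U]$ for $U\subseteq X$ open; $[X]\cdot[Y]=[X\times Y]$) and let $\mathbb{L}=[\mathbb{A}^1]$. Let $1\le m\le n$ and $l\ge 1$ be integers, and let $X=\mathbb{C}^{mn}$ be the space of $m\times n$ matrices. The $l$-jets of $X$ are the $m\times n$ matrices over $\mathbb{C}[t]/(t^{l+1})$; the group $J_l(\mathrm{GL}_m)\times J_l(\mathrm{GL}_n)=\mathrm{GL}_m(\mathbb{C}[t]/(t^{l+1}))\times \mathrm{GL}_n(\mathbb{C}[t]/(t^{l+1}))$ acts on them by $(g,h)\cdot A=gAh^{-1}$. For $\lambda=(\lambda_1,\dots,\lambda_m)$ with $0\le\lambda_1\le\dots\le\lambda_m\le\infty$, let $\delta_\lambda$ be the $m\times n$ matrix with diagonal entries $t^{\lambda_1},\dots,t^{\lambda_m}$ (where $t^\infty=0$) and all other entries $0$, and let $\mathcal{C}_\lambda^l\subseteq J_l(X)\cong\mathbb{A}^{mn(l+1)}$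 be its orbit, a locally closed subset with its reduced structure. Let $1\le i\le r\le s\le m$. Assume that $\lambda_1=\dots=\lambda_{i-1}=0$, $\lambda_i=\dots=\lambda_r=1$, $\lambda_{r+1}\le\dots\le\lambda_s\le l$ and $\lambda_{s+1}=\dots=\lambda_m=\infty$. Write $\lambda_j=a_1+\dots+a_j$ for $1\le j\le s$, let $I=\{2\le k\le s \mid a_k\ne 0\}$, write $I\cup\{1\}=\{i_1,\dots,i_p\}$ with $i_1>\dots>i_p$, and put $i_0=s+1$. Then $$ [\mathcal{C}_{\lambda}^{l}]=\frac{[\mathrm{GL}_{m}]\cdot[\mathrm{GL}_{n}]\cdot\prod_{j=1}^{p}\left([G(i_{j-1}-i_{j},\,s+1-i_{j})]^{2}\cdot[\mathrm{GL}_{i_{j-1}-i_{j}}]\right)}{[\mathrm{GL}_{s}]^{2}\cdot[\mathrm{GL}_{m-s}]\cdot[\mathrm{GL}_{n-s}]\cdot\mathbb{L}^{\,s^{2}l-(m+n)sl+s(m+n-2s)+\sum_{j=1}^{s}(m+n+1-2j)\lambda_{j}}}, $$ where $G(d,k)$ is the Grassmannian of $d$-dimensional subspaces of a $k$-dimensional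 vector space and $[\mathrm{GL}_0]=1$. Precisely: the identity obtained by multiplying both sides by the denominator on the right holds in $K_0[\mathrm{Var}_{\mathbb C}][\mathbb{L}^{-1}]$, and the identity of ratios holds in the localization of this ring at the classes $[\mathrm{GL}_d]$, $d\ge 0$. -/

import Mathlib

namespace JetOrbit

noncomputable section

open CategoryTheory AlgebraicGeometry Limits

attribute [local instance] Over.cartesianMonoidalCategory Over.braidedCategory

/-! ### Complex varieties and their Grothendieck ring -/

/-- The scheme `Spec ℂ`. -/
abbrev SpecC : Scheme.{0} := Spec (CommRingCat.of ℂ)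

/-- A complex variety is a separated scheme of finite type over `ℂ`
(it is not required to be reduced or irreducible). -/
def IsVariety : ObjectProperty (Over SpecC) := fun X =>
  LocallyOfFiniteType X.hom ∧ QuasiCompact X.hom ∧ IsSeparated X.hom

/-- The category of complex varieties. -/
abbrev Var := IsVariety.FullSubcategory

instance isMonoidal_isVariety : IsVariety.IsMonoidal where
  prop_unit := by
    refine ⟨?_, ?_, ?_⟩ <;> dsimp <;> infer_instance
  prop_tensor := by
    rintro X Y ⟨h1, h2, h3⟩ ⟨h4, h5, h6⟩
    refine ⟨?_, ?_, ?_⟩ <;> rw [Over.tensorObj_hom] <;> infer_instance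

/-- Isomorphism classes of varieties, a commutative monoid under the product over `ℂ`. -/
abbrev IsoClass := Skeleton Var

/-- The free abelian group on the isomorphism classes of varieties, with the multiplication
that extends `[X] * [Y] = [X × Y]` bilinearly. -/
abbrev FreeVar := MonoidAlgebra ℤ IsoClass

/-- The generator of `FreeVar` given by a variety. -/
def freeClass (X : Var) : FreeVar := MonoidAlgebra.of ℤ IsoClass (toSkeleton X)

/-- The relations `[X] = [X_red]` and `[X] = [U] + [X \ U]` for `U` open in `X`. -/
inductive ScissorRel : FreeVar → Prop
  | red (X Y : Var) (i : Y ⟶ X) (hi : IsClosedImmersion i.hom.left)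
      (hs : Function.Surjective i.hom.left) (hr : IsReduced Y.obj.left) :
      ScissorRel (freeClass X - freeClass Y)
  | scissor (X U Z : Var) (j : U ⟶ X) (i : Z ⟶ X) (hj : IsOpenImmersion j.hom.left)
      (hi : IsClosedImmersion i.hom.left)
      (hc : Set.range i.hom.left = (Set.range j.hom.left)ᶜ) :
      ScissorRel (freeClass X - freeClass U - freeClass Z)

/-- The Grothendieck ring of complex varieties. The subgroup generated by the relations is
closed under multiplication by classes of varieties, so that it is the ideal they generate. -/
abbrev K0 := FreeVar ⧸ Ideal.span {x : FreeVar | ScissorRel x}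

/-- The class of a variety in the Grothendieck ring. -/
def K0.cls (X : Var) : K0 := Ideal.Quotient.mk _ (freeClass X)

theorem K0.cls_eq_of_iso {X Y : Var} (e : X ≅ Y) : K0.cls X = K0.cls Y := by
  have h : toSkeleton X = toSkeleton Y := Quotient.sound ⟨e⟩
  rw [K0.cls, K0.cls, freeClass, freeClass, h]

theorem K0.cls_tensor (X Y : Var) :
    K0.cls (MonoidalCategoryStruct.tensorObj X Y) = K0.cls X * K0.cls Y := by
  unfold K0.cls freeClass
  rw [Skeleton.toSkeleton_tensorObj, map_mul, map_mul]

/-! ### Affine and quasi-affine varieties, general linear groups -/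

/-- The spectrum of a finitely generated `ℂ`-algebra as a variety. -/
def specVar (A : Type) [CommRing A] [Algebra ℂ A] [Algebra.FiniteType ℂ A] : Var where
  obj := Over.mk (Spec.map (CommRingCat.ofHom (algebraMap ℂ A)))
  property := by
    refine ⟨?_, ?_, ?_⟩
    · dsimp
      rw [HasRingHomProperty.Spec_iff (P := @LocallyOfFiniteType)]
      exact RingHom.finiteType_algebraMap.mpr inferInstance
    · dsimp; infer_instance
    · dsimp; infer_instance

/-- An open subscheme of a variety whose underlying scheme is Noetherian. -/
def openVar (X : Var) [IsNoetherian X.obj.left] (U : X.obj.left.Opens) : Var where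
  obj := Over.mk (U.ι ≫ X.obj.hom)
  property := by
    obtain ⟨h1, h2, h3⟩ := X.property
    refine ⟨?_, ?_, ?_⟩
    · dsimp; infer_instance
    · dsimp; infer_instance
    · dsimp; infer_instance

/-- The class `𝕃` of the affine line. -/
def lef : K0 := K0.cls (specVar (Polynomial ℂ))

/-- The variety `GL_d`: the spectrum of the polynomial ring in the entries of a generic
`d × d` matrix, localized at its determinant. -/
def GLVar (d : ℕ) : Var :=
  specVar (Localization.Away (Matrix.det (Matrix.mvPolynomialX (Fin d) (Fin d) ℂ)))

/-- The class of `GL_d`. -/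
def glCls (d : ℕ) : K0 := K0.cls (GLVar d)

section QuasiAffine

variable {σ : Type} [Finite σ]

instance isNoetherian_specVar (A : Type) [CommRing A] [Algebra ℂ A] [Algebra.FiniteType ℂ A] :
    IsNoetherian (specVar A).obj.left :=
  have : IsNoetherianRing A := Algebra.FiniteType.isNoetherianRing ℂ A
  inferInstanceAs (IsNoetherian (Spec (CommRingCat.of A)))

/-- The coordinate ring `ℂ[x]/I(S)` of the Zariski closure of a set `S` of points of the affine
space `ℂ^σ`. -/
abbrev coordRing (S : Set (σ → ℂ)) : Type :=
  MvPolynomial σ ℂ ⧸ MvPolynomial.vanishingIdeal ℂ S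

/-- The ideal of `ℂ[x]` of the polynomials that vanish on the points of the Zariski closure of `S`
that do not lie in `S`. -/
def boundaryIdeal (S : Set (σ → ℂ)) : Ideal (MvPolynomial σ ℂ) :=
  MvPolynomial.vanishingIdeal ℂ
    (MvPolynomial.zeroLocus ℂ (MvPolynomial.vanishingIdeal ℂ S) \ S)

/-- A Zariski locally closed set `S ⊆ ℂ^σ` as a reduced variety: the open subscheme of
`Spec ℂ[x]/I(S)` that is the complement of the closed set `closure S \ S`. -/
def locallyClosedVar (S : Set (σ → ℂ)) : Var :=
  openVar (specVar (coordRing S))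
    (⟨(PrimeSpectrum.zeroLocus
        (Ideal.Quotient.mk (MvPolynomial.vanishingIdeal ℂ S) '' boundaryIdeal S))ᶜ,
      (PrimeSpectrum.isClosed_zeroLocus _).isOpen_compl⟩ :
      TopologicalSpace.Opens (PrimeSpectrum (coordRing S)))

end QuasiAffine

/-! ### Grassmannians -/

section Grassmannian

variable (d k : ℕ)

attribute [local instance] MvPolynomial.gradedAlgebra

/-- Index set of the maximal minors of a `d × k` matrix: the `d`-element sets of columns. -/
abbrev MinorIdx := Fin d ↪o Fin k

/-- The algebra map from the polynomial ring in the Plücker coordinates that sends each of them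
to the corresponding maximal minor of the generic `d × k` matrix. -/
def pluckerHom : MvPolynomial (MinorIdx d k) ℂ →ₐ[ℂ] MvPolynomial (Fin d × Fin k) ℂ :=
  MvPolynomial.aeval fun I =>
    ((Matrix.mvPolynomialX (Fin d) (Fin k) ℂ).submatrix id I).det

/-- The projective space on the Plücker coordinates. -/
abbrev PluckerSpace : Scheme.{0} :=
  Proj (MvPolynomial.homogeneousSubmodule (MinorIdx d k) ℂ)

/-- The structure morphism of the Plücker space. -/
def pluckerSpaceHom : PluckerSpace d k ⟶ SpecC :=
  Proj.toSpecZero (MvPolynomial.homogeneousSubmodule (MinorIdx d k) ℂ) ≫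
    Spec.map (CommRingCat.ofHom
      (algebraMap ℂ (MvPolynomial.homogeneousSubmodule (MinorIdx d k) ℂ 0)))

/-- The closed subset of the Plücker space that is cut out by all homogeneous polynomial relations
between the maximal minors of a `d × k` matrix. -/
def pluckerLocus : TopologicalSpace.Closeds (PluckerSpace d k) :=
  ⟨ProjectiveSpectrum.zeroLocus (MvPolynomial.homogeneousSubmodule (MinorIdx d k) ℂ)
      {f | (∃ e, f ∈ MvPolynomial.homogeneousSubmodule (MinorIdx d k) ℂ e) ∧
        pluckerHom d k f = 0},
    ProjectiveSpectrum.isClosed_zeroLocus _ _⟩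

instance finiteType_degreeZero :
    Algebra.FiniteType ℂ (MvPolynomial.homogeneousSubmodule (MinorIdx d k) ℂ 0) := by
  have hs : Function.Surjective
      (algebraMap ℂ (MvPolynomial.homogeneousSubmodule (MinorIdx d k) ℂ 0)) := by
    rintro ⟨p, hp⟩
    refine ⟨p.coeff 0, Subtype.ext ?_⟩
    have h0 : p.totalDegree = 0 := by
      rw [MvPolynomial.mem_homogeneousSubmodule] at hp
      exact Nat.le_zero.mp hp.totalDegree_le
    exact (MvPolynomial.totalDegree_eq_zero_iff_eq_C.mp h0).symm
  have : Module.Finite ℂ (MvPolynomial.homogeneousSubmodule (MinorIdx d k) ℂ 0) :=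
    Module.Finite.of_surjective
      (Algebra.linearMap ℂ (MvPolynomial.homogeneousSubmodule (MinorIdx d k) ℂ 0)) hs
  infer_instance

instance finiteType_overDegreeZero :
    Algebra.FiniteType (MvPolynomial.homogeneousSubmodule (MinorIdx d k) ℂ 0)
      (MvPolynomial (MinorIdx d k) ℂ) :=
  have : IsScalarTower ℂ (MvPolynomial.homogeneousSubmodule (MinorIdx d k) ℂ 0)
      (MvPolynomial (MinorIdx d k) ℂ) :=
    IsScalarTower.of_algebraMap_eq (R := ℂ)
      (S := MvPolynomial.homogeneousSubmodule (MinorIdx d k) ℂ 0)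
      (A := MvPolynomial (MinorIdx d k) ℂ) fun _ => rfl
  Algebra.FiniteType.of_restrictScalars_finiteType ℂ _ _

/-- The Grassmannian `G(d, k)` of `d`-dimensional subspaces of a `k`-dimensional vector space, in
its Plücker embedding: the reduced closed subscheme on the locus of the Plücker relations. -/
def Gr : Var where
  obj := Over.mk
    ((Scheme.IdealSheafData.vanishingIdeal (pluckerLocus d k)).subschemeι ≫ pluckerSpaceHom d k)
  property := by
    have : LocallyOfFiniteType (Spec.map (CommRingCat.ofHom
        (algebraMap ℂ (MvPolynomial.homogeneousSubmodule (MinorIdx d k) ℂ 0)))) := by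
      rw [HasRingHomProperty.Spec_iff (P := @LocallyOfFiniteType)]
      exact RingHom.finiteType_algebraMap.mpr inferInstance
    unfold pluckerSpaceHom
    refine ⟨?_, ?_, ?_⟩ <;> dsimp <;> infer_instance

/-- The class of the Grassmannian `G(d, k)`. -/
def grCls : K0 := K0.cls (Gr d k)

end Grassmannian

/-! ### Jets of matrices and their orbits -/

section Jets

variable (m n l : ℕ)

/-- The ring `ℂ[t]/(t^(l+1))`. -/
abbrev JetRing : Type := Polynomial ℂ ⧸ Ideal.span {(Polynomial.X : Polynomial ℂ) ^ (l + 1)}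

/-- The coordinates of the space of `l`-jets of `m × n` matrices: the coefficient of `t^k`
in the entry `(i, j)` has index `(i, j, k)`. -/
abbrev JetIdx := Fin m × Fin n × Fin (l + 1)

variable {m n l}

/-- The class of `t` in the jet ring. -/
def jetT : JetRing l := Ideal.Quotient.mk _ Polynomial.X

/-- The power `t^c`, where `t^∞ = 0`. -/
def tPow (c : ℕ∞) : JetRing l := if c = ⊤ then 0 else jetT ^ c.toNat

/-- The `ℂ[t]/(t^(l+1))`-valued matrix with entries `∑_k a_{i,j,k} t^k`. -/
def jetMatrix (a : JetIdx m n l → ℂ) : Matrix (Fin m) (Fin n) (JetRing l) :=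
  Matrix.of fun i j => ∑ k : Fin (l + 1), algebraMap ℂ (JetRing l) (a (i, j, k)) * jetT ^ (k : ℕ)

/-- The matrix `δ_λ` with diagonal entries `t^{λ_1}, …, t^{λ_m}` and zeros elsewhere; `lam` is
indexed from `1`. -/
def deltaMatrix (lam : ℕ → ℕ∞) : Matrix (Fin m) (Fin n) (JetRing l) :=
  Matrix.of fun i j => if (i : ℕ) = j then tPow (lam (i + 1)) else 0

/-- The points of the orbit `C_λ^l = {g δ_λ h⁻¹}` of the group
`GL_m(ℂ[t]/(t^(l+1))) × GL_n(ℂ[t]/(t^(l+1)))` in the space of `l`-jets of `m × n` matrices. -/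
def orbitPoints (m n l : ℕ) (lam : ℕ → ℕ∞) : Set (JetIdx m n l → ℂ) :=
  {a | ∃ (g : GL (Fin m) (JetRing l)) (h : GL (Fin n) (JetRing l)),
    jetMatrix a =
      g.val * (deltaMatrix lam : Matrix (Fin m) (Fin n) (JetRing l)) * (h⁻¹).val}

/-- The class of the orbit `C_λ^l`; an orbit of an algebraic group action is locally closed and
carries the reduced structure. -/
def orbitCls (m n l : ℕ) (lam : ℕ → ℕ∞) : K0 :=
  K0.cls (locallyClosedVar (orbitPoints m n l lam))

end Jets

/-! ### Localizations of the Grothendieck ring -/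

/-- The Grothendieck ring localized at `𝕃`. -/
abbrev K0L := Localization.Away lef

/-- The map from the Grothendieck ring to its localization at `𝕃`. -/
abbrev toK0L : K0 →+* K0L := algebraMap K0 K0L

/-- `𝕃` as a unit of `K0L`. -/
def lefUnit : K0Lˣ := (IsLocalization.Away.algebraMap_isUnit (S := K0L) lef).unit

/-- The multiplicative set generated by the classes of all `GL_d`. -/
abbrev glSubmonoid : Submonoid K0L := Submonoid.closure (Set.range fun d => toK0L (glCls d))

/-- The localization of `K0L` at the classes of all `GL_d`. -/
abbrev K0GL := Localization glSubmonoid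

/-- The map from the Grothendieck ring to its localization at `𝕃` and all `[GL_d]`. -/
abbrev toK0GL : K0 →+* K0GL := (algebraMap K0L K0GL).comp toK0L

/-- `[GL_d]` as a unit of `K0GL`. -/
def glUnit (d : ℕ) : K0GLˣ :=
  (IsLocalization.map_units K0GL
    (⟨toK0L (glCls d), Submonoid.subset_closure ⟨d, rfl⟩⟩ : glSubmonoid)).unit

/-- `𝕃` as a unit of `K0GL`. -/
def lefUnitGL : K0GLˣ := Units.map (algebraMap K0L K0GL).toMonoidHom lefUnit

/-- The exponent `s²l - (m+n)sl + s(m+n-2s) + ∑_{j=1}^s (m+n+1-2j) λ_j`. -/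
def lefExponent (m n l s : ℕ) (lam : ℕ → ℕ∞) : ℤ :=
  (s : ℤ) ^ 2 * l - ((m : ℤ) + n) * s * l + (s : ℤ) * ((m : ℤ) + n - 2 * s) +
    ∑ j ∈ Finset.Icc 1 s, ((m : ℤ) + n + 1 - 2 * j) * ((lam j).toNat : ℤ)

/-- The numerator
`[GL_m] [GL_n] ∏_{j=1}^p [G(i_{j-1} - i_j, s + 1 - i_j)]² [GL_{i_{j-1} - i_j}]`. -/
def orbitNumerator (m n s p : ℕ) (idx : ℕ → ℕ) : K0 :=
  glCls m * glCls n *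
    ∏ j ∈ Finset.Icc 1 p,
      grCls (idx (j - 1) - idx j) (s + 1 - idx j) ^ 2 * glCls (idx (j - 1) - idx j)

end

end JetOrbit

/-! The orbit is computed by Gaussian elimination, one power of `t` at a time. Over the local ring
`ℂ[t]/(t^(N+1))`, a matrix equivalent to `diag(1_k, T)`, where `T` vanishes modulo `t`, has
reduction of rank `k`. Let `(P, Q)` be the lexicographically first rows and columns with a nonzero
`k × k` minor of the reduction. Relative to it the matrix is, in a unique way, `(B, BY; XB, XBY +
D)` with `B` invertible, and it lies in the orbit exactly when the Schur complement `D` is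
equivalent to `T` (`fromBlocks_mem_equivOrbit_iff`). Minors of the reduction factor as (minor of
`X`) · `det B` · (minor of `Y`), so minimality of `(P, Q)` says that `X` and the transpose of `Y`
reduce to points of cells of two Grassmannians. Summing over the strata gives (`mu_blockOrbit`)
[orbit] = [GL_k] · 𝕃^((k² + mk + kn)N) · [G(k, k+m)] · [G(k, k+n)] · [orbit of T].

Division by `t` identifies the orbit of `T` with an orbit over `ℂ[t]/(t^N)` whose exponents are
smaller by one (`truncOrbit_step`). The recursion ends at the zero ring. The successive `k` are the
multiplicities of the values `0, …, l` among the finite exponents; infinite exponents are replaced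
by `l + 1`, which no step reaches. The nonzero multiplicities are the differences `i_{j-1} - i_j`.

The closed formula uses the same elimination inside `GL_{k+m}`, which yields [GL_{k+m}] = [G(k,
k+m)] [GL_k] [GL_m] 𝕃^(km) (`cellSum_mul_glCls`). Applied to the sizes `m`, `n` and `s`, it trades
the Grassmannians of the recursion for general linear groups and for the Grassmannians inside an
`s`-dimensional space (`truncOrbit_formula`).

All computations in the Grothendieck ring are made with sets of points of finite-dimensional vector
spaces: `mu S` is the class of the Zariski closure minus the class of the closure of the boundary.
On locally closed sets it is additive (`mu_eq_add`), multiplicative (`mu_prod`) and invariant under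
mutually inverse regular maps (`mu_congr`); the Nullstellensatz connects points with schemes. For
the Grassmannian, a subscheme of projective space, the locus where a given Plücker coordinate is the
first nonzero one is identified with a cell by explicit relations (`adjacentRel_mem`,
`kap_chart_plucker`). -/

namespace JetOrbit

noncomputable section

open CategoryTheory AlgebraicGeometry Limits

attribute [local instance] Over.cartesianMonoidalCategory Over.braidedCategory

set_option linter.unusedSectionVars false

/-! ### Classes of affine varieties -/

theorem K0.cls_eq_of_red {X Y : Var} (i : Y ⟶ X) (hi : IsClosedImmersion i.hom.left)
    (hs : Function.Surjective i.hom.left) (hr : IsReduced Y.obj.left) : K0.cls X = K0.cls Y := by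
  rw [← sub_eq_zero, K0.cls, K0.cls, ← map_sub]
  exact Ideal.Quotient.eq_zero_iff_mem.mpr (Ideal.subset_span (ScissorRel.red X Y i hi hs hr))

theorem K0.cls_eq_add {X U Z : Var} (j : U ⟶ X) (i : Z ⟶ X) (hj : IsOpenImmersion j.hom.left)
    (hi : IsClosedImmersion i.hom.left)
    (hc : Set.range i.hom.left = (Set.range j.hom.left)ᶜ) :
    K0.cls X = K0.cls U + K0.cls Z := by
  rw [← sub_eq_zero, ← sub_sub, K0.cls, K0.cls, K0.cls, ← map_sub, ← map_sub]
  exact Ideal.Quotient.eq_zero_iff_mem.mpr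
    (Ideal.subset_span (ScissorRel.scissor X U Z j i hj hi hc))

/-- An empty `X` is both open in itself and its own closed complement, so the scissor relation reads
`[X] = [X] + [X]`. -/
theorem K0.cls_eq_zero_of_isEmpty (X : Var) [IsEmpty X.obj.left] : K0.cls X = 0 := by
  have h := K0.cls_eq_add (𝟙 X) (𝟙 X) (by simp; infer_instance) (by simp; infer_instance)
    (by
      ext x
      exact isEmptyElim (α := X.obj.left) x)
  simpa using h

variable {A B C : Type} [CommRing A] [Algebra ℂ A] [Algebra.FiniteType ℂ A]
  [CommRing B] [Algebra ℂ B] [Algebra.FiniteType ℂ B]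
  [CommRing C] [Algebra ℂ C] [Algebra.FiniteType ℂ C]

/-- The morphism of varieties given by a homomorphism of finitely generated algebras. -/
def specVarMap (f : A →ₐ[ℂ] B) : specVar B ⟶ specVar A :=
  ObjectProperty.homMk (Over.homMk (Spec.map (CommRingCat.ofHom f.toRingHom)) (by
    simp only [specVar, Over.mk_hom]
    rw [← Spec.map_comp, ← CommRingCat.ofHom_comp]
    congr 2
    exact f.comp_algebraMap))

theorem K0.cls_specVar_congr (e : A ≃ₐ[ℂ] B) : K0.cls (specVar A) = K0.cls (specVar B) := by
  let i : Spec (CommRingCat.of A) ≅ Spec (CommRingCat.of B) :=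
    { hom := Spec.map (CommRingCat.ofHom e.symm.toRingHom)
      inv := Spec.map (CommRingCat.ofHom e.toRingHom)
      hom_inv_id := by
        rw [← Spec.map_comp, ← CommRingCat.ofHom_comp, ← Spec.map_id]
        congr 1
        ext x
        exact e.symm_apply_apply x
      inv_hom_id := by
        rw [← Spec.map_comp, ← CommRingCat.ofHom_comp, ← Spec.map_id]
        congr 1
        ext x
        exact e.apply_symm_apply x }
  refine K0.cls_eq_of_iso (ObjectProperty.isoMk _ (Over.isoMk i ?_))
  change Spec.map _ ≫ Spec.map _ = Spec.map _
  rw [← Spec.map_comp, ← CommRingCat.ofHom_comp]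
  congr 2
  exact e.symm.toAlgHom.comp_algebraMap

instance finiteType_tensorProduct : Algebra.FiniteType ℂ (TensorProduct ℂ A B) :=
  Algebra.FiniteType.trans (S := A) inferInstance inferInstance

open TensorProduct in
theorem K0.cls_specVar_tensor :
    K0.cls (specVar (A ⊗[ℂ] B)) = K0.cls (specVar A) * K0.cls (specVar B) := by
  rw [← K0.cls_tensor]
  refine K0.cls_eq_of_iso (ObjectProperty.isoMk _ (Over.isoMk (pullbackSpecIso ℂ A B).symm ?_))
  have h : (pullbackSpecIso ℂ A B).inv ≫ pullback.fst _ _ ≫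
      Spec.map (CommRingCat.ofHom (algebraMap ℂ A)) =
      Spec.map (CommRingCat.ofHom (algebraMap ℂ (A ⊗[ℂ] B))) := by
    rw [pullbackSpecIso_inv_fst_assoc, ← Spec.map_comp, ← CommRingCat.ofHom_comp]
  exact h

theorem range_specVarMap_of_surjective (f : A →ₐ[ℂ] B) (hf : Function.Surjective f) :
    Set.range (specVarMap f).hom.left = PrimeSpectrum.zeroLocus (RingHom.ker f : Set A) :=
  range_comap_of_surjective _ f.toRingHom hf

theorem isClosedImmersion_specVarMap (f : A →ₐ[ℂ] B) (hf : Function.Surjective f) :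
    IsClosedImmersion (specVarMap f).hom.left :=
  IsClosedImmersion.spec_of_surjective _ hf

/-- The scissor relation only looks at underlying sets. So `C` may be any closed subscheme supported
on `a = 0`, and `hker` says that its ideal lies in the radical of `(a)`. -/
theorem K0.cls_specVar_away (a : A) (f : A →ₐ[ℂ] B)
    (hB : let _ := f.toRingHom.toAlgebra; IsLocalization.Away a B)
    (g : A →ₐ[ℂ] C) (hg : Function.Surjective g) (ha : g a = 0)
    (hker : ∀ x, g x = 0 → ∃ n : ℕ, a ∣ x ^ n) :
    K0.cls (specVar A) = K0.cls (specVar B) + K0.cls (specVar C) := by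
  let _ := f.toRingHom.toAlgebra
  refine K0.cls_eq_add (specVarMap f) (specVarMap g) ?_ (isClosedImmersion_specVarMap g hg) ?_
  · exact IsOpenImmersion.of_isLocalization (S := B) a
  · rw [range_specVarMap_of_surjective g hg]
    have h1 : Set.range (specVarMap f).hom.left =
        ((PrimeSpectrum.basicOpen a : TopologicalSpace.Opens _) : Set (PrimeSpectrum A)) :=
      PrimeSpectrum.localization_away_comap_range B a
    rw [h1, PrimeSpectrum.basicOpen_eq_zeroLocus_compl]
    refine Eq.trans ?_ (compl_compl (PrimeSpectrum.zeroLocus {a} : Set (PrimeSpectrum A))).symm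
    apply Set.Subset.antisymm
    · intro x hx
      rw [PrimeSpectrum.mem_zeroLocus] at hx ⊢
      exact Set.singleton_subset_iff.mpr (hx ha)
    · intro x hx
      rw [PrimeSpectrum.mem_zeroLocus] at hx ⊢
      intro y hy
      obtain ⟨n, hn⟩ := hker y hy
      exact x.2.mem_of_pow_mem n (Ideal.mem_of_dvd _ hn (hx rfl))

theorem K0.cls_openVar_specVar (g : A →ₐ[ℂ] C) (hg : Function.Surjective g)
    (U : TopologicalSpace.Opens (PrimeSpectrum A))
    (hU : (U : Set (PrimeSpectrum A)) = (PrimeSpectrum.zeroLocus (RingHom.ker g : Set A))ᶜ) :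
    K0.cls (openVar (specVar A) U) = K0.cls (specVar A) - K0.cls (specVar C) := by
  rw [eq_sub_iff_add_eq, eq_comm]
  let U' : (specVar A).obj.left.Opens := U
  let j : openVar (specVar A) U ⟶ specVar A := ObjectProperty.homMk (Over.homMk U'.ι rfl)
  refine K0.cls_eq_add j (specVarMap g) (inferInstanceAs (IsOpenImmersion U'.ι))
    (isClosedImmersion_specVarMap g hg) ?_
  rw [range_specVarMap_of_surjective g hg]
  have : Set.range j.hom.left = (U : Set (PrimeSpectrum A)) := Scheme.Opens.range_ι U'
  rw [this, hU]
  exact (compl_compl (PrimeSpectrum.zeroLocus (RingHom.ker g : Set A))).symm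

/-! ### Polynomial functions on finite-dimensional vector spaces -/

section PolyFun

variable (E : Type) {F G : Type} [AddCommGroup E] [Module ℂ E] [AddCommGroup F] [Module ℂ F]
  [AddCommGroup G] [Module ℂ G]

/-- The algebra of polynomial functions on a complex vector space. -/
def polyFun : Subalgebra ℂ (E → ℂ) :=
  Algebra.adjoin ℂ (Set.range fun φ : Module.Dual ℂ E => (φ : E → ℂ))

variable {E}

theorem polyFun_dual (φ : Module.Dual ℂ E) : (fun x => φ x) ∈ polyFun E :=
  Algebra.subset_adjoin ⟨φ, rfl⟩

theorem polyFun_const (c : ℂ) : (fun _ : E => c) ∈ polyFun E :=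
  (polyFun E).algebraMap_mem c

theorem polyFun_mul {p q : E → ℂ} (hp : p ∈ polyFun E) (hq : q ∈ polyFun E) :
    (fun x => p x * q x) ∈ polyFun E := (polyFun E).mul_mem hp hq

theorem polyFun_add {p q : E → ℂ} (hp : p ∈ polyFun E) (hq : q ∈ polyFun E) :
    (fun x => p x + q x) ∈ polyFun E := (polyFun E).add_mem hp hq

theorem polyFun_sub {p q : E → ℂ} (hp : p ∈ polyFun E) (hq : q ∈ polyFun E) :
    (fun x => p x - q x) ∈ polyFun E := (polyFun E).sub_mem hp hq

theorem polyFun_pow {p : E → ℂ} (hp : p ∈ polyFun E) (n : ℕ) :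
    (fun x => p x ^ n) ∈ polyFun E := (polyFun E).pow_mem hp n

/-- A map between vector spaces is polynomial if its coordinates are polynomial functions. -/
def PolyMap (f : E → F) : Prop := ∀ φ : Module.Dual ℂ F, (fun x => φ (f x)) ∈ polyFun E

theorem PolyMap.comp_mem {f : E → F} (hf : PolyMap f) {p : F → ℂ} (hp : p ∈ polyFun F) :
    (fun x => p (f x)) ∈ polyFun E := by
  induction hp using Algebra.adjoin_induction with
  | mem p hp => obtain ⟨φ, rfl⟩ := hp; exact hf φ
  | algebraMap r => exact polyFun_const r
  | add p q _ _ h1 h2 => exact polyFun_add h1 h2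
  | mul p q _ _ h1 h2 => exact polyFun_mul h1 h2

theorem PolyMap.comp {g : F → G} {f : E → F} (hg : PolyMap g) (hf : PolyMap f) :
    PolyMap (fun x => g (f x)) := fun φ => hf.comp_mem (hg φ)

theorem polyMap_linear (f : E →ₗ[ℂ] F) : PolyMap (fun x => f x) := fun φ =>
  polyFun_dual (φ ∘ₗ f)

theorem polyMap_id : PolyMap (fun x : E => x) := polyMap_linear LinearMap.id

theorem polyMap_fst : PolyMap (fun x : E × F => x.1) := polyMap_linear (LinearMap.fst ℂ E F)

theorem polyMap_snd : PolyMap (fun x : E × F => x.2) := polyMap_linear (LinearMap.snd ℂ E F)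

theorem PolyMap.prodMk {f : E → F} {g : E → G} (hf : PolyMap f) (hg : PolyMap g) :
    PolyMap (fun x => (f x, g x)) := fun φ => by
  have h : (fun x => φ (f x, g x)) = fun x => (φ ∘ₗ LinearMap.inl ℂ F G) (f x) +
      (φ ∘ₗ LinearMap.inr ℂ F G) (g x) := by
    ext x
    simp only [LinearMap.comp_apply, LinearMap.inl_apply, LinearMap.inr_apply, ← map_add]
    simp
  rw [h]
  exact polyFun_add (hf _) (hg _)

theorem PolyMap.mem {p : E → ℂ} (hp : PolyMap p) : p ∈ polyFun E := hp LinearMap.id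

end PolyFun

/-! ### Zariski closed sets and regular functions on them -/

section Zariski

variable {E F : Type} [AddCommGroup E] [Module ℂ E] [AddCommGroup F] [Module ℂ F]

/-- The Zariski closure of a set of points. -/
def zcl (S : Set E) : Set E := {x | ∀ p ∈ polyFun E, (∀ y ∈ S, p y = 0) → p x = 0}

/-- Zariski closed sets of points. -/
def ZClosed (V : Set E) : Prop := zcl V ⊆ V

theorem subset_zcl (S : Set E) : S ⊆ zcl S := fun x hx _ _ h => h x hx

theorem zcl_mono {S T : Set E} (h : S ⊆ T) : zcl S ⊆ zcl T :=
  fun _ hx p hp hT => hx p hp fun y hy => hT y (h hy)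

theorem zClosed_zcl (S : Set E) : ZClosed (zcl S) :=
  fun _ hx p hp hS => hx p hp fun _ hy => hy p hp hS

theorem ZClosed.zcl_subset {S V : Set E} (hV : ZClosed V) (h : S ⊆ V) : zcl S ⊆ V :=
  (zcl_mono h).trans hV

theorem ZClosed.inter {V W : Set E} (hV : ZClosed V) (hW : ZClosed W) : ZClosed (V ∩ W) :=
  fun _ hx => ⟨hV.zcl_subset Set.inter_subset_left hx, hW.zcl_subset Set.inter_subset_right hx⟩

theorem ZClosed.iInter {ι : Sort*} {V : ι → Set E} (hV : ∀ i, ZClosed (V i)) :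
    ZClosed (⋂ i, V i) :=
  fun _ hx => Set.mem_iInter.mpr fun i => (hV i).zcl_subset (Set.iInter_subset V i) hx

theorem zClosed_setOf_eq_zero {p : E → ℂ} (hp : p ∈ polyFun E) : ZClosed {x | p x = 0} :=
  fun _ hx => hx p hp fun _ hy => hy

theorem zClosed_univ : ZClosed (Set.univ : Set E) := Set.subset_univ _

theorem zClosed_empty : ZClosed (∅ : Set E) := fun _ hx =>
  one_ne_zero (hx (fun _ => 1) (polyFun_const 1) (fun _ h => h.elim))

theorem ZClosed.union {V W : Set E} (hV : ZClosed V) (hW : ZClosed W) : ZClosed (V ∪ W) := by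
  intro x hx
  by_contra hn
  have h1 : x ∉ zcl V := fun h => hn (Or.inl (hV h))
  have h2 : x ∉ zcl W := fun h => hn (Or.inr (hW h))
  simp only [zcl, Set.mem_ofPred_eq, not_forall] at h1 h2
  obtain ⟨p, hp, hpV, hpx⟩ := h1
  obtain ⟨q, hq, hqW, hqx⟩ := h2
  refine mul_ne_zero hpx hqx (hx _ (polyFun_mul hp hq) ?_)
  rintro y (hy | hy)
  · simp [hpV y hy]
  · simp [hqW y hy]

theorem ZClosed.preimage {V : Set F} (hV : ZClosed V) {f : E → F} (hf : PolyMap f) :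
    ZClosed (f ⁻¹' V) := fun _ hx =>
  hV fun _ hp h => hx _ (hf.comp_mem hp) fun y hy => h (f y) hy

theorem ZClosed.prod {V : Set E} {W : Set F} (hV : ZClosed V) (hW : ZClosed W) :
    ZClosed (V ×ˢ W) :=
  (hV.preimage polyMap_fst).inter (hW.preimage polyMap_snd)

/-- The restriction of functions to a set of points. -/
def restrictHom (S : Set E) : (E → ℂ) →ₐ[ℂ] (S → ℂ) :=
  AlgHom.pi fun x : S => Pi.evalAlgHom ℂ (fun _ : E => ℂ) (x : E)

/-- The algebra of the restrictions of polynomial functions to a set of points. -/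
def reg (S : Set E) : Subalgebra ℂ (S → ℂ) := (polyFun E).map (restrictHom S)

theorem mem_reg {S : Set E} {f : S → ℂ} : f ∈ reg S ↔ ∃ p ∈ polyFun E, ∀ x : S, p x = f x := by
  constructor
  · rintro ⟨p, hp, rfl⟩
    exact ⟨p, hp, fun _ => rfl⟩
  · rintro ⟨p, hp, h⟩
    exact ⟨p, hp, funext h⟩

theorem restrict_mem_reg (S : Set E) {p : E → ℂ} (hp : p ∈ polyFun E) :
    (fun x : S => p x) ∈ reg S := mem_reg.mpr ⟨p, hp, fun _ => rfl⟩

/-- The pullback of regular functions along the restriction of a polynomial map. -/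
def regComap {S : Set E} {T : Set F} (f : E → F) (hf : PolyMap f) (h : Set.MapsTo f S T) :
    reg T →ₐ[ℂ] reg S :=
  ((AlgHom.pi fun x : S =>
    Pi.evalAlgHom ℂ (fun _ : T => ℂ) ⟨f x, h x.2⟩).comp (reg T).val).codRestrict (reg S) (by
    rintro ⟨r, hr⟩
    obtain ⟨p, hp, hpr⟩ := mem_reg.mp hr
    exact mem_reg.mpr ⟨_, hf.comp_mem hp, fun x => hpr ⟨f x, h x.2⟩⟩)

theorem polyFun_eq_adjoin_basis {ι : Type*} [Finite ι] (b : Module.Basis ι ℂ E) :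
    polyFun E = Algebra.adjoin ℂ (Set.range fun i => (b.coord i : E → ℂ)) := by
  have := Fintype.ofFinite ι
  apply le_antisymm
  · refine Algebra.adjoin_le ?_
    rintro _ ⟨φ, rfl⟩
    have h : (fun x => φ x) = ∑ i, φ (b i) • (fun x => b.coord i x) := by
      ext x
      conv_lhs => rw [← b.sum_repr x, map_sum]
      rw [Finset.sum_apply]
      exact Finset.sum_congr rfl fun i _ => by
        rw [map_smul, smul_eq_mul, mul_comm]; rfl
    change (fun x => φ x) ∈ _
    rw [h]
    exact Subalgebra.sum_mem _ fun i _ =>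
      Subalgebra.smul_mem _ (Algebra.subset_adjoin (Set.mem_range_self i)) _
  · refine Algebra.adjoin_mono ?_
    rintro _ ⟨i, rfl⟩
    exact ⟨b.coord i, rfl⟩

theorem fg_polyFun [Module.Finite ℂ E] : (polyFun E).FG := by
  rw [polyFun_eq_adjoin_basis (Module.finBasis ℂ E)]
  exact Subalgebra.fg_def.mpr ⟨_, Set.finite_range _, rfl⟩

instance finiteType_polyFun [Module.Finite ℂ E] : Algebra.FiniteType ℂ (polyFun E) :=
  (polyFun E).fg_iff_finiteType.mp fg_polyFun

instance finiteType_reg [Module.Finite ℂ E] (S : Set E) : Algebra.FiniteType ℂ (reg S) :=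
  (reg S).fg_iff_finiteType.mp (fg_polyFun.map _)

end Zariski

/-! ### Nullstellensatz and classes of closed sets -/

section Kap

variable {E F : Type} [AddCommGroup E] [Module ℂ E] [AddCommGroup F] [Module ℂ F]

theorem mem_polyFun_iff_basis {ι : Type*} [Finite ι] (b : Module.Basis ι ℂ E) {p : E → ℂ} :
    p ∈ polyFun E ↔
      ∃ P : MvPolynomial ι ℂ, ∀ x, p x = MvPolynomial.eval (fun i => b.coord i x) P := by
  rw [polyFun_eq_adjoin_basis b, Algebra.adjoin_range_eq_range_aeval]
  have key : ∀ (P : MvPolynomial ι ℂ) (x : E),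
      MvPolynomial.aeval (fun i => (b.coord i : E → ℂ)) P x =
        MvPolynomial.eval (fun i => b.coord i x) P := by
    intro P x
    induction P using MvPolynomial.induction_on with
    | C a => simp
    | add p q hp hq => rw [map_add, map_add, Pi.add_apply, hp, hq]
    | mul_X p i hp => rw [map_mul, map_mul, Pi.mul_apply, hp]; simp
  constructor
  · rintro ⟨P, rfl⟩
    exact ⟨P, key P⟩
  · rintro ⟨P, h⟩
    exact ⟨P, funext fun x => (key P x).trans (h x).symm⟩

/-- Hilbert's Nullstellensatz for polynomial functions on a closed set. -/
theorem exists_pow_eq_mul_of_vanish [Module.Finite ℂ E] {V : Set E} (hV : ZClosed V) {q f : E → ℂ}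
    (hq : q ∈ polyFun E) (hf : f ∈ polyFun E) (h : ∀ x ∈ V, q x = 0 → f x = 0) :
    ∃ n : ℕ, ∃ r ∈ polyFun E, ∀ x ∈ V, f x ^ n = q x * r x := by
  let b := Module.finBasis ℂ E
  let e : E → (Fin (Module.finrank ℂ E) → ℂ) := fun x i => b.coord i x
  have he : Function.Surjective e := fun y => ⟨b.equivFun.symm y, by
    ext i
    exact congrFun (b.equivFun.apply_symm_apply y) i⟩
  obtain ⟨Q, hQ⟩ := (mem_polyFun_iff_basis b).mp hq
  obtain ⟨P, hP⟩ := (mem_polyFun_iff_basis b).mp hf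
  -- As `V` is closed, every zero of `I` is a point of `V` where `q` vanishes, hence a zero of `P`.
  -- So a power of `P` lies in `I`, and its part in the ideal of `V` disappears on `V`.
  let I := MvPolynomial.vanishingIdeal ℂ (e '' V) ⊔ Ideal.span {Q}
  have hmem : P ∈ MvPolynomial.vanishingIdeal ℂ (MvPolynomial.zeroLocus ℂ I) := by
    rw [MvPolynomial.mem_vanishingIdeal_iff]
    intro y hy
    obtain ⟨x, rfl⟩ := he y
    rw [MvPolynomial.mem_zeroLocus_iff] at hy
    have h1 : x ∈ V := by
      refine hV fun p hp hpV => ?_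
      obtain ⟨R, hR⟩ := (mem_polyFun_iff_basis b).mp hp
      have := hy R (Ideal.mem_sup_left (by
        rw [MvPolynomial.mem_vanishingIdeal_iff]
        rintro _ ⟨z, hz, rfl⟩
        exact (hR z).symm.trans (hpV z hz)))
      exact (hR x).trans this
    have h2 : q x = 0 := (hQ x).trans
      (hy Q (Ideal.mem_sup_right (Ideal.mem_span_singleton_self Q)))
    exact (hP x).symm.trans (h x h1 h2)
  rw [MvPolynomial.vanishingIdeal_zeroLocus_eq_radical] at hmem
  obtain ⟨n, hn⟩ := hmem
  obtain ⟨A, hA, B, hB, hAB⟩ := Submodule.mem_sup.mp hn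
  obtain ⟨R, rfl⟩ := Ideal.mem_span_singleton.mp hB
  refine ⟨n, fun x => MvPolynomial.eval (e x) R, (mem_polyFun_iff_basis b).mpr ⟨R, fun _ => rfl⟩,
    fun x hx => ?_⟩
  rw [hP x, hQ x, ← map_pow, ← hAB, map_add, map_mul]
  have : MvPolynomial.eval (e x) A = 0 :=
    (MvPolynomial.mem_vanishingIdeal_iff.mp hA) (e x) ⟨x, hx, rfl⟩
  change MvPolynomial.eval (e x) A + _ = _
  rw [this, zero_add]

/-- The class of the Zariski closure of a set of points. -/
def kap [Module.Finite ℂ E] (S : Set E) : K0 := K0.cls (specVar (reg S))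

variable [Module.Finite ℂ E] [Module.Finite ℂ F]

/-- Elements of `reg` are functions on the points, so it suffices that the maps are inverse to each
other on `S` and `T`, not on the ambient spaces. -/
theorem kap_congr {S : Set E} {T : Set F} (f : E → F) (g : F → E) (hf : PolyMap f)
    (hg : PolyMap g) (hfS : Set.MapsTo f S T) (hgT : Set.MapsTo g T S)
    (hgf : ∀ x ∈ S, g (f x) = x) (hfg : ∀ y ∈ T, f (g y) = y) : kap S = kap T := by
  refine K0.cls_specVar_congr (AlgEquiv.ofAlgHom (regComap g hg hgT) (regComap f hf hfS) ?_ ?_)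
  · ext r x
    change r.1 ⟨f (g x), _⟩ = r.1 x
    exact congrArg r.1 (Subtype.ext (hfg x x.2))
  · ext r x
    change r.1 ⟨g (f x), _⟩ = r.1 x
    exact congrArg r.1 (Subtype.ext (hgf x x.2))

theorem regComap_id_surjective {S T : Set E} (h : T ⊆ S) :
    Function.Surjective (regComap (fun x => x) polyMap_id h : reg S →ₐ[ℂ] reg T) := by
  rintro ⟨r, hr⟩
  obtain ⟨p, hp, hpr⟩ := mem_reg.mp hr
  exact ⟨⟨_, restrict_mem_reg S hp⟩, Subtype.ext (funext hpr)⟩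

/-- The points of `V` where `q` does not vanish, as a closed set. -/
def graphInv (V : Set E) (q : E → ℂ) : Set (E × ℂ) := {z | z.1 ∈ V ∧ q z.1 * z.2 = 1}

theorem exists_mul_pow_eq_of_graphInv {V : Set E} {q : E → ℂ} (hq : q ∈ polyFun E)
    {p : E × ℂ → ℂ} (hp : p ∈ polyFun (E × ℂ)) :
    ∃ n : ℕ, ∃ a ∈ polyFun E, ∀ z ∈ graphInv V q, p z * q z.1 ^ n = a z.1 := by
  induction hp using Algebra.adjoin_induction with
  | mem p hp =>
    obtain ⟨φ, rfl⟩ := hp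
    -- On the graph the last coordinate is `1 / q`, so one factor `q` clears the denominator of a
    -- linear form.
    refine ⟨1, fun x => (φ ∘ₗ LinearMap.inl ℂ E ℂ) x * q x + φ (0, 1),
      polyFun_add (polyFun_mul (polyFun_dual _) hq) (polyFun_const _), ?_⟩
    rintro ⟨x, c⟩ ⟨-, hc⟩
    have h : φ (x, c) = φ (x, 0) + c * φ (0, 1) := by
      rw [← smul_eq_mul, ← map_smul, ← map_add]
      simp
    simp only [h, LinearMap.comp_apply, LinearMap.inl_apply]
    simp only at hc
    linear_combination φ (0, 1) * hc
  | algebraMap r => exact ⟨0, _, polyFun_const r, fun z _ => by simp⟩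
  | add p p' _ _ h1 h2 =>
    obtain ⟨n, a, ha, h1⟩ := h1
    obtain ⟨m, b, hb, h2⟩ := h2
    refine ⟨n + m, fun x => a x * q x ^ m + b x * q x ^ n,
      polyFun_add (polyFun_mul ha (polyFun_pow hq _)) (polyFun_mul hb (polyFun_pow hq _)), ?_⟩
    intro z hz
    simp only [Pi.add_apply, ← h1 z hz, ← h2 z hz]
    ring
  | mul p p' _ _ h1 h2 =>
    obtain ⟨n, a, ha, h1⟩ := h1
    obtain ⟨m, b, hb, h2⟩ := h2
    refine ⟨n + m, fun x => a x * b x, polyFun_mul ha hb, ?_⟩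
    intro z hz
    simp only [Pi.mul_apply, ← h1 z hz, ← h2 z hz]
    ring

/-- Rabinowitsch's trick: the extra coordinate is the inverse of `q`, and every function on the
graph becomes a function on `V` after multiplication by a power of `q`. -/
theorem isLocalization_graphInv (V : Set E) {q : E → ℂ} (hq : q ∈ polyFun E) :
    let f : reg V →ₐ[ℂ] reg (graphInv V q) := regComap Prod.fst polyMap_fst fun _ h => h.1
    let _ := f.toRingHom.toAlgebra
    IsLocalization.Away (⟨_, restrict_mem_reg V hq⟩ : reg V) (reg (graphInv V q)) := by
  intro f _
  have hy : (fun z : graphInv V q => z.1.2) ∈ reg (graphInv V q) :=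
    restrict_mem_reg _ polyMap_snd.mem
  refine IsLocalization.Away.mk _ ?_ ?_ ?_
  · refine IsUnit.of_mul_eq_one (⟨_, hy⟩ : reg (graphInv V q)) ?_
    ext z
    exact z.2.2
  · rintro ⟨r, hr⟩
    obtain ⟨p, hp, hpr⟩ := mem_reg.mp hr
    obtain ⟨n, a, ha, h⟩ := exists_mul_pow_eq_of_graphInv (V := V) hq hp
    refine ⟨n, ⟨_, restrict_mem_reg V ha⟩, ?_⟩
    ext z
    change r z * q z.1.1 ^ n = a z.1.1
    rw [← hpr, h z z.2]
  · intro a b hab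
    -- One factor `q` is enough: it kills the points with `q = 0`, and at the other points the two
    -- functions agree because they agree on the graph.
    refine ⟨1, ?_⟩
    ext x
    change q x ^ 1 * a.1 x = q x ^ 1 * b.1 x
    by_cases hx : q x = 0
    · simp [hx]
    · have h : (f a).1 ⟨(x.1, (q x)⁻¹), x.2, mul_inv_cancel₀ hx⟩ =
          (f b).1 ⟨(x.1, (q x)⁻¹), x.2, mul_inv_cancel₀ hx⟩ := by
        change (algebraMap _ _ a : reg (graphInv V q)).1 _ = (algebraMap _ _ b : reg (graphInv V q)).1 _
        rw [hab]
      exact congrArg _ h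

/-- The open part `q ≠ 0` is affine and is represented by a closed set of points in one more
variable, so open pieces can be handled by `kap` alone. The Nullstellensatz gives the radical
condition on the closed part. -/
theorem kap_eq_add_graphInv {V : Set E} (hV : ZClosed V) {q : E → ℂ} (hq : q ∈ polyFun E) :
    kap V = kap (graphInv V q) + kap (V ∩ {x | q x = 0}) := by
  refine K0.cls_specVar_away (⟨_, restrict_mem_reg V hq⟩ : reg V) _
    (isLocalization_graphInv V hq) _
    (regComap_id_surjective (T := V ∩ {x | q x = 0}) Set.inter_subset_left) ?_ ?_
  · ext x
    exact x.2.2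
  · rintro ⟨r, hr⟩ h
    obtain ⟨p, hp, hpr⟩ := mem_reg.mp hr
    obtain ⟨n, s, hs, h'⟩ := exists_pow_eq_mul_of_vanish hV hq hp (fun x hx hqx => by
      have := congrArg (fun t => t.1 ⟨x, hx, hqx⟩) h
      exact (hpr ⟨x, hx⟩).trans this)
    refine ⟨n, ⟨_, restrict_mem_reg V hs⟩, ?_⟩
    ext x
    change r x ^ n = q x * s x
    rw [← hpr, h' x x.2]

theorem kap_empty : kap (∅ : Set E) = 0 := by
  have : Subsingleton (reg (∅ : Set E)) := ⟨fun a b => by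
    ext x
    exact x.2.elim⟩
  have : IsEmpty (specVar (reg (∅ : Set E))).obj.left :=
    inferInstanceAs (IsEmpty (PrimeSpectrum (reg (∅ : Set E))))
  exact K0.cls_eq_zero_of_isEmpty _

end Kap

/-! ### Products of sets of points -/

section Prod

variable {E F : Type} [AddCommGroup E] [Module ℂ E] [AddCommGroup F] [Module ℂ F]

open TensorProduct

/-- The external product of regular functions. -/
def regProd (S : Set E) (T : Set F) : reg S ⊗[ℂ] reg T →ₐ[ℂ] reg (S ×ˢ T) :=
  Algebra.TensorProduct.lift
    (regComap Prod.fst polyMap_fst fun _ h => h.1)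
    (regComap Prod.snd polyMap_snd fun _ h => h.2) fun _ _ => Commute.all _ _

theorem regProd_tmul (S : Set E) (T : Set F) (a : reg S) (b : reg T) (z : (S ×ˢ T : Set (E × F))) :
    (regProd S T (a ⊗ₜ b)).1 z = a.1 ⟨z.1.1, z.2.1⟩ * b.1 ⟨z.1.2, z.2.2⟩ := by
  rw [regProd, Algebra.TensorProduct.lift_tmul]
  rfl

/-- Write the tensor with coefficients in `reg T` along a `ℂ`-basis of `reg S`. At each fixed point
of `T`, linear independence of the basis makes all coefficients vanish. -/
theorem regProd_injective (S : Set E) (T : Set F) : Function.Injective (regProd S T) := by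
  rw [injective_iff_map_eq_zero]
  intro w hw
  classical
  let B := Module.Basis.ofVectorSpace ℂ (reg S)
  obtain ⟨c, rfl⟩ := (TensorProduct.equivFinsuppOfBasisLeft (N := reg T) B).symm.surjective w
  suffices c = 0 by
    rw [this]
    exact LinearEquiv.map_zero _
  rw [TensorProduct.equivFinsuppOfBasisLeft_symm_apply] at hw
  ext i t
  have h : c.sum (fun i b => b.1 t • B i) = 0 := by
    ext s
    have := congrArg (fun r => r.1 (⟨(s.1, t.1), s.2, t.2⟩ : (S ×ˢ T : Set (E × F)))) hw
    simp only [Finsupp.sum, map_sum] at this ⊢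
    rw [AddSubmonoidClass.coe_finsetSum, Finset.sum_apply] at this ⊢
    refine Eq.trans (Finset.sum_congr rfl fun i _ => ?_) this
    rw [regProd_tmul]
    exact mul_comm _ _
  have h2 := linearIndependent_iff'.mp B.linearIndependent c.support (fun i => (c i).1 t) h
  by_cases hi : i ∈ c.support
  · exact h2 i hi
  · rw [Finsupp.notMem_support_iff.mp hi]
    rfl

theorem regProd_surjective (S : Set E) (T : Set F) : Function.Surjective (regProd S T) := by
  rintro ⟨r, hr⟩
  obtain ⟨p, hp, hpr⟩ := mem_reg.mp hr
  suffices (⟨_, restrict_mem_reg (S ×ˢ T) hp⟩ : reg (S ×ˢ T)) ∈ (regProd S T).range by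
    obtain ⟨w, hw⟩ := this
    refine ⟨w, ?_⟩
    exact hw.trans (Subtype.ext (funext hpr))
  clear hpr hr r
  induction hp using Algebra.adjoin_induction with
  | mem p hp =>
    obtain ⟨φ, rfl⟩ := hp
    have h1 : regProd S T (⟨_, restrict_mem_reg S (polyFun_dual (φ ∘ₗ LinearMap.inl ℂ E F))⟩ ⊗ₜ 1)
        + regProd S T (1 ⊗ₜ ⟨_, restrict_mem_reg T (polyFun_dual (φ ∘ₗ LinearMap.inr ℂ E F))⟩) ∈
        (regProd S T).range := add_mem ⟨_, rfl⟩ ⟨_, rfl⟩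
    convert h1 using 1
    ext z
    change φ z.1 = (regProd S T _).1 z + (regProd S T _).1 z
    rw [regProd_tmul, regProd_tmul]
    change φ z.1 = φ (z.1.1, 0) * 1 + 1 * φ (0, z.1.2)
    rw [mul_one, one_mul, ← map_add]
    simp
  | algebraMap r => exact (regProd S T).range.algebraMap_mem r
  | add p p' _ _ h1 h2 => exact add_mem h1 h2
  | mul p p' _ _ h1 h2 => exact mul_mem h1 h2

theorem kap_prod [Module.Finite ℂ E] [Module.Finite ℂ F] (S : Set E) (T : Set F) :
    kap (S ×ˢ T) = kap S * kap T := by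
  rw [kap, kap, kap, ← K0.cls_specVar_tensor]
  exact (K0.cls_specVar_congr
    (AlgEquiv.ofBijective (regProd S T) ⟨regProd_injective S T, regProd_surjective S T⟩)).symm

end Prod

/-! ### The class of a locally closed set of points -/

section Mu

variable {E F : Type} [AddCommGroup E] [Module ℂ E] [AddCommGroup F] [Module ℂ F]

/-- The common zeros of a list of functions. -/
def zeros (L : List (E → ℂ)) : Set E := {x | ∀ p ∈ L, p x = 0}

variable [Module.Finite ℂ E] [Module.Finite ℂ F]

/-- Hilbert's basis theorem for the ring of polynomial functions. -/
theorem ZClosed.exists_zeros {V : Set E} (hV : ZClosed V) :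
    ∃ L : List (E → ℂ), (∀ p ∈ L, p ∈ polyFun E) ∧ V = zeros L := by
  have : IsNoetherianRing (polyFun E) := Algebra.FiniteType.isNoetherianRing ℂ _
  let I : Ideal (polyFun E) :=
    { carrier := {p | ∀ x ∈ V, p.1 x = 0}
      add_mem' := fun {a b} ha hb x hx => by
        change a.1 x + b.1 x = 0
        rw [ha x hx, hb x hx, add_zero]
      zero_mem' := fun _ _ => rfl
      smul_mem' := fun c a ha x hx => by
        change c.1 x * a.1 x = 0
        rw [ha x hx, mul_zero] }
  obtain ⟨s, hs⟩ := IsNoetherian.noetherian I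
  refine ⟨s.toList.map Subtype.val, ?_, ?_⟩
  · simp only [List.mem_map]
    rintro _ ⟨p, -, rfl⟩
    exact p.2
  · apply Set.Subset.antisymm
    · intro x hx p hp
      obtain ⟨q, hq, rfl⟩ := List.mem_map.mp hp
      have : q ∈ I := hs ▸ Ideal.subset_span (Finset.mem_toList.mp hq)
      exact this x hx
    · intro x hx
      refine hV fun p hp hpV => ?_
      have h : (⟨p, hp⟩ : polyFun E) ∈ Ideal.span (s : Set (polyFun E)) := by
        change _ ∈ Submodule.span _ _
        rw [hs]
        exact hpV
      let J : Ideal (polyFun E) := RingHom.ker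
        ((Pi.evalRingHom (fun _ : E => ℂ) x).comp (polyFun E).val.toRingHom)
      have hJ : Ideal.span (s : Set (polyFun E)) ≤ J := Ideal.span_le.mpr fun q hq =>
        hx q.1 (List.mem_map.mpr ⟨q, Finset.mem_toList.mpr hq, rfl⟩)
      exact hJ h

/-- The difference depends only on the points outside the zeros of `L`. For the head `q` of the
list, the part `q ≠ 0` is a graph determined by these points; on the part `q = 0` the induction
hypothesis for the tail applies. -/
theorem kap_sub_inter_zeros {L : List (E → ℂ)} (hL : ∀ p ∈ L, p ∈ polyFun E) {V V' : Set E}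
    (hV : ZClosed V) (hV' : ZClosed V') (h : V \ zeros L = V' \ zeros L) :
    kap V - kap (V ∩ zeros L) = kap V' - kap (V' ∩ zeros L) := by
  induction L generalizing V V' with
  | nil => simp [zeros]
  | cons q L ih =>
    have hq := hL q List.mem_cons_self
    have hz : zeros (q :: L) = {x | q x = 0} ∩ zeros L := by
      ext x
      simp [zeros]
    have hmem : ∀ x, ¬ (q x = 0 ∧ x ∈ zeros L) → (x ∈ V ↔ x ∈ V') := by
      intro x hx
      have h1 : x ∉ zeros (q :: L) := by rw [hz]; exact hx
      have := Set.ext_iff.mp h x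
      simpa [h1] using this
    have h1 : graphInv V q = graphInv V' q := by
      ext ⟨x, c⟩
      simp only [graphInv, Set.mem_ofPred_eq]
      refine and_congr_left fun hc => hmem x fun hx => ?_
      rw [hx.1, zero_mul] at hc
      exact zero_ne_one hc
    have h2 := ih (fun p hp => hL p (List.mem_cons_of_mem _ hp))
      (hV.inter (zClosed_setOf_eq_zero hq)) (hV'.inter (zClosed_setOf_eq_zero hq)) (by
        ext x
        by_cases hx : q x = 0
        · by_cases hx' : x ∈ zeros L
          · simp [hx']
          · have := hmem x fun h => hx' h.2
            simp [hx, hx', this]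
        · simp [hx])
    rw [hz, ← Set.inter_assoc, ← Set.inter_assoc, kap_eq_add_graphInv hV hq,
      kap_eq_add_graphInv hV' hq, h1]
    linear_combination h2

/-- `V ∪ W` and `V` have the same points outside `W`. -/
theorem kap_union_add_inter {V W : Set E} (hV : ZClosed V) (hW : ZClosed W) :
    kap (V ∪ W) + kap (V ∩ W) = kap V + kap W := by
  obtain ⟨L, hL, rfl⟩ := hW.exists_zeros
  have := kap_sub_inter_zeros hL (hV.union hW) hV Set.union_sdiff_right
  rw [Set.inter_eq_right.mpr Set.subset_union_right] at this
  linear_combination this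

/-- The class of a set of points in the Grothendieck ring: the class of its closure minus the class
of the closure of its boundary. -/
def mu (S : Set E) : K0 := kap S - kap (zcl S \ S)

theorem kap_zcl (S : Set E) : kap (zcl S) = kap S := by
  refine (K0.cls_specVar_congr (AlgEquiv.ofBijective
    (regComap (fun x => x) polyMap_id (subset_zcl S) : reg (zcl S) →ₐ[ℂ] reg S)
    ⟨?_, regComap_id_surjective _⟩))
  rintro ⟨a, ha⟩ ⟨b, hb⟩ hab
  obtain ⟨p, hp, hpa⟩ := mem_reg.mp ha
  obtain ⟨q, hq, hqb⟩ := mem_reg.mp hb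
  ext x
  change a x = b x
  rw [← hpa, ← hqb, ← sub_eq_zero]
  refine x.2 _ (polyFun_sub hp hq) fun y hy => ?_
  have := congrArg (fun r => r.1 ⟨y, hy⟩) hab
  rw [sub_eq_zero]
  exact (hpa ⟨y, subset_zcl S hy⟩).trans (this.trans (hqb ⟨y, subset_zcl S hy⟩).symm)

/-- Locally closed sets of points. -/
def LocClosed (S : Set E) : Prop := ∃ V W : Set E, ZClosed V ∧ ZClosed W ∧ S = V \ W

theorem ZClosed.locClosed {V : Set E} (hV : ZClosed V) : LocClosed V :=
  ⟨V, ∅, hV, zClosed_empty, by simp⟩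

theorem ZClosed.locClosed_compl {V : Set E} (hV : ZClosed V) : LocClosed Vᶜ :=
  ⟨Set.univ, V, zClosed_univ, hV, by rw [Set.compl_eq_univ_sdiff]⟩

theorem LocClosed.inter {S T : Set E} (hS : LocClosed S) (hT : LocClosed T) :
    LocClosed (S ∩ T) := by
  obtain ⟨V, W, hV, hW, rfl⟩ := hS
  obtain ⟨V', W', hV', hW', rfl⟩ := hT
  refine ⟨V ∩ V', W ∪ W', hV.inter hV', hW.union hW', ?_⟩
  ext x
  simp only [Set.mem_inter_iff, Set.mem_sdiff, Set.mem_union]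
  tauto

theorem LocClosed.preimage {T : Set F} (hT : LocClosed T) {f : E → F} (hf : PolyMap f) :
    LocClosed (f ⁻¹' T) := by
  obtain ⟨V, W, hV, hW, rfl⟩ := hT
  exact ⟨_, _, hV.preimage hf, hW.preimage hf, rfl⟩

theorem LocClosed.prod {S : Set E} {T : Set F} (hS : LocClosed S) (hT : LocClosed T) :
    LocClosed (S ×ˢ T) :=
  (hS.preimage polyMap_fst).inter (hT.preimage polyMap_snd)

/-- Both differences are compared with the one formed from `V ∩ V'`, by inclusion and exclusion for
`V = (V ∩ V') ∪ W`. Hence `mu` may be computed from any presentation as a difference of nested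
closed sets, not only from the closure (`mu_eq`). -/
theorem kap_sub_eq_of_sdiff_eq {V W V' W' : Set E} (hV : ZClosed V) (hW : ZClosed W)
    (hV' : ZClosed V') (hW' : ZClosed W') (hWV : W ⊆ V) (hWV' : W' ⊆ V')
    (h : V \ W = V' \ W') : kap V - kap W = kap V' - kap W' := by
  have key : ∀ {V W V' W' : Set E}, ZClosed V → ZClosed W → ZClosed V' → W ⊆ V →
      V \ W = V' \ W' → kap V - kap W = kap (V ∩ V') - kap ((V ∩ V') \ (V \ W)) := by
    intro V W V' W' hV hW hV' hWV h
    have h0 : V \ W ⊆ V' := h ▸ Set.sdiff_subset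
    have h1 := kap_union_add_inter (hV.inter hV') hW
    have h2 : V ∩ V' ∪ W = V := by
      ext x
      have := @hWV x
      have := @h0 x
      simp only [Set.mem_sdiff, Set.mem_union, Set.mem_inter_iff] at *
      tauto
    have h3 : V ∩ V' ∩ W = (V ∩ V') \ (V \ W) := by
      ext x
      simp only [Set.mem_sdiff, Set.mem_inter_iff]
      tauto
    rw [h2, h3] at h1
    linear_combination h1
  rw [key hV hW hV' hWV h, key hV' hW' hV hWV' h.symm, h, Set.inter_comm]

theorem mu_eq {V W S : Set E} (hV : ZClosed V) (hW : ZClosed W) (hWV : W ⊆ V) (h : S = V \ W) :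
    mu S = kap V - kap W := by
  have h1 : zcl S \ S = zcl S ∩ W := by
    ext x
    have : x ∈ zcl S → x ∈ V := fun hx => hV.zcl_subset (h ▸ Set.sdiff_subset) hx
    rw [h] at this ⊢
    simp only [Set.mem_sdiff, Set.mem_inter_iff]
    tauto
  rw [mu, ← kap_zcl S, h1]
  refine kap_sub_eq_of_sdiff_eq (zClosed_zcl S) ((zClosed_zcl S).inter hW) hV hW
    Set.inter_subset_left hWV ?_
  rw [← h1, Set.sdiff_sdiff_right_self, ← h]
  exact Set.inter_eq_right.mpr (subset_zcl S)

theorem LocClosed.exists_subset {S : Set E} (hS : LocClosed S) :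
    ∃ V W : Set E, ZClosed V ∧ ZClosed W ∧ W ⊆ V ∧ S = V \ W := by
  obtain ⟨V, W, hV, hW, rfl⟩ := hS
  exact ⟨V, V ∩ W, hV, hV.inter hW, Set.inter_subset_left, by simp⟩

theorem mu_of_zClosed {V : Set E} (hV : ZClosed V) : mu V = kap V := by
  rw [mu_eq hV zClosed_empty (Set.empty_subset _) (by simp), kap_empty, sub_zero]

theorem mu_empty : mu (∅ : Set E) = 0 := by rw [mu_of_zClosed zClosed_empty, kap_empty]

theorem mu_eq_add {S Z : Set E} (hS : LocClosed S) (hZ : ZClosed Z) :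
    mu S = mu (S ∩ Z) + mu (S \ Z) := by
  obtain ⟨V, W, hV, hW, hWV, rfl⟩ := hS.exists_subset
  rw [mu_eq hV hW hWV rfl, mu_eq (V := V ∩ Z) (W := W ∩ Z) (hV.inter hZ) (hW.inter hZ)
    (Set.inter_subset_inter_left _ hWV) (by ext x; simp; tauto),
    mu_eq (V := V) (W := W ∪ V ∩ Z) hV (hW.union (hV.inter hZ))
    (Set.union_subset hWV Set.inter_subset_left) (by ext x; simp; tauto)]
  have h := kap_union_add_inter hW (hV.inter hZ)
  have h2 : W ∩ (V ∩ Z) = W ∩ Z := by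
    ext x
    have := @hWV x
    simp only [Set.mem_inter_iff]
    tauto
  rw [h2] at h
  linear_combination h

/-- The complement of `(V \ W) × (V' \ W')` in `V × V'` is `W × V' ∪ V × W'`, a union of closed sets
meeting in `W × W'`. -/
theorem mu_prod {S : Set E} {T : Set F} (hS : LocClosed S) (hT : LocClosed T) :
    mu (S ×ˢ T) = mu S * mu T := by
  obtain ⟨V, W, hV, hW, hWV, rfl⟩ := hS.exists_subset
  obtain ⟨V', W', hV', hW', hWV', rfl⟩ := hT.exists_subset
  have h := kap_union_add_inter (hW.prod hV') (hV.prod hW')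
  rw [Set.prod_inter_prod, Set.inter_eq_left.mpr hWV, Set.inter_eq_right.mpr hWV'] at h
  rw [mu_eq hV hW hWV rfl, mu_eq hV' hW' hWV' rfl, mu_eq (V := V ×ˢ V')
    (W := W ×ˢ V' ∪ V ×ˢ W') (hV.prod hV') ((hW.prod hV').union (hV.prod hW'))
    (Set.union_subset (Set.prod_mono_left hWV) (Set.prod_mono_right hWV'))
    (by ext x; simp; tauto)]
  simp only [kap_prod] at h ⊢
  linear_combination -h

/-- The identity `g (f x) = x` is polynomial and so extends from `S` to its closure. Therefore the
boundaries correspond too, and local closedness is not needed. -/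
theorem mu_congr_polyMap {S : Set E} {T : Set F} (f : E → F) (g : F → E) (hf : PolyMap f)
    (hg : PolyMap g) (hfS : Set.MapsTo f S T) (hgT : Set.MapsTo g T S)
    (hgf : ∀ x ∈ S, g (f x) = x) (hfg : ∀ y ∈ T, f (g y) = y) : mu S = mu T := by
  have key : ∀ {E F : Type} [AddCommGroup E] [Module ℂ E] [Module.Finite ℂ E] [AddCommGroup F]
      [Module ℂ F] [Module.Finite ℂ F] {S : Set E} {T : Set F} (f : E → F) (g : F → E),
      PolyMap f → PolyMap g → Set.MapsTo f S T → Set.MapsTo g T S → (∀ x ∈ S, g (f x) = x) →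
      (∀ x ∈ zcl S, g (f x) = x) ∧ Set.MapsTo f (zcl S \ S) (zcl T \ T) := by
    intro E F _ _ _ _ _ _ S T f g hf hg hfS hgT hgf
    have h1 : ∀ x ∈ zcl S, g (f x) = x := by
      intro x hx
      rw [← sub_eq_zero, ← Module.forall_dual_apply_eq_zero_iff ℂ]
      intro φ
      rw [map_sub]
      refine hx (fun x => φ (g (f x)) - φ x) (polyFun_sub (hf.comp_mem (hg φ)) (polyFun_dual φ))
        fun y hy => ?_
      rw [hgf y hy, sub_self]
    refine ⟨h1, fun x hx => ⟨fun p hp hpT => ?_, fun hfx => hx.2 ?_⟩⟩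
    · exact hx.1 _ (hf.comp_mem hp) fun y hy => hpT _ (hfS hy)
    · rw [← h1 x hx.1]
      exact hgT hfx
  obtain ⟨h1, h2⟩ := key f g hf hg hfS hgT hgf
  obtain ⟨h3, h4⟩ := key g f hg hf hgT hfS hfg
  rw [mu, mu, kap_congr f g hf hg hfS hgT hgf hfg, kap_congr f g hf hg h2 h4
    (fun x hx => h1 x hx.1) fun y hy => h3 y hy.1]

theorem LocClosed.graphInv {S : Set E} (hS : LocClosed S) {q : E → ℂ} (hq : q ∈ polyFun E) :
    LocClosed (graphInv S q) := by
  refine (hS.preimage (polyMap_fst (F := ℂ))).inter (ZClosed.locClosed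
    (V := {z : E × ℂ | q z.1 * z.2 = 1}) ?_)
  convert zClosed_setOf_eq_zero (E := E × ℂ) (p := fun z => q z.1 * z.2 - 1)
    (polyFun_sub (polyFun_mul (polyMap_fst.comp_mem hq) polyMap_snd.mem) (polyFun_const 1)) using 3
  rw [sub_eq_zero]

/-- Adjoining the inverse of a nowhere vanishing function does not change the class. This is how
denominators of regular maps are removed in `mu_congr`. -/
theorem mu_graphInv {S : Set E} (hS : LocClosed S) {q : E → ℂ} (hq : q ∈ polyFun E)
    (h : ∀ x ∈ S, q x ≠ 0) : mu (graphInv S q) = mu S := by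
  have hcl : ∀ {V : Set E}, ZClosed V → ZClosed (JetOrbit.graphInv V q) := by
    intro V hV
    refine (hV.preimage (polyMap_fst (F := ℂ))).inter (W := {z : E × ℂ | q z.1 * z.2 = 1}) ?_
    convert zClosed_setOf_eq_zero (E := E × ℂ) (p := fun z => q z.1 * z.2 - 1)
      (polyFun_sub (polyFun_mul (polyMap_fst.comp_mem hq) polyMap_snd.mem) (polyFun_const 1)) using 3
    rw [sub_eq_zero]
  obtain ⟨V, W, hV, hW, hWV, rfl⟩ := hS.exists_subset
  rw [mu_eq hV hW hWV rfl,
    mu_eq (V := JetOrbit.graphInv V q) (W := JetOrbit.graphInv W q) (hcl hV) (hcl hW)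
    (fun z hz => ⟨hWV hz.1, hz.2⟩) (by ext z; simp [JetOrbit.graphInv]; tauto),
    kap_eq_add_graphInv hV hq, kap_eq_add_graphInv hW hq]
  have : V ∩ {x | q x = 0} = W ∩ {x | q x = 0} := by
    ext x
    have h1 := @hWV x
    have h2 := h x
    simp only [Set.mem_sdiff, Set.mem_inter_iff, Set.mem_ofPred_eq] at *
    tauto
  rw [this]
  ring

end Mu

/-! ### Regular maps, invariance of the class, and stratifications -/

section Regular

variable {E F G H : Type} [AddCommGroup E] [Module ℂ E] [AddCommGroup F] [Module ℂ F]
  [AddCommGroup G] [Module ℂ G] [AddCommGroup H] [Module ℂ H]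

/-- Functions that are quotients of polynomial functions on a set of points. -/
def RegOn (S : Set E) (f : E → ℂ) : Prop :=
  ∃ p ∈ polyFun E, ∃ q ∈ polyFun E, ∀ x ∈ S, q x ≠ 0 ∧ f x = p x / q x

theorem regOn_of_mem (S : Set E) {p : E → ℂ} (hp : p ∈ polyFun E) : RegOn S p :=
  ⟨p, hp, _, polyFun_const 1, fun x _ => ⟨one_ne_zero, by simp⟩⟩

theorem regOn_const (S : Set E) (c : ℂ) : RegOn S fun _ => c := regOn_of_mem S (polyFun_const c)

theorem RegOn.congr {S : Set E} {f g : E → ℂ} (hf : RegOn S f) (h : ∀ x ∈ S, g x = f x) :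
    RegOn S g := by
  obtain ⟨p, hp, q, hq, hf⟩ := hf
  exact ⟨p, hp, q, hq, fun x hx => ⟨(hf x hx).1, (h x hx).trans (hf x hx).2⟩⟩

theorem RegOn.mul {S : Set E} {f g : E → ℂ} (hf : RegOn S f) (hg : RegOn S g) :
    RegOn S fun x => f x * g x := by
  obtain ⟨p, hp, q, hq, hf⟩ := hf
  obtain ⟨p', hp', q', hq', hg⟩ := hg
  refine ⟨_, polyFun_mul hp hp', _, polyFun_mul hq hq', fun x hx =>
    ⟨mul_ne_zero (hf x hx).1 (hg x hx).1, ?_⟩⟩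
  beta_reduce
  rw [(hf x hx).2, (hg x hx).2, div_mul_div_comm]

theorem RegOn.add {S : Set E} {f g : E → ℂ} (hf : RegOn S f) (hg : RegOn S g) :
    RegOn S fun x => f x + g x := by
  obtain ⟨p, hp, q, hq, hf⟩ := hf
  obtain ⟨p', hp', q', hq', hg⟩ := hg
  refine ⟨_, polyFun_add (polyFun_mul hp hq') (polyFun_mul hq hp'), _, polyFun_mul hq hq',
    fun x hx => ⟨mul_ne_zero (hf x hx).1 (hg x hx).1, ?_⟩⟩
  beta_reduce
  rw [(hf x hx).2, (hg x hx).2, div_add_div _ _ (hf x hx).1 (hg x hx).1]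

theorem RegOn.inv {S : Set E} {f : E → ℂ} (hf : RegOn S f) (h : ∀ x ∈ S, f x ≠ 0) :
    RegOn S fun x => (f x)⁻¹ := by
  obtain ⟨p, hp, q, hq, hf⟩ := hf
  refine ⟨q, hq, p, hp, fun x hx => ⟨fun h0 => h x hx ?_, ?_⟩⟩
  · rw [(hf x hx).2, h0, zero_div]
  · beta_reduce
    rw [(hf x hx).2, inv_div]

theorem RegOn.sum {S : Set E} {ι : Type*} (s : Finset ι) {f : ι → E → ℂ}
    (h : ∀ i ∈ s, RegOn S (f i)) : RegOn S fun x => ∑ i ∈ s, f i x := by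
  classical
  induction s using Finset.induction_on with
  | empty => simpa using regOn_const S 0
  | insert a s ha ih =>
    simp only [Finset.sum_insert ha]
    exact (h a (Finset.mem_insert_self a s)).add
      (ih fun i hi => h i (Finset.mem_insert_of_mem hi))

theorem RegOn.prod {S : Set E} {ι : Type*} (s : Finset ι) {f : ι → E → ℂ}
    (h : ∀ i ∈ s, RegOn S (f i)) : RegOn S fun x => ∏ i ∈ s, f i x := by
  classical
  induction s using Finset.induction_on with
  | empty => simpa using regOn_const S 1
  | insert a s ha ih =>
    simp only [Finset.prod_insert ha]
    exact (h a (Finset.mem_insert_self a s)).mul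
      (ih fun i hi => h i (Finset.mem_insert_of_mem hi))

theorem RegOn.det {S : Set E} {ι : Type*} [Fintype ι] [DecidableEq ι] {M : E → Matrix ι ι ℂ}
    (h : ∀ i j, RegOn S fun x => M x i j) : RegOn S fun x => (M x).det := by
  simp only [Matrix.det_apply']
  exact RegOn.sum _ fun σ _ => (regOn_const S _).mul (RegOn.prod _ fun i _ => h _ _)

theorem polyFun_sum {ι : Type*} (s : Finset ι) {f : ι → E → ℂ}
    (h : ∀ i ∈ s, f i ∈ polyFun E) : (fun x => ∑ i ∈ s, f i x) ∈ polyFun E := by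
  convert (polyFun E).sum_mem h using 1
  ext x
  simp

theorem polyFun_prod {ι : Type*} (s : Finset ι) {f : ι → E → ℂ}
    (h : ∀ i ∈ s, f i ∈ polyFun E) : (fun x => ∏ i ∈ s, f i x) ∈ polyFun E := by
  convert (polyFun E).prod_mem h using 1
  ext x
  simp

theorem polyFun_det {ι : Type*} [Fintype ι] [DecidableEq ι] {M : E → Matrix ι ι ℂ}
    (h : ∀ i j, (fun x => M x i j) ∈ polyFun E) : (fun x => (M x).det) ∈ polyFun E := by
  simp only [Matrix.det_apply']
  exact polyFun_sum _ fun σ _ =>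
    polyFun_mul (polyFun_const _) (polyFun_prod _ fun i _ => h _ _)

/-- Maps whose coordinates are quotients of polynomial functions on a set of points. -/
def RegMap (S : Set E) (f : E → F) : Prop := ∀ φ : Module.Dual ℂ F, RegOn S fun x => φ (f x)

theorem PolyMap.regMap {f : E → F} (hf : PolyMap f) (S : Set E) : RegMap S f :=
  fun φ => regOn_of_mem S (hf φ)

theorem RegMap.congr {S : Set E} {f g : E → F} (hf : RegMap S f) (h : ∀ x ∈ S, g x = f x) :
    RegMap S g := fun φ => (hf φ).congr fun x hx => by rw [h x hx]

theorem regMap_id (S : Set E) : RegMap S fun x : E => x := polyMap_id.regMap S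

theorem regMap_const (S : Set E) (c : F) : RegMap S fun _ : E => c := fun _ => regOn_const S _

theorem RegMap.linear {S : Set E} {f : E → F} (hf : RegMap S f) (L : F →ₗ[ℂ] G) :
    RegMap S fun x => L (f x) := fun φ => hf (φ ∘ₗ L)

theorem RegMap.add {S : Set E} {f g : E → F} (hf : RegMap S f) (hg : RegMap S g) :
    RegMap S fun x => f x + g x := fun φ => by
  simp only [map_add]
  exact (hf φ).add (hg φ)

theorem RegMap.neg {S : Set E} {f : E → F} (hf : RegMap S f) : RegMap S fun x => -f x :=
  hf.linear (-LinearMap.id)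

theorem RegMap.sub {S : Set E} {f g : E → F} (hf : RegMap S f) (hg : RegMap S g) :
    RegMap S fun x => f x - g x := by
  simp only [sub_eq_add_neg]
  exact hf.add hg.neg

theorem RegMap.sum {S : Set E} {ι : Type*} (s : Finset ι) {f : ι → E → F}
    (h : ∀ i ∈ s, RegMap S (f i)) : RegMap S fun x => ∑ i ∈ s, f i x := fun φ => by
  simp only [map_sum]
  exact RegOn.sum s fun i hi => h i hi φ

theorem RegMap.smul {S : Set E} {c : E → ℂ} {f : E → F} (hc : RegOn S c) (hf : RegMap S f) :
    RegMap S fun x => c x • f x := fun φ => by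
  simp only [map_smul, smul_eq_mul]
  exact hc.mul (hf φ)

theorem RegMap.prodMk {S : Set E} {f : E → F} {g : E → G} (hf : RegMap S f) (hg : RegMap S g) :
    RegMap S fun x => (f x, g x) := by
  refine ((hf.linear (LinearMap.inl ℂ F G)).add (hg.linear (LinearMap.inr ℂ F G))).congr ?_
  intro x _
  simp

theorem RegMap.fst {S : Set E} {f : E → F × G} (hf : RegMap S f) : RegMap S fun x => (f x).1 :=
  hf.linear (LinearMap.fst ℂ F G)

theorem RegMap.snd {S : Set E} {f : E → F × G} (hf : RegMap S f) : RegMap S fun x => (f x).2 :=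
  hf.linear (LinearMap.snd ℂ F G)

theorem RegMap.bilin [Module.Finite ℂ F] {S : Set E} {f : E → F} {g : E → G}
    (hf : RegMap S f) (hg : RegMap S g) (B : F →ₗ[ℂ] G →ₗ[ℂ] H) :
    RegMap S fun x => B (f x) (g x) := by
  let b := Module.finBasis ℂ F
  refine (RegMap.sum Finset.univ (f := fun i x => b.coord i (f x) • B (b i) (g x))
    fun i _ => RegMap.smul (hf _) (hg.linear _)).congr fun x _ => ?_
  conv_lhs => rw [← b.sum_repr (f x)]
  rw [map_sum, LinearMap.sum_apply]
  exact Finset.sum_congr rfl fun i _ => by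
    rw [map_smul]
    rfl

theorem RegMap.matrix {S : Set E} {ι κ : Type} [Fintype ι] [Fintype κ]
    {M : E → Matrix ι κ F} (h : ∀ i j, RegMap S fun x => M x i j) : RegMap S M := by
  classical
  refine (RegMap.sum Finset.univ (f := fun i x => ∑ j, Matrix.singleLinearMap ℂ i j (M x i j))
    fun i _ => RegMap.sum _ fun j _ => (h i j).linear _).congr fun x _ => ?_
  exact Matrix.matrix_eq_sum_single (M x)

theorem RegMap.entry {S : Set E} {ι κ : Type}
    {M : E → Matrix ι κ F} (h : RegMap S M) (i : ι) (j : κ) : RegMap S fun x => M x i j :=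
  h.linear (Matrix.entryLinearMap ℂ F i j)

theorem RegMap.matrix_mul {R : Type} [Ring R] [Algebra ℂ R] [Module.Finite ℂ R] {S : Set E}
    {ι κ τ : Type} [Fintype ι] [Fintype κ] [Fintype τ]
    {M : E → Matrix ι κ R} {N : E → Matrix κ τ R} (hM : RegMap S M) (hN : RegMap S N) :
    RegMap S fun x => M x * N x := by
  refine RegMap.matrix fun i j => ?_
  simp only [Matrix.mul_apply]
  exact RegMap.sum _ fun k _ => (hM.entry i k).bilin (hN.entry k j) (LinearMap.mul ℂ R)

/-- The inverse of `y` solves the linear system whose matrix is left multiplication by `y`. The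
entries of this matrix are linear in `y`, and Cramer's rule writes the solution as a quotient of
polynomials. It is used for matrix rings over truncated polynomial rings. -/
theorem RegMap.ringInverse {A : Type} [Ring A] [Algebra ℂ A] [Module.Finite ℂ A] {S : Set E}
    {f : E → A} (hf : RegMap S f) (h : ∀ x ∈ S, IsUnit (f x)) :
    RegMap S fun x => Ring.inverse (f x) := by
  classical
  let b := Module.finBasis ℂ A
  let M : E → Matrix _ _ ℂ := fun x => LinearMap.toMatrix b b (LinearMap.mul ℂ A (f x))
  have hM : ∀ i j, RegOn S fun x => M x i j := fun i j => by
    refine (hf (b.coord i ∘ₗ (LinearMap.mul ℂ A).flip (b j))).congr fun x _ => ?_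
    simp only [M, LinearMap.toMatrix_apply]
    rfl
  have hu : ∀ x ∈ S, IsUnit (M x) := fun x hx => by
    obtain ⟨u, hu⟩ := h x hx
    refine IsUnit.of_mul_eq_one (LinearMap.toMatrix b b (LinearMap.mul ℂ A ↑u⁻¹)) ?_
    rw [← LinearMap.toMatrix_mul, ← LinearMap.toMatrix_one b]
    congr 1
    ext y
    change f x * (↑u⁻¹ * y) = y
    rw [← hu, Units.mul_inv_cancel_left]
  have hinv : ∀ i j, RegOn S fun x => (M x)⁻¹ i j := fun i j => by
    have h1 : RegOn S fun x => ((M x).det)⁻¹ := (RegOn.det hM).inv fun x hx =>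
      ((Matrix.isUnit_iff_isUnit_det _).mp (hu x hx)).ne_zero
    have h2 : RegOn S fun x => (M x).adjugate i j := by
      simp only [Matrix.adjugate_apply]
      refine RegOn.det fun k l => ?_
      by_cases hk : k = j
      · subst hk
        simpa using regOn_const S _
      · simpa [Matrix.updateRow_ne hk] using hM k l
    refine (h1.mul h2).congr fun x _ => ?_
    rw [Matrix.inv_def, Ring.inverse_eq_inv']
    rfl
  refine (RegMap.sum Finset.univ (f := fun i x => (∑ j, (M x)⁻¹ i j * b.repr 1 j) • b i)
    fun i _ => RegMap.smul (RegOn.sum _ fun j _ => (hinv i j).mul (regOn_const S _))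
      (regMap_const S _)).congr fun x hx => ?_
  have h1 : (M x).mulVec (b.repr (Ring.inverse (f x))) = b.repr 1 := by
    rw [LinearMap.toMatrix_mulVec_repr]
    simp [Ring.mul_inverse_cancel _ (h x hx)]
  have h2 : (M x)⁻¹.mulVec (b.repr 1) = b.repr (Ring.inverse (f x)) := by
    rw [← h1, Matrix.mulVec_mulVec, Matrix.nonsing_inv_mul _
      ((Matrix.isUnit_iff_isUnit_det _).mp (hu x hx)), Matrix.one_mulVec]
  rw [← b.sum_repr (Ring.inverse (f x))]
  exact Finset.sum_congr rfl fun i _ => by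
    rw [← h2]
    rfl

/-- With `q` the product of the denominators of all coordinates, `f` becomes polynomial once `1 / q`
is an extra coordinate. -/
theorem RegMap.exists_polyMap [Module.Finite ℂ F] {S : Set E} {f : E → F} (hf : RegMap S f) :
    ∃ q ∈ polyFun E, ∃ g : E × ℂ → F, PolyMap g ∧ (∀ x ∈ S, q x ≠ 0) ∧
      ∀ x ∈ S, ∀ y, q x * y = 1 → g (x, y) = f x := by
  classical
  let b := Module.finBasis ℂ F
  choose p hp q hq h using fun i => hf (b.coord i)
  refine ⟨_, polyFun_prod Finset.univ (f := q) fun i _ => hq i,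
    fun z => ∑ i, (p i z.1 * (∏ j ∈ Finset.univ.erase i, q j z.1) * z.2) • b i, ?_, ?_, ?_⟩
  · intro φ
    simp only [map_sum, map_smul, smul_eq_mul]
    refine polyFun_sum _ fun i _ => polyFun_mul (polyFun_mul (polyFun_mul
      (polyMap_fst.comp_mem (hp i)) (polyFun_prod _ fun j _ => polyMap_fst.comp_mem (hq j)))
      polyMap_snd.mem) (polyFun_const _)
  · exact fun x hx => Finset.prod_ne_zero_iff.mpr fun i _ => (h i x hx).1
  · intro x hx y hy
    rw [← b.sum_repr (f x)]
    refine Finset.sum_congr rfl fun i _ => ?_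
    congr 1
    refine Eq.trans ?_ (h i x hx).2.symm
    rw [eq_div_iff (h i x hx).1]
    rw [← Finset.mul_prod_erase _ _ (Finset.mem_univ i)] at hy
    linear_combination p i x * hy

variable [Module.Finite ℂ E] [Module.Finite ℂ F]

/-- Sets of points that are related by mutually inverse regular maps have the same class. -/
theorem mu_congr {S : Set E} {T : Set F} (hS : LocClosed S) (hT : LocClosed T) (f : E → F)
    (g : F → E) (hf : RegMap S f) (hg : RegMap T g) (hfS : Set.MapsTo f S T)
    (hgT : Set.MapsTo g T S) (hgf : ∀ x ∈ S, g (f x) = x) (hfg : ∀ y ∈ T, f (g y) = y) :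
    mu S = mu T := by
  obtain ⟨q, hq, f', hf', hq0, hff'⟩ := hf.exists_polyMap
  obtain ⟨r, hr, g', hg', hr0, hgg'⟩ := hg.exists_polyMap
  have e1 : ∀ z ∈ graphInv S q, f' z = f z.1 := fun z hz => hff' z.1 hz.1 z.2 hz.2
  have e2 : ∀ z ∈ graphInv T r, g' z = g z.1 := fun z hz => hgg' z.1 hz.1 z.2 hz.2
  -- Over `S` the functions `q` and `r ∘ f` are inverted, over `T` the functions `r` and `q ∘ g`. On
  -- these double graphs `f` and `g` are polynomial, and they interchange the two extra coordinates.
  rw [← mu_graphInv hS hq hq0, ← mu_graphInv hT hr hr0,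
    ← mu_graphInv (hS.graphInv hq) (hf'.comp_mem hr)
      (fun z hz => by rw [e1 z hz]; exact hr0 _ (hfS hz.1)),
    ← mu_graphInv (hT.graphInv hr) (hg'.comp_mem hq)
      (fun z hz => by rw [e2 z hz]; exact hq0 _ (hgT hz.1))]
  refine mu_congr_polyMap (fun z => ((f' z.1, z.2), z.1.2)) (fun z => ((g' z.1, z.2), z.1.2))
    (((hf'.comp polyMap_fst).prodMk polyMap_snd).prodMk (polyMap_snd.comp polyMap_fst))
    (((hg'.comp polyMap_fst).prodMk polyMap_snd).prodMk (polyMap_snd.comp polyMap_fst)) ?_ ?_ ?_ ?_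
  · rintro ⟨z, w⟩ ⟨hz, hw⟩
    have h1 : (f' z, w) ∈ graphInv T r := ⟨by rw [e1 z hz]; exact hfS hz.1, hw⟩
    refine ⟨h1, ?_⟩
    change q (g' (f' z, w)) * z.2 = 1
    rw [e2 _ h1]
    simp only [e1 z hz, hgf z.1 hz.1]
    exact hz.2
  · rintro ⟨z, w⟩ ⟨hz, hw⟩
    have h1 : (g' z, w) ∈ graphInv S q := ⟨by rw [e2 z hz]; exact hgT hz.1, hw⟩
    refine ⟨h1, ?_⟩
    change r (f' (g' z, w)) * z.2 = 1
    rw [e1 _ h1]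
    simp only [e2 z hz, hfg z.1 hz.1]
    exact hz.2
  · rintro ⟨z, w⟩ ⟨hz, hw⟩
    have h1 : (f' z, w) ∈ graphInv T r := ⟨by rw [e1 z hz]; exact hfS hz.1, hw⟩
    have h2 : g' (f' z, w) = z.1 := (e2 _ h1).trans (by rw [e1 z hz]; exact hgf z.1 hz.1)
    change ((g' (f' z, w), z.2), w) = (z, w)
    rw [h2]
  · rintro ⟨z, w⟩ ⟨hz, hw⟩
    have h1 : (g' z, w) ∈ graphInv S q := ⟨by rw [e2 z hz]; exact hgT hz.1, hw⟩
    have h2 : f' (g' z, w) = z.1 := (e1 _ h1).trans (by rw [e2 z hz]; exact hfg z.1 hz.1)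
    change ((f' (g' z, w), z.2), w) = (z, w)
    rw [h2]

theorem mu_eq_sum {ι : Type*} [Fintype ι] [LinearOrder ι] {S : Set E} (hS : LocClosed S)
    {q : ι → E → ℂ} (hq : ∀ i, q i ∈ polyFun E) (h : ∀ x ∈ S, ∃ i, q i x ≠ 0) :
    mu S = ∑ i, mu {x | x ∈ S ∧ q i x ≠ 0 ∧ ∀ j < i, q j x = 0} := by
  -- The last term collects the points where all functions treated so far vanish. Indices are added
  -- in increasing order, so each new one splits only this term.
  have key : ∀ s : Finset ι, mu S =
      ∑ i ∈ s, mu {x | x ∈ S ∧ q i x ≠ 0 ∧ ∀ j ∈ s, j < i → q j x = 0} +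
        mu (S ∩ ⋂ j ∈ s, {x | q j x = 0}) := by
    intro s
    induction s using Finset.induction_on_max with
    | empty => simp
    | insert a s ha ih =>
      have has : a ∉ s := fun h => lt_irrefl a (ha a h)
      have hZ : ZClosed (⋂ j ∈ s, {x | q j x = 0}) :=
        ZClosed.iInter fun j => ZClosed.iInter fun _ => zClosed_setOf_eq_zero (hq j)
      rw [ih, Finset.sum_insert has,
        mu_eq_add (hS.inter hZ.locClosed) (zClosed_setOf_eq_zero (hq a))]
      have h1 : S ∩ (⋂ j ∈ s, {x | q j x = 0}) ∩ {x | q a x = 0} =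
          S ∩ ⋂ j ∈ insert a s, {x | q j x = 0} := by
        ext x
        simp
        tauto
      have h2 : (S ∩ ⋂ j ∈ s, {x | q j x = 0}) \ {x | q a x = 0} =
          {x | x ∈ S ∧ q a x ≠ 0 ∧ ∀ j ∈ insert a s, j < a → q j x = 0} := by
        ext x
        simp only [Set.mem_sdiff, Set.mem_inter_iff, Set.mem_iInter, Set.mem_ofPred_eq,
          Finset.mem_insert, forall_eq_or_imp, lt_irrefl, IsEmpty.forall_iff, true_and]
        constructor
        · rintro ⟨⟨hx, h1⟩, h2⟩
          exact ⟨hx, h2, fun j hj _ => h1 j hj⟩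
        · rintro ⟨hx, h2, h1⟩
          exact ⟨⟨hx, fun j hj => h1 j hj (ha j hj)⟩, h2⟩
      rw [h1, h2]
      have h3 : ∀ i ∈ s, {x | x ∈ S ∧ q i x ≠ 0 ∧ ∀ j ∈ insert a s, j < i → q j x = 0} =
          {x | x ∈ S ∧ q i x ≠ 0 ∧ ∀ j ∈ s, j < i → q j x = 0} := by
        intro i hi
        ext x
        simp [(ha i hi).le]
      rw [Finset.sum_congr rfl fun i hi => congrArg mu (h3 i hi)]
      ring
  rw [key Finset.univ]
  have h0 : S ∩ ⋂ j ∈ (Finset.univ : Finset ι), {x | q j x = 0} = ∅ := by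
    rw [Set.eq_empty_iff_forall_notMem]
    rintro x ⟨hx, hx'⟩
    obtain ⟨i, hi⟩ := h x hx
    exact hi (by simpa using (Set.mem_iInter₂.mp hx' i (Finset.mem_univ i)))
  rw [h0, mu_empty, add_zero]
  simp

theorem locClosed_ne_zero {q : E → ℂ} (hq : q ∈ polyFun E) : LocClosed {x | q x ≠ 0} :=
  (zClosed_setOf_eq_zero hq).locClosed_compl

theorem LocClosed.stratum {ι : Type*} [LT ι] {S : Set E} (hS : LocClosed S)
    {q : ι → E → ℂ} (hq : ∀ i, q i ∈ polyFun E) (i : ι) :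
    LocClosed {x | x ∈ S ∧ q i x ≠ 0 ∧ ∀ j < i, q j x = 0} := by
  refine hS.inter ((locClosed_ne_zero (hq i)).inter (ZClosed.locClosed
    (V := {x | ∀ j < i, q j x = 0}) ?_))
  have : {x | ∀ j < i, q j x = 0} = ⋂ j, ⋂ (_ : j < i), {x | q j x = 0} := by
    ext x
    simp
  rw [this]
  exact ZClosed.iInter fun j => ZClosed.iInter fun _ => zClosed_setOf_eq_zero (hq j)

end Regular

/-! ### Comparison of `mu` with the given varieties -/

section Comparison

variable {E : Type} [AddCommGroup E] [Module ℂ E]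

/-- The evaluation of polynomials in the coordinates at the points of a set. -/
def evalReg {ι : Type*} [Finite ι] (b : Module.Basis ι ℂ E) (S : Set E) :
    MvPolynomial ι ℂ →ₐ[ℂ] reg S :=
  MvPolynomial.aeval fun i => ⟨_, restrict_mem_reg S (polyFun_dual (b.coord i))⟩

theorem evalReg_apply {ι : Type*} [Finite ι] (b : Module.Basis ι ℂ E) (S : Set E)
    (P : MvPolynomial ι ℂ) (x : S) :
    (evalReg b S P).1 x = MvPolynomial.eval (fun i => b.coord i x) P := by
  induction P using MvPolynomial.induction_on with
  | C a =>
    rw [MvPolynomial.eval_C]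
    have : evalReg b S (MvPolynomial.C a) = algebraMap ℂ _ a := (evalReg b S).commutes a
    rw [this]
    rfl
  | add p q hp hq =>
    rw [map_add, map_add, ← hp, ← hq]
    rfl
  | mul_X p i hp =>
    rw [map_mul, map_mul, ← hp, MvPolynomial.eval_X]
    have : evalReg b S (MvPolynomial.X i) =
      ⟨_, restrict_mem_reg S (polyFun_dual (b.coord i))⟩ := MvPolynomial.aeval_X _ i
    rw [this]
    rfl

theorem evalReg_surjective {ι : Type*} [Finite ι] (b : Module.Basis ι ℂ E) (S : Set E) :
    Function.Surjective (evalReg b S) := by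
  rintro ⟨r, hr⟩
  obtain ⟨p, hp, hpr⟩ := mem_reg.mp hr
  obtain ⟨P, hP⟩ := (mem_polyFun_iff_basis b).mp hp
  refine ⟨P, Subtype.ext (funext fun x => ?_)⟩
  rw [evalReg_apply, ← hP, hpr]

theorem evalReg_univ_injective {ι : Type*} [Finite ι] (b : Module.Basis ι ℂ E) :
    Function.Injective (evalReg b (Set.univ : Set E)) := by
  intro P Q h
  refine MvPolynomial.funext fun y => ?_
  have hy : (fun i => b.coord i (b.equivFun.symm y)) = y := b.equivFun.apply_symm_apply y
  have := congrArg (fun r => r.1 ⟨b.equivFun.symm y, trivial⟩) h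
  simp only [evalReg_apply, hy] at this
  exact this

variable {σ : Type} [Finite σ]

theorem kap_eq_cls_coordRing (S : Set (σ → ℂ)) : kap S = K0.cls (specVar (coordRing S)) := by
  have hk : MvPolynomial.vanishingIdeal ℂ S =
      RingHom.ker (evalReg (Pi.basisFun ℂ σ) S) := by
    ext P
    rw [MvPolynomial.mem_vanishingIdeal_iff, RingHom.mem_ker, Subtype.ext_iff, funext_iff]
    simp only [evalReg_apply]
    constructor
    · exact fun h x => h x x.2
    · exact fun h x hx => h ⟨x, hx⟩
  exact (K0.cls_specVar_congr ((Ideal.quotientEquivAlgOfEq ℂ hk).trans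
    (Ideal.quotientKerAlgEquivOfSurjective (evalReg_surjective (Pi.basisFun ℂ σ) S)))).symm

theorem zcl_eq_zeroLocus (S : Set (σ → ℂ)) :
    zcl S = MvPolynomial.zeroLocus ℂ (MvPolynomial.vanishingIdeal ℂ S) := by
  ext x
  rw [MvPolynomial.mem_zeroLocus_iff]
  constructor
  · intro hx P hP
    exact hx (fun y => MvPolynomial.eval y P)
      ((mem_polyFun_iff_basis (Pi.basisFun ℂ σ)).mpr ⟨P, fun _ => rfl⟩)
      (MvPolynomial.mem_vanishingIdeal_iff.mp hP)
  · intro hx p hp hpS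
    obtain ⟨P, hP⟩ := (mem_polyFun_iff_basis (Pi.basisFun ℂ σ)).mp hp
    rw [hP]
    exact hx P (MvPolynomial.mem_vanishingIdeal_iff.mpr fun y hy => (hP y).symm.trans (hpS y hy))

/-- The closed set removed in `locallyClosedVar` is the spectrum of the coordinate ring of the
boundary, so the scissor relation is the difference that defines `mu`. This holds for every set of
points. -/
theorem cls_locallyClosedVar (S : Set (σ → ℂ)) : K0.cls (locallyClosedVar S) = mu S := by
  have hle : MvPolynomial.vanishingIdeal ℂ S ≤ boundaryIdeal S := by
    intro P hP
    rw [boundaryIdeal, MvPolynomial.mem_vanishingIdeal_iff]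
    exact fun x hx => hx.1 P hP
  rw [mu, zcl_eq_zeroLocus, kap_eq_cls_coordRing, kap_eq_cls_coordRing]
  refine K0.cls_openVar_specVar (Ideal.Quotient.factorₐ ℂ hle)
    (Ideal.Quotient.factor_surjective hle) _ ?_
  change (PrimeSpectrum.zeroLocus _)ᶜ = _
  congr 2
  ext z
  obtain ⟨P, rfl⟩ := Ideal.Quotient.mk_surjective z
  change _ ↔ Ideal.Quotient.mk (boundaryIdeal S) P = 0
  rw [Ideal.Quotient.eq_zero_iff_mem]
  constructor
  · rintro ⟨Q, hQ, h⟩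
    have := hle (Ideal.Quotient.eq.mp h)
    have h2 := (boundaryIdeal S).sub_mem hQ this
    rwa [sub_sub_cancel] at h2
  · exact fun h => ⟨P, h, rfl⟩

theorem lef_eq_mu : lef = mu (Set.univ : Set ℂ) := by
  rw [mu_of_zClosed zClosed_univ, lef, kap]
  exact K0.cls_specVar_congr ((MvPolynomial.uniqueAlgEquiv ℂ Unit).symm.trans (AlgEquiv.ofBijective
    (evalReg (Module.Basis.singleton Unit ℂ) Set.univ)
    ⟨evalReg_univ_injective _, evalReg_surjective _ _⟩))

theorem cls_specVar_complex : K0.cls (specVar ℂ) = 1 := by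
  have h1 : K0.cls (MonoidalCategoryStruct.tensorUnit Var) = 1 := by
    rw [K0.cls, freeClass, ← Skeleton.one_eq, map_one, map_one]
  rw [← h1]
  refine K0.cls_eq_of_iso (ObjectProperty.isoMk _ (Over.isoMk (Iso.refl (Spec (CommRingCat.of ℂ))) ?_))
  change 𝟙 _ ≫ 𝟙 _ = Spec.map (CommRingCat.ofHom (algebraMap ℂ ℂ))
  rw [Category.comp_id]
  exact (Spec.map_id _).symm

theorem mu_univ [Module.Finite ℂ E] :
    mu (Set.univ : Set E) = lef ^ Module.finrank ℂ E := by
  have key : ∀ n : ℕ, mu (Set.univ : Set (Fin n → ℂ)) = lef ^ n := by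
    intro n
    induction n with
    | zero =>
      have hb : Function.Bijective (algebraMap ℂ (reg (Set.univ : Set (Fin 0 → ℂ)))) := by
        refine ⟨fun a b h => congrArg (fun r => r.1 ⟨0, trivial⟩) h, fun r => ⟨r.1 ⟨0, trivial⟩, ?_⟩⟩
        ext x
        rw [Subsingleton.elim x ⟨0, trivial⟩]
        rfl
      rw [mu_of_zClosed zClosed_univ, pow_zero, ← cls_specVar_complex]
      exact (K0.cls_specVar_congr (AlgEquiv.ofBijective (Algebra.ofId ℂ _) hb)).symm
    | succ n ih =>
      rw [pow_succ, ← ih, lef_eq_mu, ← mu_prod zClosed_univ.locClosed zClosed_univ.locClosed,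
        Set.univ_prod_univ]
      let e := (Fin.consLinearEquiv ℂ (fun _ : Fin (n + 1) => ℂ)).symm.trans
        (LinearEquiv.prodComm ℂ _ _)
      exact mu_congr_polyMap e e.symm (polyMap_linear e.toLinearMap)
        (polyMap_linear e.symm.toLinearMap) (fun _ _ => trivial) (fun _ _ => trivial)
        (fun x _ => e.symm_apply_apply x) (fun x _ => e.apply_symm_apply x)
  rw [← key]
  let e := (Module.finBasis ℂ E).equivFun
  exact mu_congr_polyMap e e.symm (polyMap_linear e.toLinearMap)
    (polyMap_linear e.symm.toLinearMap) (fun _ _ => trivial) (fun _ _ => trivial)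
    (fun x _ => e.symm_apply_apply x) (fun x _ => e.apply_symm_apply x)

theorem locClosed_isUnit (d : ℕ) : LocClosed {M : Matrix (Fin d) (Fin d) ℂ | IsUnit M} := by
  have : {M : Matrix (Fin d) (Fin d) ℂ | IsUnit M} = {M | M.det ≠ 0} := by
    ext M
    exact (Matrix.isUnit_iff_isUnit_det M).trans isUnit_iff_ne_zero
  rw [this]
  exact locClosed_ne_zero (polyFun_det fun i j => polyFun_dual (Matrix.entryLinearMap ℂ ℂ i j))

/-- The class on the right is that of the graph of `1 / det`. Its ring of functions is the
localization of the polynomial ring at the generic determinant. -/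
theorem glCls_eq_mu (d : ℕ) : glCls d = mu {M : Matrix (Fin d) (Fin d) ℂ | IsUnit M} := by
  have hq : (fun M : Matrix (Fin d) (Fin d) ℂ => M.det) ∈ polyFun _ :=
    polyFun_det fun i j => polyFun_dual (Matrix.entryLinearMap ℂ ℂ i j)
  have h1 : mu {M : Matrix (Fin d) (Fin d) ℂ | IsUnit M} =
      kap (graphInv Set.univ fun M : Matrix (Fin d) (Fin d) ℂ => M.det) := by
    rw [mu_eq zClosed_univ (zClosed_setOf_eq_zero hq) (Set.subset_univ _), kap_eq_add_graphInv
      zClosed_univ hq, Set.univ_inter, add_sub_cancel_right]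
    ext M
    simpa using (Matrix.isUnit_iff_isUnit_det M).trans isUnit_iff_ne_zero
  rw [h1]
  let b := Matrix.stdBasis ℂ (Fin d) (Fin d)
  let P := MvPolynomial (Fin d × Fin d) ℂ
  let T := reg (graphInv Set.univ fun M : Matrix (Fin d) (Fin d) ℂ => M.det)
  have hloc := isLocalization_graphInv Set.univ hq
  let f : reg Set.univ →ₐ[ℂ] T := regComap Prod.fst polyMap_fst fun _ h => h.1
  let g : P →ₐ[ℂ] T := f.comp (evalReg b Set.univ)
  let D : P := Matrix.det (Matrix.mvPolynomialX (Fin d) (Fin d) ℂ)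
  have hD : evalReg b Set.univ D = ⟨_, restrict_mem_reg Set.univ hq⟩ := by
    ext M
    rw [evalReg_apply]
    have hM : (fun i => b.coord i M.1) = fun i => M.1 i.1 i.2 := by
      ext i
      rfl
    rw [hM, RingHom.map_det]
    exact congrArg Matrix.det (by ext i j; simp [Matrix.mvPolynomialX])
  let _ : Algebra P T := g.toRingHom.toAlgebra
  have _ : IsScalarTower ℂ P T := IsScalarTower.of_algebraMap_eq fun c => (g.commutes c).symm
  have hg : ∀ p, algebraMap P T p = f (evalReg b Set.univ p) := fun _ => rfl
  have _ : IsLocalization.Away D T := by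
    let _ := f.toRingHom.toAlgebra
    refine IsLocalization.Away.mk _ ?_ ?_ ?_
    · rw [hg, hD]
      exact hloc.map_units _ ⟨_, Submonoid.mem_powers _⟩
    · intro t
      obtain ⟨n, a, h⟩ := IsLocalization.Away.surj (⟨_, restrict_mem_reg Set.univ hq⟩ : reg _) t
      obtain ⟨p, rfl⟩ := evalReg_surjective b _ a
      refine ⟨n, p, ?_⟩
      rw [hg, hg, hD]
      exact h
    · intro p p' h
      obtain ⟨n, hn⟩ := IsLocalization.Away.exists_of_eq
        (⟨_, restrict_mem_reg Set.univ hq⟩ : reg _) (S := T) (a := evalReg b Set.univ p)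
        (b := evalReg b Set.univ p') h
      refine ⟨n, evalReg_univ_injective b ?_⟩
      rw [map_mul, map_mul, map_pow, hD]
      exact hn
  exact K0.cls_specVar_congr ((IsLocalization.algEquiv (Submonoid.powers D)
    (Localization.Away D) T).restrictScalars ℂ)

end Comparison

/-! ### Affine charts of projective space -/

section Dehomogenization

attribute [local instance] MvPolynomial.gradedAlgebra

open HomogeneousLocalization

variable {σ : Type} [Fintype σ]

theorem eval₂_mul_of_isHomogeneous {L : Type*} [CommRing L] (φ : ℂ →+* L) (c : L) (g : σ → L)
    {p : MvPolynomial σ ℂ} {n : ℕ} (hp : p.IsHomogeneous n) :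
    MvPolynomial.eval₂ φ (fun j => c * g j) p = c ^ n * MvPolynomial.eval₂ φ g p := by
  rw [MvPolynomial.eval₂_eq', MvPolynomial.eval₂_eq', Finset.mul_sum]
  refine Finset.sum_congr rfl fun d hd => ?_
  have h : ∑ i, d i = n := by
    have := hp (MvPolynomial.mem_support_iff.mp hd)
    rwa [Finsupp.weight_apply, Finsupp.sum_fintype _ _ (by simp), Finset.sum_congr rfl
      (fun i _ => by simp : ∀ i ∈ Finset.univ, d i • (1 : σ → ℕ) i = d i)] at this
  simp only [mul_pow, Finset.prod_mul_distrib, Finset.prod_pow_eq_pow_sum, h]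
  ring

/-- The degree zero part of the localization at a coordinate. -/
abbrev AwayX (i : σ) : Type :=
  Away (MvPolynomial.homogeneousSubmodule σ ℂ) (MvPolynomial.X i : MvPolynomial σ ℂ)

theorem X_mem_homogeneousSubmodule (i : σ) :
    (MvPolynomial.X i : MvPolynomial σ ℂ) ∈ MvPolynomial.homogeneousSubmodule σ ℂ 1 :=
  MvPolynomial.isHomogeneous_X ℂ i

/-- The structure map of the degree zero part of the localization at a coordinate. -/
def awayXAlgebraMap (i : σ) : ℂ →+* AwayX i :=
  (fromZeroRingHom (MvPolynomial.homogeneousSubmodule σ ℂ) _).comp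
    (algebraMap ℂ (MvPolynomial.homogeneousSubmodule σ ℂ 0))

/-- Dehomogenization of polynomials with respect to a coordinate. -/
def dehomog (i : σ) : MvPolynomial σ ℂ →+* AwayX i :=
  MvPolynomial.eval₂Hom (awayXAlgebraMap i) fun j =>
    Away.mk _ (X_mem_homogeneousSubmodule i) 1 (MvPolynomial.X j) (X_mem_homogeneousSubmodule j)

theorem val_awayXAlgebraMap (i : σ) (c : ℂ) :
    (awayXAlgebraMap i c).val = algebraMap (MvPolynomial σ ℂ) _ (MvPolynomial.C c) := by
  rfl

theorem val_dehomog (i : σ) (p : MvPolynomial σ ℂ) :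
    (dehomog i p).val = MvPolynomial.eval₂
      ((algebraMap (MvPolynomial σ ℂ) (Localization.Away (MvPolynomial.X i))).comp MvPolynomial.C)
      (fun j => Localization.mk (MvPolynomial.X j) ⟨MvPolynomial.X i, 1, pow_one _⟩) p := by
  induction p using MvPolynomial.induction_on with
  | C a =>
    rw [dehomog, MvPolynomial.coe_eval₂Hom, MvPolynomial.eval₂_C, MvPolynomial.eval₂_C]
    exact val_awayXAlgebraMap i a
  | add p q hp hq => rw [map_add, MvPolynomial.eval₂_add, val_add, hp, hq]
  | mul_X p j hp =>
    rw [map_mul, MvPolynomial.eval₂_mul, val_mul, hp, MvPolynomial.eval₂_X]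
    congr 1
    rw [dehomog, MvPolynomial.coe_eval₂Hom, MvPolynomial.eval₂_X, Away.val_mk]
    congr 1
    exact Subtype.ext (pow_one _)

/-- Homogeneity gives `X_i ^ n * p(X / X_i) = p(X)`, and `X_i` can be cancelled in the localization.
-/
theorem dehomog_of_mem (i : σ) {p : MvPolynomial σ ℂ} {n : ℕ}
    (hp : p ∈ MvPolynomial.homogeneousSubmodule σ ℂ (n • 1)) :
    dehomog i p = Away.mk _ (X_mem_homogeneousSubmodule i) n p hp := by
  have hp' : p.IsHomogeneous n := by
    rw [smul_eq_mul, mul_one] at hp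
    exact hp
  apply val_injective
  rw [Away.val_mk, val_dehomog]
  let x : Localization.Away (MvPolynomial.X i : MvPolynomial σ ℂ) :=
    algebraMap (MvPolynomial σ ℂ) _ (MvPolynomial.X i)
  have hx : IsUnit x := IsLocalization.Away.algebraMap_isUnit _
  have h := eval₂_mul_of_isHomogeneous
    ((algebraMap (MvPolynomial σ ℂ) (Localization.Away (MvPolynomial.X i))).comp MvPolynomial.C)
    x (fun j => Localization.mk (MvPolynomial.X j) ⟨MvPolynomial.X i, 1, pow_one _⟩) hp'
  have h2 : (fun j => x * Localization.mk (MvPolynomial.X j)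
      (⟨MvPolynomial.X i, 1, pow_one _⟩ : Submonoid.powers (MvPolynomial.X i : MvPolynomial σ ℂ))) =
      fun j => algebraMap (MvPolynomial σ ℂ) _ (MvPolynomial.X j) := by
    ext j
    rw [Localization.mk_eq_mk', mul_comm]
    exact IsLocalization.mk'_spec _ _ (⟨MvPolynomial.X i, 1, pow_one _⟩ : Submonoid.powers _)
  have h3 : MvPolynomial.eval₂ ((algebraMap (MvPolynomial σ ℂ)
      (Localization.Away (MvPolynomial.X i : MvPolynomial σ ℂ))).comp MvPolynomial.C)
      (fun j => algebraMap (MvPolynomial σ ℂ) _ (MvPolynomial.X j)) p = algebraMap _ _ p := by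
    have := MvPolynomial.eval₂_comp_left (algebraMap (MvPolynomial σ ℂ)
      (Localization.Away (MvPolynomial.X i : MvPolynomial σ ℂ))) MvPolynomial.C MvPolynomial.X p
    rw [MvPolynomial.eval₂_eta] at this
    exact this.symm
  rw [h2, h3] at h
  refine (hx.pow n).mul_left_cancel ?_
  rw [← h, Localization.mk_eq_mk', mul_comm, ← map_pow]
  exact (IsLocalization.mk'_spec _ _ (⟨_, n, rfl⟩ : Submonoid.powers _)).symm

/-- The points of an affine chart of a projective closed set. -/
def chart (i : σ) (s : Set (MvPolynomial σ ℂ)) : Set (σ → ℂ) :=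
  {y | y i = 1 ∧ ∀ f ∈ s, MvPolynomial.eval y f = 0}

theorem isUnit_evalReg_X (i : σ) (s : Set (MvPolynomial σ ℂ)) :
    IsUnit (evalReg (Pi.basisFun ℂ σ) (chart i s) (MvPolynomial.X i)) := by
  have : evalReg (Pi.basisFun ℂ σ) (chart i s) (MvPolynomial.X i) = 1 := by
    ext y
    rw [evalReg_apply, MvPolynomial.eval_X]
    exact y.2.1
  rw [this]
  exact isUnit_one

/-- The extension of the evaluation of polynomials to the localization at a coordinate. -/
def chartLift (i : σ) (s : Set (MvPolynomial σ ℂ)) :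
    Localization.Away (MvPolynomial.X i : MvPolynomial σ ℂ) →+* reg (chart i s) :=
  IsLocalization.Away.lift (MvPolynomial.X i : MvPolynomial σ ℂ)
    (g := (evalReg (Pi.basisFun ℂ σ) (chart i s)).toRingHom) (isUnit_evalReg_X i s)

theorem chartLift_algebraMap (i : σ) (s : Set (MvPolynomial σ ℂ)) (p : MvPolynomial σ ℂ) :
    chartLift i s (algebraMap _ _ p) = evalReg (Pi.basisFun ℂ σ) (chart i s) p :=
  IsLocalization.Away.lift_eq _ _ _

/-- The restriction of functions on an affine chart of the projective space. -/
def chartHom (i : σ) (s : Set (MvPolynomial σ ℂ)) : AwayX i →+* reg (chart i s) :=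
  (chartLift i s).comp (algebraMap (AwayX i) (Localization.Away (MvPolynomial.X i)))

theorem chartHom_awayXAlgebraMap (i : σ) (s : Set (MvPolynomial σ ℂ)) (c : ℂ) :
    chartHom i s (awayXAlgebraMap i c) = algebraMap ℂ _ c := by
  rw [chartHom, RingHom.comp_apply]
  change chartLift i s (awayXAlgebraMap i c).val = _
  rw [val_awayXAlgebraMap, chartLift_algebraMap]
  exact (evalReg (Pi.basisFun ℂ σ) (chart i s)).commutes c

theorem chartHom_dehomog (i : σ) (s : Set (MvPolynomial σ ℂ)) (p : MvPolynomial σ ℂ) :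
    chartHom i s (dehomog i p) = evalReg (Pi.basisFun ℂ σ) (chart i s) p := by
  suffices (chartHom i s).comp (dehomog i) =
      (evalReg (Pi.basisFun ℂ σ) (chart i s)).toRingHom from DFunLike.congr_fun this p
  refine MvPolynomial.ringHom_ext (fun c => ?_) fun j => ?_
  · rw [RingHom.comp_apply, dehomog, MvPolynomial.coe_eval₂Hom, MvPolynomial.eval₂_C,
      chartHom_awayXAlgebraMap]
    exact ((evalReg (Pi.basisFun ℂ σ) (chart i s)).commutes c).symm
  · rw [RingHom.comp_apply, chartHom, RingHom.comp_apply]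
    change chartLift i s (dehomog i (MvPolynomial.X j)).val = _
    rw [val_dehomog, MvPolynomial.eval₂_X, Localization.mk_eq_mk']
    refine (isUnit_evalReg_X i s).mul_right_cancel ?_
    have h := IsLocalization.mk'_spec (Localization.Away (MvPolynomial.X i : MvPolynomial σ ℂ))
      (MvPolynomial.X j : MvPolynomial σ ℂ)
      (⟨MvPolynomial.X i, 1, pow_one _⟩ : Submonoid.powers (MvPolynomial.X i : MvPolynomial σ ℂ))
    have h2 := congrArg (chartLift i s) h
    rw [map_mul, chartLift_algebraMap, chartLift_algebraMap] at h2
    refine h2.trans ?_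
    have h1 : evalReg (Pi.basisFun ℂ σ) (chart i s) (MvPolynomial.X i) = 1 := by
      ext y
      rw [evalReg_apply, MvPolynomial.eval_X]
      exact y.2.1
    rw [h1, mul_one]
    rfl

theorem chartHom_surjective (i : σ) (s : Set (MvPolynomial σ ℂ)) :
    Function.Surjective (chartHom i s) := fun r => by
  obtain ⟨p, rfl⟩ := evalReg_surjective (Pi.basisFun ℂ σ) _ r
  exact ⟨dehomog i p, chartHom_dehomog i s p⟩

theorem dehomog_surjective (i : σ) : Function.Surjective (dehomog i) := fun a => by
  obtain ⟨n, p, hp, rfl⟩ := Away.mk_surjective _ (X_mem_homogeneousSubmodule i) a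
  exact ⟨p, dehomog_of_mem i hp⟩

theorem dehomog_X_self (i : σ) : dehomog i (MvPolynomial.X i) = 1 := by
  apply val_injective
  rw [val_dehomog, MvPolynomial.eval₂_X, val_one]
  exact Localization.mk_self (⟨MvPolynomial.X i, 1, pow_one _⟩ :
    Submonoid.powers (MvPolynomial.X i : MvPolynomial σ ℂ))

/-- The kernel is defined by points, the right-hand side by equations. By the Nullstellensatz, a
polynomial vanishing at the points of the chart has a power in the ideal of `X_i - 1` and `s`, and
dehomogenization kills `X_i - 1`. -/
theorem zeroLocus_ker_chartHom (i : σ) (s : Set (MvPolynomial σ ℂ)) :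
    PrimeSpectrum.zeroLocus (RingHom.ker (chartHom i s) : Set (AwayX i)) =
      PrimeSpectrum.zeroLocus (dehomog i '' s) := by
  apply Set.Subset.antisymm
  · refine PrimeSpectrum.zeroLocus_anti_mono ?_
    rintro _ ⟨f, hf, rfl⟩
    change chartHom i s _ = 0
    rw [chartHom_dehomog]
    ext y
    rw [evalReg_apply]
    exact y.2.2 f hf
  · intro 𝔮 h𝔮 a ha
    obtain ⟨p, rfl⟩ := dehomog_surjective i a
    have h1 : evalReg (Pi.basisFun ℂ σ) (chart i s) p = 0 := (chartHom_dehomog i s p).symm.trans ha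
    have h2 : p ∈ MvPolynomial.vanishingIdeal ℂ (MvPolynomial.zeroLocus ℂ
        (Ideal.span (insert (MvPolynomial.X i - 1) s))) := by
      rw [MvPolynomial.mem_vanishingIdeal_iff]
      intro y hy
      rw [MvPolynomial.mem_zeroLocus_iff] at hy
      have hy' : y ∈ chart i s := by
        refine ⟨?_, fun f hf => hy f (Ideal.subset_span (Set.mem_insert_of_mem _ hf))⟩
        have := hy _ (Ideal.subset_span (Set.mem_insert _ _))
        simpa [sub_eq_zero] using this
      have := congrArg (fun r => r.1 ⟨y, hy'⟩) h1
      simp only [evalReg_apply] at this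
      exact this
    rw [MvPolynomial.vanishingIdeal_zeroLocus_eq_radical] at h2
    obtain ⟨n, hn⟩ := h2
    have h3 : Ideal.span (insert (MvPolynomial.X i - 1) s) ≤ 𝔮.asIdeal.comap (dehomog i) := by
      rw [Ideal.span_le]
      rintro f (rfl | hf)
      · change dehomog i _ ∈ 𝔮.asIdeal
        rw [map_sub, map_one, dehomog_X_self, sub_self]
        exact zero_mem _
      · exact h𝔮 ⟨f, hf, rfl⟩
    refine 𝔮.2.mem_of_pow_mem n ?_
    rw [← map_pow]
    exact h3 hn

end Dehomogenization

/-! ### Classes of closed subschemes of the Plücker space -/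

section Projective

attribute [local instance] MvPolynomial.gradedAlgebra

open HomogeneousLocalization

variable {d k : ℕ}

instance locallyOfFiniteType_pluckerSpaceHom : LocallyOfFiniteType (pluckerSpaceHom d k) := by
  have : LocallyOfFiniteType (Spec.map (CommRingCat.ofHom
      (algebraMap ℂ (MvPolynomial.homogeneousSubmodule (MinorIdx d k) ℂ 0)))) := by
    rw [HasRingHomProperty.Spec_iff (P := @LocallyOfFiniteType)]
    exact RingHom.finiteType_algebraMap.mpr inferInstance
  unfold pluckerSpaceHom
  infer_instance

/-- The reduced closed subscheme of the Plücker space on a closed subset. -/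
def projVar (Z : TopologicalSpace.Closeds (PluckerSpace d k)) : Var where
  obj := Over.mk ((Scheme.IdealSheafData.vanishingIdeal Z).subschemeι ≫ pluckerSpaceHom d k)
  property := by
    refine ⟨?_, ?_, ?_⟩
    · dsimp; infer_instance
    · unfold pluckerSpaceHom; dsimp; infer_instance
    · unfold pluckerSpaceHom; dsimp; infer_instance

theorem grCls_eq_projVar : grCls d k = K0.cls (projVar (pluckerLocus d k)) := rfl

/-- The common zeros of homogeneous polynomials in the Plücker space. -/
def projZeros (s : Set (MvPolynomial (MinorIdx d k) ℂ)) :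
    TopologicalSpace.Closeds (PluckerSpace d k) :=
  ⟨ProjectiveSpectrum.zeroLocus (MvPolynomial.homogeneousSubmodule (MinorIdx d k) ℂ) s,
    ProjectiveSpectrum.isClosed_zeroLocus _ _⟩

/-- The affine chart of the Plücker space. -/
def chartι (i : MinorIdx d k) : Spec (CommRingCat.of (AwayX i)) ⟶ PluckerSpace d k :=
  Proj.awayι _ _ (X_mem_homogeneousSubmodule i) one_pos

instance isOpenImmersion_chartι (i : MinorIdx d k) : IsOpenImmersion (chartι i) := by
  unfold chartι
  infer_instance

theorem chartι_pluckerSpaceHom (i : MinorIdx d k) :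
    chartι i ≫ pluckerSpaceHom d k = Spec.map (CommRingCat.ofHom (awayXAlgebraMap i)) := by
  rw [chartι, pluckerSpaceHom, Proj.awayι_toSpecZero_assoc, ← Spec.map_comp,
    ← CommRingCat.ofHom_comp]
  rfl

theorem range_chartι (i : MinorIdx d k) :
    Set.range (chartι i) = {x : PluckerSpace d k | MvPolynomial.X i ∉ x.asHomogeneousIdeal} := by
  have h := Proj.opensRange_awayι (MvPolynomial.homogeneousSubmodule (MinorIdx d k) ℂ) _
    (X_mem_homogeneousSubmodule i) one_pos
  have h2 := congrArg (fun U : (PluckerSpace d k).Opens => (U : Set (PluckerSpace d k))) h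
  exact h2

theorem chartι_preimage (i : MinorIdx d k) {s : Set (MvPolynomial (MinorIdx d k) ℂ)}
    (hs : ∀ f ∈ s, ∃ e, f ∈ MvPolynomial.homogeneousSubmodule (MinorIdx d k) ℂ e) :
    chartι i ⁻¹' (projZeros s : Set (PluckerSpace d k)) =
      PrimeSpectrum.zeroLocus (dehomog i '' s) := by
  ext 𝔮
  have hq : MvPolynomial.X i ∉ (chartι i 𝔮 : PluckerSpace d k).asHomogeneousIdeal := by
    have : chartι i 𝔮 ∈ Set.range (chartι i) := ⟨𝔮, rfl⟩
    rwa [range_chartι] at this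
  have key : ∀ f ∈ s, f ∈ (chartι i 𝔮 : PluckerSpace d k).asHomogeneousIdeal ↔
      dehomog i f ∈ PrimeSpectrum.asIdeal (R := AwayX i) 𝔮 := by
    intro f hf
    obtain ⟨e, he⟩ := hs f hf
    -- The description of basic opens in a chart needs positive degree. The factor `X_i` provides it
    -- and does not affect membership in a prime that avoids `X_i`.
    have hg : f * MvPolynomial.X i ∈ MvPolynomial.homogeneousSubmodule (MinorIdx d k) ℂ (e + 1) :=
      SetLike.mul_mem_graded he (X_mem_homogeneousSubmodule i)
    have h := Proj.awayι_preimage_basicOpen (MvPolynomial.homogeneousSubmodule (MinorIdx d k) ℂ)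
      (X_mem_homogeneousSubmodule i) one_pos hg e.succ_pos
    have h2 : 𝔮 ∈ chartι i ⁻¹ᵁ Proj.basicOpen _ (f * MvPolynomial.X i) ↔
        𝔮 ∈ PrimeSpectrum.basicOpen (Away.isLocalizationElem (X_mem_homogeneousSubmodule i) hg) :=
      Eq.to_iff (congrArg (fun U => 𝔮 ∈ U) h)
    have h3 : dehomog i f = Away.isLocalizationElem (X_mem_homogeneousSubmodule i) hg := by
      have h4 : (f * MvPolynomial.X i) ^ 1 ∈
          MvPolynomial.homogeneousSubmodule (MinorIdx d k) ℂ ((e + 1) • 1) := by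
        rw [pow_one, smul_eq_mul, mul_one]
        exact hg
      refine Eq.trans ?_ (dehomog_of_mem i h4)
      rw [pow_one, map_mul, dehomog_X_self, mul_one]
    rw [← h3] at h2
    have h4 := not_congr h2
    have h5 : f * MvPolynomial.X i ∈ (chartι i 𝔮 : PluckerSpace d k).asHomogeneousIdeal ↔
        dehomog i f ∈ PrimeSpectrum.asIdeal (R := AwayX i) 𝔮 := by
      refine Iff.trans ?_ (h4.trans ?_)
      · exact not_not.symm
      · exact not_not
    rw [← h5]
    constructor
    · intro h
      exact Ideal.mul_mem_right _ _ h
    · intro h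
      exact ((chartι i 𝔮 : PluckerSpace d k).isPrime.mem_or_mem h).resolve_right hq
  constructor
  · rintro h _ ⟨f, hf, rfl⟩
    exact (key f hf).mp (h hf)
  · intro h f hf
    exact (key f hf).mpr (h ⟨f, hf, rfl⟩)

theorem range_projVar (Z : TopologicalSpace.Closeds (PluckerSpace d k)) :
    Set.range (Scheme.IdealSheafData.vanishingIdeal Z).subschemeι = (Z : Set (PluckerSpace d k)) :=
  (Scheme.IdealSheafData.range_subschemeι _).trans
    (Scheme.IdealSheafData.coe_support_vanishingIdeal Z)

theorem projZeros_eq_empty {s : Set (MvPolynomial (MinorIdx d k) ℂ)}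
    (hs : Set.range MvPolynomial.X ⊆ s) :
    (projZeros s : Set (PluckerSpace d k)) = ∅ := by
  have h := Proj.iSup_basicOpen_eq_top' (MvPolynomial.homogeneousSubmodule (MinorIdx d k) ℂ)
    MvPolynomial.X (fun i => ⟨1, X_mem_homogeneousSubmodule i⟩) (by
      rw [eq_top_iff]
      rintro p -
      induction p using MvPolynomial.induction_on with
      | C a =>
        exact Subalgebra.algebraMap_mem _
          (algebraMap ℂ (MvPolynomial.homogeneousSubmodule (MinorIdx d k) ℂ 0) a)
      | add p q hp hq => exact add_mem hp hq
      | mul_X p i hp => exact mul_mem hp (Algebra.subset_adjoin ⟨i, rfl⟩))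
  rw [Set.eq_empty_iff_forall_notMem]
  intro x hx
  have hx' : x ∈ (⨆ i, Proj.basicOpen (MvPolynomial.homogeneousSubmodule (MinorIdx d k) ℂ)
      (MvPolynomial.X i) : (PluckerSpace d k).Opens) := by
    rw [h]
    trivial
  obtain ⟨i, hi⟩ := TopologicalSpace.Opens.mem_iSup.mp hx'
  exact hi (hx (hs ⟨i, rfl⟩))

theorem cls_projVar_eq_zero {s : Set (MvPolynomial (MinorIdx d k) ℂ)}
    (hs : Set.range MvPolynomial.X ⊆ s) : K0.cls (projVar (projZeros s)) = 0 := by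
  have : IsEmpty (projVar (projZeros s)).obj.left := by
    constructor
    intro x
    have h : (Scheme.IdealSheafData.vanishingIdeal (projZeros s)).subschemeι x ∈
        (projZeros s : Set (PluckerSpace d k)) := by
      rw [← range_projVar]
      exact ⟨x, rfl⟩
    exact Set.notMem_empty _ (projZeros_eq_empty hs ▸ h)
  exact K0.cls_eq_zero_of_isEmpty _

/-- The part of a closed subscheme of the Plücker space in an affine chart. -/
def chartVar (i : MinorIdx d k) (Z : TopologicalSpace.Closeds (PluckerSpace d k)) : Var where
  obj := Over.mk (pullback.snd (Scheme.IdealSheafData.vanishingIdeal Z).subschemeι (chartι i) ≫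
    chartι i ≫ pluckerSpaceHom d k)
  property := by
    have h1 : IsAffineHom (chartι i ≫ pluckerSpaceHom d k) := by
      rw [chartι_pluckerSpaceHom]
      infer_instance
    refine ⟨?_, ?_, ?_⟩ <;> dsimp <;> infer_instance

theorem isReduced_reg {E : Type} [AddCommGroup E] [Module ℂ E] (S : Set E) :
    _root_.IsReduced (reg S) :=
  isReduced_of_injective (reg S).val Subtype.val_injective

/-- The ideal of the subscheme in the chart is never computed: the spectrum of `reg` is a reduced
closed subscheme with the same support, and the relation `[X] = [X_red]` suffices. -/
theorem cls_chartVar (i : MinorIdx d k) {s : Set (MvPolynomial (MinorIdx d k) ℂ)}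
    (hs : ∀ f ∈ s, ∃ e, f ∈ MvPolynomial.homogeneousSubmodule (MinorIdx d k) ℂ e) :
    K0.cls (chartVar i (projZeros s)) = kap (chart i s) := by
  let ι := (Scheme.IdealSheafData.vanishingIdeal (projZeros s)).subschemeι
  let u : pullback ι (chartι i) ⟶ Spec (CommRingCat.of (AwayX i)) := pullback.snd _ _
  have hu : IsClosedImmersion u := inferInstance
  have hur : Set.range u = PrimeSpectrum.zeroLocus (dehomog i '' s) := by
    rw [← chartι_preimage i hs, ← range_projVar]
    exact Scheme.Pullback.range_snd _ _
  obtain ⟨I, e, hue⟩ := IsClosedImmersion.Spec_iff.mp hu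
  have hIr : Set.range u = PrimeSpectrum.zeroLocus (I : Set (AwayX i)) := by
    have h1 : Set.range (Spec.map (CommRingCat.ofHom (Ideal.Quotient.mk I))) =
        PrimeSpectrum.zeroLocus (RingHom.ker (Ideal.Quotient.mk I) : Set (AwayX i)) :=
      range_comap_of_surjective _ _ Ideal.Quotient.mk_surjective
    rw [Ideal.mk_ker] at h1
    rw [← h1, hue, Scheme.Hom.comp_base, TopCat.coe_comp, Set.range_comp,
      (Set.range_eq_univ (f := e.hom)).mpr e.hom.homeomorph.surjective, Set.image_univ]
  -- `I` and the kernel of `chartHom` have the same zero locus, so `a` has a power in the kernel;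
  -- the target is reduced.
  have hI : ∀ a ∈ I, chartHom i s a = 0 := by
    intro a ha
    have h1 : a ∈ PrimeSpectrum.vanishingIdeal
        (PrimeSpectrum.zeroLocus (RingHom.ker (chartHom i s) : Set (AwayX i))) := by
      rw [zeroLocus_ker_chartHom, ← hur, hIr, PrimeSpectrum.vanishingIdeal_zeroLocus_eq_radical]
      exact Ideal.le_radical ha
    rw [PrimeSpectrum.vanishingIdeal_zeroLocus_eq_radical] at h1
    obtain ⟨n, hn⟩ := h1
    have hn' : chartHom i s a ^ n = 0 := (map_pow _ _ _).symm.trans hn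
    have := isReduced_reg (chart i s)
    exact (IsNilpotent.eq_zero ⟨n, hn'⟩)
  let φ : AwayX i ⧸ I →+* reg (chart i s) := Ideal.Quotient.lift I (chartHom i s) hI
  have hφ : Function.Surjective φ :=
    Ideal.Quotient.lift_surjective_of_surjective I hI (chartHom_surjective i s)
  let c : Spec (CommRingCat.of (reg (chart i s))) ⟶ pullback ι (chartι i) :=
    Spec.map (CommRingCat.ofHom φ) ≫ e.inv
  have hcu : c ≫ u = Spec.map (CommRingCat.ofHom (chartHom i s)) := by
    rw [hue, Category.assoc, e.inv_hom_id_assoc, ← Spec.map_comp, ← CommRingCat.ofHom_comp]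
    rfl
  have hc : IsClosedImmersion c := by
    have : IsClosedImmersion (Spec.map (CommRingCat.ofHom φ)) :=
      IsClosedImmersion.spec_of_surjective _ hφ
    infer_instance
  let c' : specVar (reg (chart i s)) ⟶ chartVar i (projZeros s) :=
    ObjectProperty.homMk (Over.homMk c (by
      change c ≫ u ≫ chartι i ≫ pluckerSpaceHom d k = Spec.map _
      rw [chartι_pluckerSpaceHom, ← Category.assoc, hcu, ← Spec.map_comp,
        ← CommRingCat.ofHom_comp]
      congr 2
      ext x : 1
      exact chartHom_awayXAlgebraMap i s x))
  refine K0.cls_eq_of_red c' hc ?_ ?_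
  · intro x
    have hx : u x ∈ Set.range (c ≫ u) := by
      have h1 : Set.range (Spec.map (CommRingCat.ofHom (chartHom i s))) =
          PrimeSpectrum.zeroLocus (RingHom.ker (chartHom i s) : Set (AwayX i)) :=
        range_comap_of_surjective _ _ (chartHom_surjective i s)
      rw [hcu, h1, zeroLocus_ker_chartHom, ← hur]
      exact ⟨x, rfl⟩
    obtain ⟨y, hy⟩ := hx
    refine ⟨y, (Scheme.Hom.isClosedEmbedding u).injective ?_⟩
    exact hy
  · have := isReduced_reg (chart i s)
    exact inferInstanceAs (IsReduced (Spec (CommRingCat.of (reg (chart i s)))))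

/-- The hyperplane `X_i = 0` cuts out the closed part; the open complement is the part in the chart.
-/
theorem cls_projVar_insert (i : MinorIdx d k) {s : Set (MvPolynomial (MinorIdx d k) ℂ)}
    (hs : ∀ f ∈ s, ∃ e, f ∈ MvPolynomial.homogeneousSubmodule (MinorIdx d k) ℂ e) :
    K0.cls (projVar (projZeros s)) =
      kap (chart i s) + K0.cls (projVar (projZeros (insert (MvPolynomial.X i) s))) := by
  rw [← cls_chartVar i hs]
  have hle : projZeros (insert (MvPolynomial.X i) s) ≤ projZeros s :=
    ProjectiveSpectrum.zeroLocus_anti_mono _ (Set.subset_insert _ _)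
  let ι := (Scheme.IdealSheafData.vanishingIdeal (projZeros s)).subschemeι
  let inc := Scheme.IdealSheafData.inclusion
    (Scheme.IdealSheafData.vanishingIdeal_antimono hle)
  have hinc : inc ≫ ι = (Scheme.IdealSheafData.vanishingIdeal
      (projZeros (insert (MvPolynomial.X i) s))).subschemeι :=
    Scheme.IdealSheafData.inclusion_subschemeι _
  have hclosed : IsClosedImmersion inc := by
    have : IsClosedImmersion (inc ≫ ι) := by
      rw [hinc]
      infer_instance
    exact IsClosedImmersion.of_comp_isClosedImmersion inc ι
  let j : chartVar i (projZeros s) ⟶ projVar (projZeros s) :=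
    ObjectProperty.homMk (Over.homMk (pullback.fst ι (chartι i)) (by
      change pullback.fst ι (chartι i) ≫ ι ≫ pluckerSpaceHom d k =
        pullback.snd ι (chartι i) ≫ chartι i ≫ pluckerSpaceHom d k
      rw [pullback.condition_assoc]))
  let c : projVar (projZeros (insert (MvPolynomial.X i) s)) ⟶ projVar (projZeros s) :=
    ObjectProperty.homMk (Over.homMk inc (by
      change inc ≫ ι ≫ pluckerSpaceHom d k = _
      rw [← Category.assoc, hinc]
      rfl))
  refine K0.cls_eq_add j c (inferInstanceAs (IsOpenImmersion (pullback.fst ι (chartι i))))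
    hclosed ?_
  change Set.range inc = (Set.range (pullback.fst ι (chartι i)))ᶜ
  rw [Scheme.Pullback.range_fst, range_chartι]
  have hr : ι '' Set.range inc = (projZeros (insert (MvPolynomial.X i) s) :
      Set (PluckerSpace d k)) := by
    rw [← range_projVar, ← hinc, ← Set.range_comp]
    rfl
  have hinj : Function.Injective ι := (Scheme.Hom.isClosedEmbedding ι).injective
  rw [← hinj.preimage_image (Set.range inc), hr]
  ext x
  have hx : ι x ∈ (projZeros s : Set (PluckerSpace d k)) := by
    rw [← range_projVar]
    exact ⟨x, rfl⟩
  constructor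
  · intro h h2
    exact h2 (h (Set.mem_insert _ _))
  · rintro h f (rfl | hf)
    · exact not_not.mp h
    · exact hx hf

end Projective

/-! ### Polynomial maps given by coordinates -/

section PolyMapPi

variable {E : Type} [AddCommGroup E] [Module ℂ E]

theorem polyMap_pi {ι : Type} [Fintype ι] {f : E → ι → ℂ}
    (h : ∀ i, (fun x => f x i) ∈ polyFun E) : PolyMap f := fun φ => by
  classical
  have h1 : (fun x => φ (f x)) = fun x => ∑ i, f x i * φ (Pi.single i 1) := by
    ext x
    conv_lhs => rw [← Finset.univ_sum_single (f x), map_sum]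
    refine Finset.sum_congr rfl fun i _ => ?_
    rw [← smul_eq_mul, ← map_smul, ← Pi.single_smul, smul_eq_mul, mul_one]
  rw [h1]
  exact polyFun_sum _ fun i _ => polyFun_mul (h i) (polyFun_const _)

theorem polyMap_matrix {ι κ : Type} [Fintype ι] [Fintype κ] {f : E → Matrix ι κ ℂ}
    (h : ∀ i j, (fun x => f x i j) ∈ polyFun E) : PolyMap f := by
  have h1 : PolyMap fun x => (fun p : ι × κ => f x p.1 p.2) := polyMap_pi fun p => h p.1 p.2
  exact (polyMap_linear (LinearEquiv.curry ℂ ℂ ι κ).toLinearMap).comp h1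

end PolyMapPi

/-! ### Cell decompositions of Grassmannians -/

section Cells

variable {k m : ℕ}

/-- An enumeration of the maximal minors. -/
def minorEnum (d k : ℕ) : Fin (Nat.card (MinorIdx d k)) ≃ MinorIdx d k := (Finite.equivFin _).symm

/-- The splitting of the rows of a matrix into those of a maximal minor and the other ones. -/
def splitRows (P : MinorIdx k (k + m)) : Fin k ⊕ Fin m ≃ Fin (k + m) := by
  classical
  exact (Equiv.sumCongr (Equiv.ofInjective P P.injective)
    (Fintype.equivOfCardEq (by
      rw [Fintype.card_compl_set, Set.card_range_of_injective P.injective]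
      simp))).trans (Equiv.Set.sumCompl (Set.range P))

@[simp]
theorem splitRows_inl (P : MinorIdx k (k + m)) (j : Fin k) : splitRows P (Sum.inl j) = P j := by
  simp [splitRows]

@[simp]
theorem splitRows_symm_apply (P : MinorIdx k (k + m)) (j : Fin k) :
    (splitRows P).symm (P j) = Sum.inl j := by
  rw [Equiv.symm_apply_eq, splitRows_inl]

/-- The maximal minors of the matrix with rows `P` equal to the identity matrix and the other rows
given by `X`. -/
def cellMinor (P J : MinorIdx k (k + m)) (X : Matrix (Fin m) (Fin k) ℂ) : ℂ :=
  ((Matrix.fromRows 1 X).submatrix ((splitRows P).symm ∘ J) id).det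

/-- The Schubert-like cells of the Grassmannian: the matrices of full rank whose first nonzero
maximal minor is a given one, up to column operations. -/
def cell (i : Fin (Nat.card (MinorIdx k (k + m)))) : Set (Matrix (Fin m) (Fin k) ℂ) :=
  {X | ∀ j < i, cellMinor (minorEnum _ _ i) (minorEnum _ _ j) X = 0}

theorem cellMinor_mem_polyFun (P J : MinorIdx k (k + m)) :
    cellMinor P J ∈ polyFun (Matrix (Fin m) (Fin k) ℂ) := by
  refine polyFun_det fun i j => ?_
  simp only [Matrix.submatrix_apply, Function.comp_apply, id]
  rcases (splitRows P).symm (J i) with a | b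
  · exact polyFun_const _
  · exact polyFun_dual (Matrix.entryLinearMap ℂ ℂ b j)

theorem zClosed_cell (i : Fin (Nat.card (MinorIdx k (k + m)))) : ZClosed (cell i) := by
  have : cell i = ⋂ j, ⋂ _ : j < i,
      {X | cellMinor (minorEnum _ _ i) (minorEnum _ _ j) X = 0} := by
    ext X
    simp [cell]
  rw [this]
  exact ZClosed.iInter fun j => ZClosed.iInter fun _ =>
    zClosed_setOf_eq_zero (cellMinor_mem_polyFun _ _)

theorem cellMinor_self (P : MinorIdx k (k + m)) (X : Matrix (Fin m) (Fin k) ℂ) :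
    cellMinor P P X = 1 := by
  have : (Matrix.fromRows 1 X).submatrix ((splitRows P).symm ∘ P) id = 1 := by
    ext i j
    simp
  rw [cellMinor, this, Matrix.det_one]

/-- A determinant with columns taken from a matrix is a multiple of a maximal minor. -/
theorem exists_det_submatrix_eq {d k : ℕ} (I : MinorIdx d k) (h : Fin d → Fin k) :
    ∃ (c : ℤ) (J : MinorIdx d k), ∀ {R : Type} [CommRing R] (M : Matrix (Fin d) (Fin k) R),
      (M.submatrix id h).det = c * (M.submatrix id J).det := by
  by_cases hh : Function.Injective h
  · have hm : StrictMono (h ∘ Tuple.sort h) :=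
      (Tuple.monotone_sort h).strictMono_of_injective (hh.comp (Equiv.injective _))
    -- Sorting makes the choice of columns increasing at the cost of a sign.
    refine ⟨Equiv.Perm.sign (Tuple.sort h), OrderEmbedding.ofStrictMono _ hm, fun {R} _ M => ?_⟩
    have h1 := Matrix.det_permute' (Tuple.sort h) (M.submatrix id h)
    rw [Matrix.submatrix_submatrix] at h1
    have h2 : (M.submatrix id (OrderEmbedding.ofStrictMono _ hm)).det =
      (M.submatrix (id ∘ id) (h ∘ Tuple.sort h)).det := rfl
    rw [h2, h1, ← mul_assoc, ← Int.cast_mul, ← Units.val_mul, Int.units_mul_self]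
    simp
  · refine ⟨0, I, fun {R} _ M => ?_⟩
    simp only [Function.Injective, not_forall] at hh
    obtain ⟨a, b, hab, hne⟩ := hh
    rw [Int.cast_zero, zero_mul]
    refine Matrix.det_zero_of_column_eq hne fun i => ?_
    simp [hab]

/-- The sign in `exists_det_submatrix_eq`. -/
def sortSign {d k : ℕ} (I : MinorIdx d k) (h : Fin d → Fin k) : ℤ :=
  (exists_det_submatrix_eq I h).choose

/-- The maximal minor in `exists_det_submatrix_eq`. -/
def sortIdx {d k : ℕ} (I : MinorIdx d k) (h : Fin d → Fin k) : MinorIdx d k :=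
  (exists_det_submatrix_eq I h).choose_spec.choose

theorem det_submatrix_eq {d k : ℕ} (I : MinorIdx d k) (h : Fin d → Fin k) {R : Type} [CommRing R]
    (M : Matrix (Fin d) (Fin k) R) :
    (M.submatrix id h).det = sortSign I h * (M.submatrix id (sortIdx I h)).det :=
  (exists_det_submatrix_eq I h).choose_spec.choose_spec M

end Cells

/-! ### Plücker relations and the strata of the Grassmannian -/

section Chart

open MvPolynomial hiding eval

attribute [local instance] MvPolynomial.gradedAlgebra

variable {d k m : ℕ}

/-- Stratification by the first nonzero homogeneous coordinate. What remains after all of them is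
the locus where every coordinate vanishes, which is empty. -/
theorem cls_projVar_eq_sum {s : Set (MvPolynomial (MinorIdx d k) ℂ)}
    (hs : ∀ f ∈ s, ∃ e, f ∈ MvPolynomial.homogeneousSubmodule (MinorIdx d k) ℂ e) :
    K0.cls (projVar (projZeros s)) =
      ∑ i, kap (chart (minorEnum d k i) (s ∪ {f | ∃ j < i, f = X (minorEnum d k j)})) := by
  have key : ∀ t : Finset (Fin (Nat.card (MinorIdx d k))), K0.cls (projVar (projZeros s)) =
      ∑ i ∈ t, kap (chart (minorEnum d k i)
        (s ∪ {f | ∃ j ∈ t, j < i ∧ f = X (minorEnum d k j)})) +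
        K0.cls (projVar (projZeros (s ∪ {f | ∃ j ∈ t, f = X (minorEnum d k j)}))) := by
    intro t
    induction t using Finset.induction_on_max with
    | empty => simp
    | insert a t ha ih =>
      have hat : a ∉ t := fun h => lt_irrefl a (ha a h)
      rw [ih, Finset.sum_insert hat, cls_projVar_insert (minorEnum d k a)]
      · have h1 : insert (X (minorEnum d k a)) (s ∪ {f | ∃ j ∈ t, f = X (minorEnum d k j)}) =
            s ∪ {f | ∃ j ∈ insert a t, f = X (minorEnum d k j)} := by
          ext f
          simp
          tauto
        have h2 : {f : MvPolynomial (MinorIdx d k) ℂ | ∃ j ∈ insert a t, j < a ∧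
            f = X (minorEnum d k j)} = {f | ∃ j ∈ t, f = X (minorEnum d k j)} := by
          ext f
          constructor
          · rintro ⟨j, hj, hja, rfl⟩
            exact ⟨j, (Finset.mem_insert.mp hj).resolve_left hja.ne, rfl⟩
          · rintro ⟨j, hj, rfl⟩
            exact ⟨j, Finset.mem_insert_of_mem hj, ha j hj, rfl⟩
        have h3 : ∀ i ∈ t, {f : MvPolynomial (MinorIdx d k) ℂ | ∃ j ∈ insert a t, j < i ∧
            f = X (minorEnum d k j)} = {f | ∃ j ∈ t, j < i ∧ f = X (minorEnum d k j)} := by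
          intro i hi
          ext f
          constructor
          · rintro ⟨j, hj, hji, rfl⟩
            refine ⟨j, (Finset.mem_insert.mp hj).resolve_left ?_, hji, rfl⟩
            rintro rfl
            exact lt_asymm hji (ha i hi)
          · rintro ⟨j, hj, hji, rfl⟩
            exact ⟨j, Finset.mem_insert_of_mem hj, hji, rfl⟩
        rw [h1, h2, Finset.sum_congr rfl fun i hi => by rw [← h3 i hi]]
        ring
      · rintro f (hf | ⟨j, -, rfl⟩)
        · exact hs f hf
        · exact ⟨1, X_mem_homogeneousSubmodule _⟩
  rw [key Finset.univ, cls_projVar_eq_zero, add_zero]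
  · simp
  · rintro _ ⟨J, rfl⟩
    exact Or.inr ⟨(minorEnum d k).symm J, Finset.mem_univ _, by simp⟩

/-- The homogeneous polynomial relations between the maximal minors. -/
def pluckerRel (d k : ℕ) : Set (MvPolynomial (MinorIdx d k) ℂ) :=
  {f | (∃ e, f ∈ homogeneousSubmodule (MinorIdx d k) ℂ e) ∧ pluckerHom d k f = 0}

theorem pluckerHom_X (J : MinorIdx d k) : pluckerHom d k (X J) =
    ((Matrix.mvPolynomialX (Fin d) (Fin k) ℂ).submatrix id J).det := by
  rw [pluckerHom, aeval_X]

theorem eval_minors_of_mem_pluckerRel {f : MvPolynomial (MinorIdx d k) ℂ}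
    (hf : f ∈ pluckerRel d k) (M : Matrix (Fin d) (Fin k) ℂ) :
    MvPolynomial.eval (fun J : MinorIdx d k => (M.submatrix id J).det) f = 0 := by
  have h := congrArg (MvPolynomial.eval fun p : Fin d × Fin k => M p.1 p.2) hf.2
  rw [map_zero] at h
  rw [← h]
  change MvPolynomial.eval _ f = ((MvPolynomial.eval fun p : Fin d × Fin k => M p.1 p.2).comp
    (pluckerHom d k).toRingHom) f
  congr 1
  refine ringHom_ext (fun c => ?_) fun J => ?_
  · have : (pluckerHom d k).toRingHom (C c) = C c := (pluckerHom d k).commutes c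
    rw [RingHom.comp_apply, this, eval_C, eval_C]
  · change _ = MvPolynomial.eval _ (pluckerHom d k (X J))
    rw [eval_X, pluckerHom_X, RingHom.map_det]
    congr 1
    ext a b
    simp [Matrix.mvPolynomialX]

/-- The matrix of full rank with Plücker coordinates proportional to the given ones, in the chart
of a coordinate. -/
def pluckerMatrix {R : Type} [CommRing R] (I : MinorIdx d (d + m)) (y : MinorIdx d (d + m) → R) :
    Matrix (Fin m) (Fin d) R :=
  Matrix.of fun b j => sortSign I (Function.update I j (splitRows I (Sum.inr b))) *
    y (sortIdx I (Function.update I j (splitRows I (Sum.inr b))))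

/-- The generic form of `pluckerMatrix`, on top of a scalar matrix. -/
def adjacentMatrix (I : MinorIdx d (d + m)) :
    Matrix (Fin d ⊕ Fin m) (Fin d) (MvPolynomial (MinorIdx d (d + m)) ℂ) :=
  Matrix.fromRows ((X I : MvPolynomial (MinorIdx d (d + m)) ℂ) • 1) (pluckerMatrix I X)

/-- The relation that expresses a Plücker coordinate by the ones that are adjacent to a given
one. -/
def adjacentRel (I J : MinorIdx d (d + m)) : MvPolynomial (MinorIdx d (d + m)) ℂ :=
  X I ^ d * X J - X I * ((adjacentMatrix I).submatrix
    ((splitRows I).symm ∘ J) id).det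

theorem adjacentRel_isHomogeneous (I J : MinorIdx d (d + m)) :
    (adjacentRel I J).IsHomogeneous (d + 1) := by
  refine IsHomogeneous.sub ?_ ?_
  · have := ((isHomogeneous_X ℂ I).pow d).mul (isHomogeneous_X ℂ J)
    rwa [one_mul] at this
  · rw [add_comm d 1]
    refine (isHomogeneous_X ℂ I).mul ?_
    rw [Matrix.det_apply']
    refine IsHomogeneous.sum _ _ _ fun σ _ => ?_
    have h1 : (∏ i : Fin d, (adjacentMatrix I).submatrix
        ((splitRows I).symm ∘ J) id (σ i) i : MvPolynomial (MinorIdx d (d + m)) ℂ).IsHomogeneous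
        (∑ _i : Fin d, 1) := by
      refine IsHomogeneous.prod _ _ _ fun i _ => ?_
      simp only [Matrix.submatrix_apply, Function.comp_apply, id]
      rcases (splitRows I).symm (J (σ i)) with a | b
      · simp only [adjacentMatrix, Matrix.fromRows_apply_inl, Matrix.smul_apply, Matrix.one_apply]
        split_ifs
        · simpa using isHomogeneous_X ℂ I
        · simpa using isHomogeneous_zero _ _ _
      · simp only [adjacentMatrix, Matrix.fromRows_apply_inr, pluckerMatrix, Matrix.of_apply]
        have := (isHomogeneous_C (MinorIdx d (d + m)) ((sortSign I (Function.update I i (splitRows I (Sum.inr b))) : ℤ) : ℂ)).mul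
          (isHomogeneous_X ℂ (sortIdx I (Function.update I i (splitRows I (Sum.inr b)))))
        rw [zero_add] at this
        simpa using this
    have h2 := (isHomogeneous_C (MinorIdx d (d + m)) ((Equiv.Perm.sign σ : ℤ) : ℂ)).mul h1
    simpa using h2

/-- Let `B` and `M_J` be the column blocks `I` and `J` of the generic matrix. By Cramer's rule the
entries of `adj B * M_J` are minors with one column of `I` exchanged, that is, Plücker coordinates
up to sign; its determinant is `det (adj B) * det M_J`. The additional factor `X_I` turns `det (adj
B)` into `(det B) ^ d`, also for `d = 0`. -/
theorem adjacentRel_mem (I J : MinorIdx d (d + m)) : adjacentRel I J ∈ pluckerRel d (d + m) := by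
  refine ⟨⟨d + 1, adjacentRel_isHomogeneous I J⟩, ?_⟩
  let M := Matrix.mvPolynomialX (Fin d) (Fin (d + m)) ℂ
  let B := M.submatrix id I
  have h : ((adjacentMatrix I).submatrix
      ((splitRows I).symm ∘ J) id).map (pluckerHom d (d + m)) =
        (B.adjugate * M.submatrix id J).transpose := by
    ext i j : 1
    have hJ : (B.adjugate * M.submatrix id J) j i = (M.submatrix id (Function.update I j (J i))).det := by
      have h1 : (B.adjugate * M.submatrix id J) j i = B.cramer (fun a => M a (J i)) j := by
        rw [Matrix.cramer_eq_adjugate_mulVec]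
        rfl
      rw [h1, Matrix.cramer_apply]
      congr 1
      ext a b : 1
      rw [Matrix.updateCol_apply, Matrix.submatrix_apply, Function.update_apply]
      split_ifs with hb
      · rfl
      · rfl
    rw [Matrix.transpose_apply, hJ, Matrix.map_apply, Matrix.submatrix_apply, Function.comp_apply]
    rcases hc : (splitRows I).symm (J i) with a | b
    · rw [Equiv.symm_apply_eq, splitRows_inl] at hc
      rw [adjacentMatrix, Matrix.fromRows_apply_inl, hc, Matrix.smul_apply, Matrix.one_apply, id]
      split_ifs with hb
      · subst hb
        rw [Function.update_eq_self, smul_eq_mul, mul_one, pluckerHom_X]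
      · rw [smul_zero, map_zero]
        refine (Matrix.det_zero_of_column_eq hb fun c => ?_).symm
        simp [Function.update_of_ne hb]
    · rw [Equiv.symm_apply_eq] at hc
      rw [adjacentMatrix, Matrix.fromRows_apply_inr, hc, id, pluckerMatrix,
        Matrix.of_apply, map_mul, pluckerHom_X, map_intCast]
      exact (det_submatrix_eq I _ M).symm
  have h2 : pluckerHom d (d + m) ((adjacentMatrix I).submatrix
      ((splitRows I).symm ∘ J) id).det = B.adjugate.det * (M.submatrix id J).det := by
    rw [AlgHom.map_det, AlgHom.mapMatrix_apply, h, Matrix.det_transpose, Matrix.det_mul]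
  have h3 : B.det * B.adjugate.det = B.det ^ d := by
    rw [← Matrix.det_mul, Matrix.mul_adjugate, Matrix.det_smul]
    simp
  rw [adjacentRel, map_sub, map_mul, map_mul, map_pow, h2, pluckerHom_X, pluckerHom_X,
    ← mul_assoc]
  change B.det ^ d * (M.submatrix id J).det - B.det * B.adjugate.det * (M.submatrix id J).det = 0
  rw [h3, sub_self]

/-- Where `y_I = 1`, the relations `adjacentRel` recover all coordinates as minors of the matrix
with identity rows at `I` and remaining rows `pluckerMatrix I y`. Conversely, minors satisfy every
Plücker relation. The vanishing of the earlier coordinates is the equation of the cell. -/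
theorem kap_chart_plucker (i : Fin (Nat.card (MinorIdx d (d + m)))) :
    kap (chart (minorEnum d (d + m) i)
      (pluckerRel d (d + m) ∪ {f | ∃ j < i, f = X (minorEnum d (d + m) j)})) = mu (cell i) := by
  rw [mu_of_zClosed (zClosed_cell i)]
  set I := minorEnum d (d + m) i with hI
  have hcoord : ∀ y ∈ chart I
      (pluckerRel d (d + m) ∪ {f | ∃ j < i, f = X (minorEnum d (d + m) j)}), ∀ J,
      cellMinor I J (pluckerMatrix I y) = y J := by
    intro y hy J
    have h := hy.2 _ (Or.inl (adjacentRel_mem I J))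
    rw [adjacentRel, map_sub, map_mul, map_mul, map_pow, eval_X, eval_X, hy.1, one_pow, one_mul,
      one_mul, sub_eq_zero, RingHom.map_det] at h
    rw [h, cellMinor]
    congr 1
    ext a b
    rw [RingHom.mapMatrix_apply, Matrix.map_apply, Matrix.submatrix_apply, Matrix.submatrix_apply]
    rcases ((splitRows I).symm ∘ J) a with a | a
    · simp [adjacentMatrix, Matrix.one_apply, hy.1, apply_ite]
    · simp [adjacentMatrix, pluckerMatrix]
  refine kap_congr (fun y => pluckerMatrix I y) (fun Y J => cellMinor I J Y) ?_ ?_ ?_ ?_ ?_ ?_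
  · exact polyMap_matrix fun b j => polyFun_mul (polyFun_const _) (polyFun_dual
      (LinearMap.proj (sortIdx I (Function.update I j (splitRows I (Sum.inr b)))) :
        (MinorIdx d (d + m) → ℂ) →ₗ[ℂ] ℂ))
  · exact polyMap_pi fun J => cellMinor_mem_polyFun I J
  · intro y hy j hj
    rw [hcoord y hy]
    simpa using hy.2 _ (Or.inr ⟨j, hj, rfl⟩)
  · intro Y hY
    refine ⟨cellMinor_self _ _, ?_⟩
    rintro f (hf | ⟨j, hj, rfl⟩)
    · have h := eval_minors_of_mem_pluckerRel hf
        (((Matrix.fromRows 1 Y).submatrix (splitRows I).symm id).transpose)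
      rw [← h]
      refine congrArg (fun y => MvPolynomial.eval y f) (funext fun J => ?_)
      beta_reduce
      rw [cellMinor, ← Matrix.det_transpose]
      rfl
    · rw [eval_X]
      exact hY j hj
  · intro y hy
    ext J
    exact hcoord y hy J
  · intro Y hY
    ext b j
    have h := det_submatrix_eq I (Function.update I j (splitRows I (Sum.inr b)))
        (((Matrix.fromRows 1 Y).submatrix (splitRows I).symm id).transpose)
    have h1 : pluckerMatrix I (fun J => cellMinor I J Y) b j =
        sortSign I (Function.update I j (splitRows I (Sum.inr b))) *
        cellMinor I (sortIdx I (Function.update I j (splitRows I (Sum.inr b)))) Y := rfl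
    rw [h1, cellMinor, ← Matrix.det_transpose]
    refine h.symm.trans ?_
    -- Exchanging column `j` of `I` for the one of row `b` leaves an identity matrix with one column
    -- replaced by `Y b`; its determinant is the entry `Y b j`.
    have h2 : (((Matrix.fromRows 1 Y).submatrix (splitRows I).symm id).transpose.submatrix id
        (Function.update I j (splitRows I (Sum.inr b)))) =
        Matrix.updateCol 1 j (fun c => Y b c) := by
      ext c c'
      rw [Matrix.updateCol_apply, Matrix.submatrix_apply, Matrix.transpose_apply,
        Matrix.submatrix_apply, Function.update_apply]
      split_ifs with hc
      · simp
      · simp [Matrix.one_apply, eq_comm]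
    rw [h2, ← Matrix.cramer_apply, Matrix.cramer_one]
    rfl

theorem grCls_eq_sum (d m : ℕ) :
    grCls d (d + m) = ∑ i : Fin (Nat.card (MinorIdx d (d + m))), mu (cell i) := by
  rw [grCls_eq_projVar]
  have h := cls_projVar_eq_sum (s := pluckerRel d (d + m)) fun f hf => hf.1
  exact h.trans (Finset.sum_congr rfl fun i _ => kap_chart_plucker i)

end Chart

/-! ### Stratification of matrices by the first nonzero minor -/

section RegMapBlocks

variable {E F : Type} [AddCommGroup E] [Module ℂ E] [AddCommGroup F] [Module ℂ F]
variable {ι ι' κ κ' : Type} [Fintype ι] [Fintype κ] [Fintype ι'] [Fintype κ'] {S : Set E}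

theorem RegMap.submatrix {M : E → Matrix ι κ F} (h : RegMap S M) (r : ι' → ι) (c : κ' → κ) :
    RegMap S fun x => (M x).submatrix r c :=
  RegMap.matrix fun i j => h.entry (r i) (c j)

theorem RegMap.fromBlocks {A : E → Matrix ι κ F} {B : E → Matrix ι κ' F} {C : E → Matrix ι' κ F}
    {D : E → Matrix ι' κ' F} (hA : RegMap S A) (hB : RegMap S B) (hC : RegMap S C)
    (hD : RegMap S D) : RegMap S fun x => Matrix.fromBlocks (A x) (B x) (C x) (D x) := by
  refine RegMap.matrix ?_
  rintro (i | i) (j | j)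
  · exact hA.entry i j
  · exact hB.entry i j
  · exact hC.entry i j
  · exact hD.entry i j

end RegMapBlocks

section Strata

variable {k m : ℕ}

/-- A left inverse makes the rows span `ℂ^k`, so `k` of them form a basis; sorting them changes only
the sign of the minor. -/
theorem exists_minor_ne_zero (M : Matrix (Fin (k + m)) (Fin k) ℂ)
    {N : Matrix (Fin k) (Fin (k + m)) ℂ} (h : N * M = 1) :
    ∃ i, (M.submatrix (minorEnum k (k + m) i) id).det ≠ 0 := by
  have hs : Submodule.span ℂ (Set.range M.row) = ⊤ := by
    rw [eq_top_iff]
    rintro v -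
    have hv : v = Matrix.vecMul (Matrix.vecMul v N) M := by
      rw [Matrix.vecMul_vecMul, h, Matrix.vecMul_one]
    rw [hv, Matrix.vecMul_eq_sum]
    exact Submodule.sum_mem _ fun i _ => Submodule.smul_mem _ _ (Submodule.subset_span ⟨i, rfl⟩)
  obtain ⟨f, hf, -, hli⟩ := Submodule.exists_fun_fin_finrank_span_eq ℂ (Set.range M.row)
  have hk : Module.finrank ℂ (Submodule.span ℂ (Set.range M.row)) = k := by
    rw [hs, finrank_top]
    simp
  choose r hr using hf
  have hu : IsUnit (M.submatrix (r ∘ Fin.cast hk.symm) id) := by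
    rw [← Matrix.linearIndependent_rows_iff_isUnit]
    have h1 : (M.submatrix (r ∘ Fin.cast hk.symm) id).row = f ∘ Fin.cast hk.symm := by
      ext i j
      exact congrFun (hr (Fin.cast hk.symm i)) j
    rw [h1]
    exact hli.comp _ (Fin.cast_injective _)
  rw [Matrix.isUnit_iff_isUnit_det, isUnit_iff_ne_zero] at hu
  have h2 := det_submatrix_eq (Fin.castAddOrderEmb m) (r ∘ Fin.cast hk.symm) M.transpose
  rw [← Matrix.transpose_submatrix, ← Matrix.transpose_submatrix, Matrix.det_transpose,
    Matrix.det_transpose] at h2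
  refine ⟨(minorEnum k (k + m)).symm (sortIdx (Fin.castAddOrderEmb m) (r ∘ Fin.cast hk.symm)),
    fun h0 => hu ?_⟩
  rw [h2]
  rw [Equiv.apply_symm_apply] at h0
  rw [h0, mul_zero]

theorem det_submatrix_eq_cellMinor {M : Matrix (Fin (k + m)) (Fin k) ℂ}
    {P : MinorIdx k (k + m)} {X : Matrix (Fin m) (Fin k) ℂ} {B : Matrix (Fin k) (Fin k) ℂ}
    (h : M.submatrix (splitRows P) id = Matrix.fromRows 1 X * B) (J : MinorIdx k (k + m)) :
    (M.submatrix J id).det = cellMinor P J X * B.det := by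
  rw [cellMinor, ← Matrix.det_mul]
  congr 1
  have h1 : M = (Matrix.fromRows 1 X * B).submatrix (splitRows P).symm id := by
    rw [← h]
    ext i j
    simp
  conv_lhs => rw [h1]
  rfl

/-- The sum of the classes of the cells of a Grassmannian. -/
def cellSum (k m : ℕ) : K0 := ∑ i : Fin (Nat.card (MinorIdx k (k + m))), mu (cell i)

/-- `GL_{k+m}` is stratified by the first nonzero maximal minor of the first `k` columns. On a
stratum a matrix is, up to a permutation of rows, `(B, Y; XB, XY + D)` with `B` and `D` invertible,
`Y` arbitrary and `X` in the cell. -/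
theorem cellSum_mul_glCls (k m : ℕ) :
    cellSum k m * (glCls k * (lef ^ (k * m) * glCls m)) = glCls (k + m) := by
  let q : Fin (Nat.card (MinorIdx k (k + m))) → Matrix (Fin (k + m)) (Fin (k + m)) ℂ → ℂ :=
    fun i A => (A.submatrix (minorEnum k (k + m) i) (Fin.castAdd m)).det
  have hq : ∀ i, q i ∈ polyFun (Matrix (Fin (k + m)) (Fin (k + m)) ℂ) := fun i =>
    polyFun_det fun a b => polyFun_dual (Matrix.entryLinearMap ℂ ℂ _ _)
  rw [glCls_eq_mu (k + m), mu_eq_sum (locClosed_isUnit (k + m)) hq, cellSum, Finset.sum_mul]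
  · refine Finset.sum_congr rfl fun i _ => ?_
    have h1 : lef ^ (k * m) = mu (Set.univ : Set (Matrix (Fin k) (Fin m) ℂ)) := by
      rw [mu_univ]
      simp [Module.finrank_matrix]
    have hl1 : LocClosed ((Set.univ : Set (Matrix (Fin k) (Fin m) ℂ)) ×ˢ
        {D : Matrix (Fin m) (Fin m) ℂ | IsUnit D}) :=
      zClosed_univ.locClosed.prod (locClosed_isUnit m)
    have hl2 := (locClosed_isUnit k).prod hl1
    have hl3 := (zClosed_cell i).locClosed.prod hl2
    rw [h1, glCls_eq_mu, glCls_eq_mu, ← mu_prod zClosed_univ.locClosed (locClosed_isUnit m),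
      ← mu_prod (locClosed_isUnit k) hl1, ← mu_prod (zClosed_cell i).locClosed hl2]
    symm
    have hstr := (locClosed_isUnit (k + m)).stratum hq i
    set S := {x | x ∈ {M : Matrix (Fin (k + m)) (Fin (k + m)) ℂ | IsUnit M} ∧ q i x ≠ 0 ∧
      ∀ j < i, q j x = 0} with hS
    set P := minorEnum k (k + m) i with hP
    let W : Matrix (Fin (k + m)) (Fin (k + m)) ℂ → Matrix (Fin k ⊕ Fin m) (Fin k ⊕ Fin m) ℂ :=
      fun A => A.submatrix (splitRows P) finSumFinEquiv
    have hWq : ∀ A (X : Matrix (Fin m) (Fin k) ℂ) B Y Z, W A = Matrix.fromBlocks B Y (X * B) Z → ∀ j,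
        q j A = cellMinor P (minorEnum k (k + m) j) X * B.det := by
      intro A X B Y Z hA j
      have h2 : (A.submatrix id (Fin.castAdd m)).submatrix (splitRows P) id =
          Matrix.fromRows 1 X * B := by
        rw [Matrix.fromRows_mul, Matrix.one_mul]
        ext a b
        have h3 := congrFun (congrFun hA a) (Sum.inl b)
        rcases a with a | a <;> simpa [W] using h3
      rw [← det_submatrix_eq_cellMinor h2]
      rfl
    have hW11 : ∀ A, q i A = ((W A).toBlocks₁₁).det := by
      intro A
      simp only [q]
      congr 1
    have hu : ∀ A ∈ S, IsUnit (W A).toBlocks₁₁ := by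
      intro A hA
      rw [Matrix.isUnit_iff_isUnit_det, isUnit_iff_ne_zero, ← hW11]
      exact hA.2.1
    have hWr : RegMap S W := (regMap_id S).submatrix _ _
    have hr11 : RegMap S fun A => (W A).toBlocks₁₁ := hWr.submatrix Sum.inl Sum.inl
    have hr12 : RegMap S fun A => (W A).toBlocks₁₂ := hWr.submatrix Sum.inl Sum.inr
    have hr21 : RegMap S fun A => (W A).toBlocks₂₁ := hWr.submatrix Sum.inr Sum.inl
    have hr22 : RegMap S fun A => (W A).toBlocks₂₂ := hWr.submatrix Sum.inr Sum.inr
    have hrX : RegMap S fun A => (W A).toBlocks₂₁ * Ring.inverse (W A).toBlocks₁₁ :=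
      hr21.matrix_mul (hr11.ringInverse hu)
    have hWg : ∀ (X : Matrix (Fin m) (Fin k) ℂ) B Y D, W ((Matrix.fromBlocks B Y (X * B) (X * Y + D)).submatrix
        (splitRows P).symm finSumFinEquiv.symm) =
          Matrix.fromBlocks B Y (X * B) (X * Y + D) := by
      intro X B Y D
      simp [W]
    refine mu_congr hstr hl3
      (fun A => ((W A).toBlocks₂₁ * Ring.inverse (W A).toBlocks₁₁, (W A).toBlocks₁₁,
        (W A).toBlocks₁₂, (W A).toBlocks₂₂ -
          (W A).toBlocks₂₁ * Ring.inverse (W A).toBlocks₁₁ * (W A).toBlocks₁₂))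
      (fun z => (Matrix.fromBlocks z.2.1 z.2.2.1 (z.1 * z.2.1) (z.1 * z.2.2.1 + z.2.2.2)).submatrix
        (splitRows P).symm finSumFinEquiv.symm) ?_ ?_ ?_ ?_ ?_ ?_
    · exact hrX.prodMk (hr11.prodMk (hr12.prodMk (hr22.sub (hrX.matrix_mul hr12))))
    · have hz := regMap_id (cell i ×ˢ ({M : Matrix (Fin k) (Fin k) ℂ | IsUnit M} ×ˢ
        ((Set.univ : Set (Matrix (Fin k) (Fin m) ℂ)) ×ˢ {D : Matrix (Fin m) (Fin m) ℂ | IsUnit D})))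
      exact (RegMap.fromBlocks hz.snd.fst hz.snd.snd.fst (hz.fst.matrix_mul hz.snd.fst)
        ((hz.fst.matrix_mul hz.snd.snd.fst).add hz.snd.snd.snd)).submatrix _ _
    · intro A hA
      have hB := hu A hA
      have h2 : W A = Matrix.fromBlocks (W A).toBlocks₁₁ (W A).toBlocks₁₂
          ((W A).toBlocks₂₁ * Ring.inverse (W A).toBlocks₁₁ * (W A).toBlocks₁₁)
            (W A).toBlocks₂₂ := by
        rw [Matrix.mul_assoc, Ring.inverse_mul_cancel _ hB, Matrix.mul_one,
          Matrix.fromBlocks_toBlocks]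
      refine ⟨fun j hj => ?_, hB, trivial, ?_⟩
      -- Each maximal minor of the first `k` columns is a minor for `X` times `det B ≠ 0`, so the
      -- stratum condition is the cell condition on `X`.
      · have h3 := (hWq A _ _ _ _ h2 j).symm.trans (hA.2.2 j hj)
        exact (mul_eq_zero.mp h3).resolve_right ((hW11 A).symm ▸ hA.2.1)
      · have h3 : IsUnit (W A) := (Matrix.isUnit_submatrix_equiv _ _).mpr hA.1
        let _ := hB.invertible
        rw [← Matrix.fromBlocks_toBlocks (W A), Matrix.isUnit_fromBlocks_iff_of_invertible₁₁,
          ← Ring.inverse_invertible] at h3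
        exact h3
    · rintro ⟨X, B, Y, D⟩ ⟨hX, hB, -, hD⟩
      have h2 := hWg X B Y D
      refine ⟨?_, ?_, fun j hj => ?_⟩
      · let _ := hB.invertible
        have h3 : IsUnit (Matrix.fromBlocks B Y (X * B) (X * Y + D)) := by
          rw [Matrix.isUnit_fromBlocks_iff_of_invertible₁₁, Matrix.mul_invOf_cancel_right,
            add_sub_cancel_left]
          exact hD
        exact (Matrix.isUnit_submatrix_equiv _ _).mpr h3
      · rw [hWq _ _ _ _ _ h2, cellMinor_self, one_mul]
        exact ((Matrix.isUnit_iff_isUnit_det B).mp hB).ne_zero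
      · rw [hWq _ _ _ _ _ h2, hX j hj, zero_mul]
    · intro A hA
      have hB := hu A hA
      have h2 : (W A).toBlocks₂₁ * Ring.inverse (W A).toBlocks₁₁ * (W A).toBlocks₁₁ =
          (W A).toBlocks₂₁ := by
        rw [Matrix.mul_assoc, Ring.inverse_mul_cancel _ hB, Matrix.mul_one]
      dsimp only
      rw [h2, add_sub_cancel, Matrix.fromBlocks_toBlocks]
      simp [W]
    · rintro ⟨X, B, Y, D⟩ ⟨hX, hB, -, hD⟩
      rw [hWg X B Y D]
      simp only [Matrix.toBlocks_fromBlocks₁₁, Matrix.toBlocks_fromBlocks₁₂,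
        Matrix.toBlocks_fromBlocks₂₁, Matrix.toBlocks_fromBlocks₂₂]
      rw [Matrix.mul_assoc, Ring.mul_inverse_cancel _ hB, Matrix.mul_one, add_sub_cancel_left]
  · intro A hA
    have h1 : ((A⁻¹).submatrix (Fin.castAdd m) id * A.submatrix id (Fin.castAdd m)) = 1 := by
      have h2 : A⁻¹ * A = 1 :=
        Matrix.nonsing_inv_mul _ ((Matrix.isUnit_iff_isUnit_det A).mp hA)
      ext a b
      have := congrFun (congrFun h2 (Fin.castAdd m a)) (Fin.castAdd m b)
      rw [Matrix.mul_apply] at this ⊢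
      simpa [Matrix.one_apply] using this
    exact exists_minor_ne_zero _ h1

end Strata

/-! ### Locally closed sets and regular maps -/

section LocallyClosed

variable {E F : Type} [AddCommGroup E] [Module ℂ E] [AddCommGroup F] [Module ℂ F]

theorem RegMap.comp_mem {S : Set E} {f : E → F} (hf : RegMap S f) {p : F → ℂ}
    (hp : p ∈ polyFun F) : RegOn S fun x => p (f x) := by
  induction hp using Algebra.adjoin_induction with
  | mem p hp => obtain ⟨φ, rfl⟩ := hp; exact hf φ
  | algebraMap r => exact regOn_const S r
  | add p q _ _ hp hq => exact hp.add hq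
  | mul p q _ _ hp hq => exact hp.mul hq

/-- On `S` a quotient of polynomials vanishes exactly where its numerator does. -/
theorem ZClosed.exists_inter_preimage {S : Set E} {V : Set F} (hV : ZClosed V) {f : E → F}
    (hf : RegMap S f) : ∃ V' : Set E, ZClosed V' ∧ S ∩ f ⁻¹' V = S ∩ V' := by
  have h : ∀ p : {p : polyFun F // ∀ y ∈ V, p.1 y = 0}, ∃ p' ∈ polyFun E, ∀ x ∈ S,
      p.1.1 (f x) = 0 ↔ p' x = 0 := by
    rintro ⟨⟨p, hp⟩, hpV⟩
    obtain ⟨a, ha, b, hb, hab⟩ := hf.comp_mem hp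
    refine ⟨a, ha, fun x hx => ?_⟩
    obtain ⟨h1, h2⟩ := hab x hx
    beta_reduce at h2
    change p (f x) = 0 ↔ _
    rw [h2, div_eq_zero_iff, or_iff_left h1]
  choose p' hp' hpp' using h
  refine ⟨⋂ p, {x | p' p x = 0}, ZClosed.iInter fun p => zClosed_setOf_eq_zero (hp' p), ?_⟩
  ext x
  constructor
  · rintro ⟨hx, hxV⟩
    exact ⟨hx, Set.mem_iInter.mpr fun p => (hpp' p x hx).mp (p.2 _ hxV)⟩
  · rintro ⟨hx, hxV⟩
    refine ⟨hx, hV fun p hp h => ?_⟩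
    exact (hpp' ⟨⟨p, hp⟩, h⟩ x hx).mpr (Set.mem_iInter.mp hxV _)

theorem LocClosed.inter_preimage [Module.Finite ℂ E] {S : Set E} {T : Set F}
    (hS : LocClosed S) (hT : LocClosed T)
    {f : E → F} (hf : RegMap S f) : LocClosed (S ∩ f ⁻¹' T) := by
  obtain ⟨V, W, hV, hW, rfl⟩ := hT
  obtain ⟨V', hV', h1⟩ := hV.exists_inter_preimage hf
  obtain ⟨W', hW', h2⟩ := hW.exists_inter_preimage hf
  have h3 : S ∩ f ⁻¹' (V \ W) = S ∩ (V' \ W') := by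
    ext x
    have h1x := Set.ext_iff.mp h1 x
    have h2x := Set.ext_iff.mp h2 x
    simp only [Set.mem_inter_iff, Set.mem_preimage, Set.mem_sdiff] at h1x h2x ⊢
    tauto
  rw [h3]
  exact hS.inter ⟨V', W', hV', hW', rfl⟩

theorem locClosed_of_cover [Module.Finite ℂ E] {ι : Type*} {S : Set E} {q : ι → E → ℂ}
    (hq : ∀ i, q i ∈ polyFun E)
    (h : ∀ x ∈ S, ∃ i, q i x ≠ 0) (hS : ∀ i, LocClosed ({x | q i x ≠ 0} ∩ S)) : LocClosed S := by
  choose V W hV hW hVW using hS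
  -- A point outside the intersection has some `q i ≠ 0` and avoids `W i`. The closure of `S` lies
  -- in `V i ∪ {q i = 0}`, so such a point of the closure lies in `V i \ W i`, hence in `S`.
  refine ⟨zcl S, ⋂ i, (W i ∪ {x | q i x = 0}), zClosed_zcl S,
    ZClosed.iInter fun i => (hW i).union (zClosed_setOf_eq_zero (hq i)), ?_⟩
  have hsub : ∀ i, zcl S ⊆ V i ∪ {x | q i x = 0} := fun i =>
    ((hV i).union (zClosed_setOf_eq_zero (hq i))).zcl_subset fun x hx => by
      by_cases h0 : q i x = 0
      · exact Or.inr h0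
      · exact Or.inl ((hVW i).le ⟨h0, hx⟩).1
  ext x
  constructor
  · intro hx
    refine ⟨subset_zcl S hx, fun hx' => ?_⟩
    obtain ⟨i, hi⟩ := h x hx
    rcases Set.mem_iInter.mp hx' i with hw | h0
    · exact ((hVW i).le ⟨hi, hx⟩).2 hw
    · exact hi h0
  · rintro ⟨hx, hx'⟩
    simp only [Set.mem_iInter, not_forall, Set.mem_union, not_or] at hx'
    obtain ⟨i, hw, h0⟩ := hx'
    have hv := (hsub i hx).resolve_right h0
    exact ((hVW i).ge ⟨hv, hw⟩).2

/-- A linear section splits `E` as `F × ker f`. -/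
theorem mu_preimage_linear [Module.Finite ℂ E] [Module.Finite ℂ F] (f : E →ₗ[ℂ] F)
    (hf : Function.Surjective f) {S : Set F} (hS : LocClosed S) {c : ℕ}
    (hc : Module.finrank ℂ E = Module.finrank ℂ F + c) : mu (f ⁻¹' S) = mu S * lef ^ c := by
  obtain ⟨s, hs⟩ := f.exists_rightInverse_of_surjective (LinearMap.range_eq_top.mpr hf)
  have hs' : ∀ y, f (s y) = y := fun y => LinearMap.congr_fun hs y
  have hk : Module.finrank ℂ (LinearMap.ker f) = c := by
    have h1 := f.finrank_range_add_finrank_ker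
    rw [LinearMap.range_eq_top.mpr hf, finrank_top] at h1
    omega
  rw [← hk, ← mu_univ, ← mu_prod hS zClosed_univ.locClosed]
  let pr : E →ₗ[ℂ] LinearMap.ker f := (LinearMap.id - s ∘ₗ f).codRestrict _ fun x => by
    simp [hs']
  refine mu_congr_polyMap (fun x => (f x, pr x)) (fun y => s y.1 + y.2)
    ((polyMap_linear f).prodMk (polyMap_linear pr))
    (polyMap_linear (s.coprod (LinearMap.ker f).subtype)) ?_ ?_ ?_ ?_
  · intro x hx
    exact ⟨hx, trivial⟩
  · rintro ⟨y, z⟩ ⟨hy, -⟩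
    change f (s y + z) ∈ S
    rw [map_add, hs', z.2, add_zero]
    exact hy
  · intro x _
    simp [pr]
  · rintro ⟨y, z⟩ -
    refine Prod.ext ?_ (Subtype.ext ?_)
    · simp [hs']
    · simp [pr, hs']

end LocallyClosed

/-! ### Orbits of matrices under row and column operations -/

section EquivOrbit

variable {R : Type} [CommRing R]
variable {ι κ ι' κ' : Type} [Fintype ι] [Fintype κ] [Fintype ι'] [Fintype κ']
  [DecidableEq ι] [DecidableEq κ] [DecidableEq ι'] [DecidableEq κ']

/-- The orbit of a matrix under multiplication by invertible matrices on both sides. -/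
def equivOrbit (T : Matrix ι κ R) : Set (Matrix ι κ R) :=
  {A | ∃ (g : Matrix ι ι R) (h : Matrix κ κ R), IsUnit g ∧ IsUnit h ∧ A = g * T * h}

theorem mul_mem_equivOrbit {T A : Matrix ι κ R} {g : Matrix ι ι R} {h : Matrix κ κ R}
    (hg : IsUnit g) (hh : IsUnit h) (hA : A ∈ equivOrbit T) : g * A * h ∈ equivOrbit T := by
  obtain ⟨g', h', hg', hh', rfl⟩ := hA
  exact ⟨g * g', h' * h, hg.mul hg', hh'.mul hh, by simp only [Matrix.mul_assoc]⟩

theorem mul_mem_equivOrbit_iff {T A : Matrix ι κ R} {g : Matrix ι ι R} {h : Matrix κ κ R}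
    (hg : IsUnit g) (hh : IsUnit h) : g * A * h ∈ equivOrbit T ↔ A ∈ equivOrbit T := by
  refine ⟨fun H => ?_, mul_mem_equivOrbit hg hh⟩
  have h1 := mul_mem_equivOrbit hg.ringInverse hh.ringInverse H
  have h2 : Ring.inverse g * (g * A * h) * Ring.inverse h = A := by
    rw [Matrix.mul_assoc g, ← Matrix.mul_assoc, Ring.inverse_mul_cancel _ hg, Matrix.one_mul,
      Matrix.mul_assoc, Ring.mul_inverse_cancel _ hh, Matrix.mul_one]
  rwa [h2] at h1

theorem submatrix_mem_equivOrbit_iff {T A : Matrix ι κ R} (σ : Equiv.Perm ι) (τ : Equiv.Perm κ) :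
    A.submatrix σ τ ∈ equivOrbit T ↔ A ∈ equivOrbit T := by
  have h1 : A.submatrix σ τ =
      (1 : Matrix ι ι R).submatrix σ id * A * (1 : Matrix κ κ R).submatrix id τ := by
    ext i j
    simp [Matrix.mul_apply, Matrix.one_apply]
  rw [h1]
  exact mul_mem_equivOrbit_iff ((Matrix.isUnit_submatrix_equiv σ (Equiv.refl ι)).mpr isUnit_one)
    ((Matrix.isUnit_submatrix_equiv (Equiv.refl κ) τ).mpr isUnit_one)

theorem submatrix_mem_equivOrbit_congr {T : Matrix ι κ R} {A : Matrix ι' κ' R} (e e' : ι ≃ ι')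
    (f f' : κ ≃ κ') :
    A.submatrix e f ∈ equivOrbit T ↔ A.submatrix e' f' ∈ equivOrbit T := by
  rw [← submatrix_mem_equivOrbit_iff (e.trans e'.symm) (f.trans f'.symm) (A := A.submatrix e' f')]
  have : (A.submatrix e' f').submatrix (e.trans e'.symm) (f.trans f'.symm) = A.submatrix e f := by
    ext i j
    simp
  rw [this]

theorem submatrix_mem_equivOrbit_submatrix_iff {T A : Matrix ι' κ' R} (e : ι ≃ ι') (f : κ ≃ κ') :
    A.submatrix e f ∈ equivOrbit (T.submatrix e f) ↔ A ∈ equivOrbit T := by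
  constructor
  · rintro ⟨g, h, hg, hh, hA⟩
    refine ⟨g.submatrix e.symm e.symm, h.submatrix f.symm f.symm,
      (Matrix.isUnit_submatrix_equiv _ _).mpr hg, (Matrix.isUnit_submatrix_equiv _ _).mpr hh, ?_⟩
    have h1 := congrArg (fun M => M.submatrix e.symm f.symm) hA
    simpa [← Matrix.submatrix_mul_equiv _ _ _ f.symm _, ← Matrix.submatrix_mul_equiv _ _ _ e.symm _]
      using h1
  · rintro ⟨g, h, hg, hh, rfl⟩
    refine ⟨g.submatrix e e, h.submatrix f f, (Matrix.isUnit_submatrix_equiv _ _).mpr hg,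
      (Matrix.isUnit_submatrix_equiv _ _).mpr hh, ?_⟩
    simp

variable {K : Type} [Field K] (ε : R →+* K) [IsLocalHom ε]

theorem isUnit_matrix_map_iff (M : Matrix ι ι R) : IsUnit (M.map ε) ↔ IsUnit M := by
  rw [Matrix.isUnit_iff_isUnit_det, Matrix.isUnit_iff_isUnit_det, ← RingHom.mapMatrix_apply,
    ← RingHom.map_det, isUnit_map_iff ε]

/-- Cancellation of the identity block. With blocks `g = (a, b; c, d)` and `h = (p, q; r, u)`,
reduction gives `a p = 1`, so `a` is invertible. The upper right block gives `q = -a⁻¹ b T u`, which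
reduces to zero, so `u` is invertible. The lower right block then reads `D = (d - c a⁻¹ b) T u`, and
the Schur complement of `g` is invertible. -/
theorem fromBlocks_one_mem_equivOrbit_iff {T D : Matrix ι' κ' R} (hT : T.map ε = 0) :
    Matrix.fromBlocks (1 : Matrix ι ι R) 0 0 D ∈ equivOrbit (Matrix.fromBlocks 1 0 0 T) ↔
      D ∈ equivOrbit T := by
  constructor
  · rintro ⟨g, h, hg, hh, H⟩
    rw [← Matrix.fromBlocks_toBlocks g, ← Matrix.fromBlocks_toBlocks h,
      Matrix.fromBlocks_multiply, Matrix.fromBlocks_multiply] at H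
    set a := g.toBlocks₁₁
    set b := g.toBlocks₁₂
    set c := g.toBlocks₂₁
    set d := g.toBlocks₂₂
    set p := h.toBlocks₁₁
    set q := h.toBlocks₁₂
    set r := h.toBlocks₂₁
    set u := h.toBlocks₂₂
    simp only [Matrix.mul_one, Matrix.mul_zero, add_zero, zero_add] at H
    obtain ⟨h11, h12, -, h22⟩ := Matrix.fromBlocks_inj.mp H
    have hTu : (T * u).map ε = 0 := by
      rw [Matrix.map_mul, hT, Matrix.zero_mul]
    have hap : a.map ε * p.map ε = 1 := by
      have h1 := congrArg (fun M => M.map ε) h11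
      simp only [Matrix.mul_assoc] at h1
      rw [Matrix.map_add _ (map_add ε), Matrix.map_mul, Matrix.map_mul, Matrix.map_mul, hT,
        Matrix.zero_mul, Matrix.mul_zero, add_zero] at h1
      rw [← h1, Matrix.map_one _ (map_zero ε) (map_one ε)]
    have ha : IsUnit a := by
      rw [← isUnit_matrix_map_iff ε]
      exact IsUnit.of_mul_eq_one _ hap
    have hp : IsUnit (p.map ε) :=
      IsUnit.of_mul_eq_one _ (mul_eq_one_comm.mp hap)
    have hq : q = -(Ring.inverse a * b * (T * u)) := by
      have h1 : a * q = -(b * (T * u)) := by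
        rw [eq_neg_iff_add_eq_zero, ← Matrix.mul_assoc]
        exact h12.symm
      have h2 : Ring.inverse a * (a * q) = q := by
        rw [← Matrix.mul_assoc, Ring.inverse_mul_cancel _ ha, Matrix.one_mul]
      rw [← h2, h1, Matrix.mul_neg, Matrix.mul_assoc]
    have hq0 : q.map ε = 0 := by
      rw [hq, Matrix.map_neg _ (map_neg ε), Matrix.map_mul, hTu, Matrix.mul_zero, neg_zero]
    have hu : IsUnit u := by
      have h1 := (isUnit_matrix_map_iff ε h).mpr hh
      rw [← Matrix.fromBlocks_toBlocks h, Matrix.fromBlocks_map] at h1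
      change IsUnit (Matrix.fromBlocks (p.map ε) (q.map ε) (r.map ε) (u.map ε)) at h1
      rw [hq0] at h1
      exact (isUnit_matrix_map_iff ε u).mp (Matrix.isUnit_fromBlocks_zero₁₂.mp h1).2
    have hs : IsUnit (d - c * Ring.inverse a * b) := by
      let _ := ha.invertible
      have h1 := hg
      rw [← Matrix.fromBlocks_toBlocks g, Matrix.isUnit_fromBlocks_iff_of_invertible₁₁,
        ← Ring.inverse_invertible] at h1
      exact h1
    refine ⟨_, u, hs, hu, ?_⟩
    rw [h22, hq]
    simp only [Matrix.sub_mul, Matrix.mul_neg, Matrix.mul_assoc]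
    abel
  · rintro ⟨g, h, hg, hh, rfl⟩
    refine ⟨Matrix.fromBlocks 1 0 0 g, Matrix.fromBlocks 1 0 0 h, ?_, ?_, ?_⟩
    · exact Matrix.isUnit_fromBlocks_zero₂₁.mpr ⟨isUnit_one, hg⟩
    · exact Matrix.isUnit_fromBlocks_zero₂₁.mpr ⟨isUnit_one, hh⟩
    · simp [Matrix.fromBlocks_multiply]

theorem fromBlocks_mem_equivOrbit_iff {T : Matrix ι' κ' R} (hT : T.map ε = 0)
    {B : Matrix ι ι R} (hB : IsUnit B) (X : Matrix ι' ι R) (Y : Matrix ι κ' R)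
    (D : Matrix ι' κ' R) :
    Matrix.fromBlocks B (B * Y) (X * B) (X * B * Y + D) ∈ equivOrbit (Matrix.fromBlocks 1 0 0 T) ↔
      D ∈ equivOrbit T := by
  rw [← fromBlocks_one_mem_equivOrbit_iff (ι := ι) ε hT]
  have h1 : Matrix.fromBlocks B (B * Y) (X * B) (X * B * Y + D) =
      Matrix.fromBlocks B 0 (X * B) (1 : Matrix ι' ι' R) *
        Matrix.fromBlocks (1 : Matrix ι ι R) 0 0 D *
          Matrix.fromBlocks 1 Y 0 (1 : Matrix κ' κ' R) := by
    simp [Matrix.fromBlocks_multiply]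
  rw [h1]
  exact mul_mem_equivOrbit_iff (Matrix.isUnit_fromBlocks_zero₁₂.mpr ⟨hB, isUnit_one⟩)
    (Matrix.isUnit_fromBlocks_zero₂₁.mpr ⟨isUnit_one, isUnit_one⟩)

theorem map_eq_zero_of_mem_equivOrbit {T D : Matrix ι κ R} (hT : T.map ε = 0)
    (hD : D ∈ equivOrbit T) : D.map ε = 0 := by
  obtain ⟨g, h, -, -, rfl⟩ := hD
  rw [Matrix.map_mul, Matrix.map_mul, hT]
  simp

end EquivOrbit

/-! ### The orbit of a block matrix over a local algebra -/

section BlockOrbit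

variable {R : Type} [CommRing R] [Algebra ℂ R]
variable (ε : R →ₐ[ℂ] ℂ) {k m n : ℕ}

/-- The reduction of matrices as a linear map. -/
def mapMatrixₗ (ι κ : Type) : Matrix ι κ R →ₗ[ℂ] Matrix ι κ ℂ where
  toFun A := A.map ε
  map_add' A B := by ext; simp
  map_smul' c A := by ext; simp

@[simp]
theorem mapMatrixₗ_apply (ι κ : Type) (A : Matrix ι κ R) : mapMatrixₗ ε ι κ A = A.map ε := rfl

theorem mapMatrixₗ_surjective (ι κ : Type) : Function.Surjective (mapMatrixₗ ε ι κ) := fun A =>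
  ⟨A.map (algebraMap ℂ R), by ext; simp⟩

theorem mu_preimage_map [Module.Finite ℂ R] {c a b : ℕ} (hc : Module.finrank ℂ R = 1 + c)
    {S : Set (Matrix (Fin a) (Fin b) ℂ)} (hS : LocClosed S) :
    mu {A : Matrix (Fin a) (Fin b) R | A.map ε ∈ S} = mu S * lef ^ (a * b * c) := by
  refine mu_preimage_linear (mapMatrixₗ ε (Fin a) (Fin b)) (mapMatrixₗ_surjective ε _ _) hS ?_
  rw [Module.finrank_matrix, Module.finrank_matrix, hc]
  simp
  ring

theorem locClosed_preimage_map [Module.Finite ℂ R] {a b : ℕ}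
    {S : Set (Matrix (Fin a) (Fin b) ℂ)} (hS : LocClosed S) :
    LocClosed {A : Matrix (Fin a) (Fin b) R | A.map ε ∈ S} :=
  hS.preimage (polyMap_linear (mapMatrixₗ ε (Fin a) (Fin b)))

/-- The orbit of the block diagonal matrix with blocks `1` and `T`. -/
def blockOrbit (k : ℕ) (T : Matrix (Fin m) (Fin n) R) :
    Set (Matrix (Fin (k + m)) (Fin (k + n)) R) :=
  {A | A.submatrix finSumFinEquiv finSumFinEquiv ∈
    equivOrbit (Matrix.fromBlocks (1 : Matrix (Fin k) (Fin k) R) 0 0 T)}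

/-- A minor of the reduction of a matrix. -/
def reducedMinor (P : MinorIdx k (k + m)) (Q : MinorIdx k (k + n))
    (A : Matrix (Fin (k + m)) (Fin (k + n)) R) : ℂ :=
  ((A.map ε).submatrix P Q).det

theorem reducedMinor_mem_polyFun (P : MinorIdx k (k + m)) (Q : MinorIdx k (k + n)) :
    reducedMinor ε P Q ∈ polyFun (Matrix (Fin (k + m)) (Fin (k + n)) R) :=
  polyFun_det fun i j => polyFun_dual (ε.toLinearMap ∘ₗ Matrix.entryLinearMap ℂ R (P i) (Q j))

/-- A matrix with the rows and columns split by a minor. -/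
def splitMatrix (P : MinorIdx k (k + m)) (Q : MinorIdx k (k + n))
    (A : Matrix (Fin (k + m)) (Fin (k + n)) R) : Matrix (Fin k ⊕ Fin m) (Fin k ⊕ Fin n) R :=
  A.submatrix (splitRows P) (splitRows Q)

theorem mem_blockOrbit_iff {T : Matrix (Fin m) (Fin n) R} (P : MinorIdx k (k + m))
    (Q : MinorIdx k (k + n)) {A : Matrix (Fin (k + m)) (Fin (k + n)) R} :
    A ∈ blockOrbit k T ↔ splitMatrix P Q A ∈
      equivOrbit (Matrix.fromBlocks (1 : Matrix (Fin k) (Fin k) R) 0 0 T) :=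
  submatrix_mem_equivOrbit_congr _ _ _ _

/-- As `D` reduces to zero, the reduction is the product `(1; X) * B * (1, Y)` through dimension
`k`, and its `k × k` minors are products of determinants. This separates the conditions on rows from
those on columns. -/
theorem reducedMinor_eq {P : MinorIdx k (k + m)} {Q : MinorIdx k (k + n)}
    {A : Matrix (Fin (k + m)) (Fin (k + n)) R} {B : Matrix (Fin k) (Fin k) R}
    {X : Matrix (Fin m) (Fin k) R} {Y : Matrix (Fin k) (Fin n) R} {D : Matrix (Fin m) (Fin n) R}
    (h : splitMatrix P Q A = Matrix.fromBlocks B (B * Y) (X * B) (X * B * Y + D))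
    (hD : D.map ε = 0) (P' : MinorIdx k (k + m)) (Q' : MinorIdx k (k + n)) :
    reducedMinor ε P' Q' A = cellMinor P P' (X.map ε) * (B.map ε).det *
      cellMinor Q Q' (Y.map ε).transpose := by
  have h1 : A.map ε = (Matrix.fromRows 1 (X.map ε) * B.map ε *
      (Matrix.fromRows 1 (Y.map ε).transpose).transpose).submatrix
        (splitRows P).symm (splitRows Q).symm := by
    have h2 : A = (splitMatrix P Q A).submatrix (splitRows P).symm (splitRows Q).symm := by
      ext i j
      simp [splitMatrix]
    have h3 : (splitMatrix P Q A).map ε = Matrix.fromRows 1 (X.map ε) * B.map ε *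
      (Matrix.fromRows 1 (Y.map ε).transpose).transpose := by
      rw [h, Matrix.fromBlocks_map, Matrix.map_add _ (map_add ε), hD, Matrix.map_mul,
        Matrix.map_mul, Matrix.map_mul, Matrix.map_mul, Matrix.transpose_fromRows,
        Matrix.transpose_transpose, Matrix.transpose_one, Matrix.fromRows_mul,
        Matrix.fromRows_mul_fromCols]
      simp
    rw [← h3]
    conv_lhs => rw [h2]
    rfl
  rw [reducedMinor, h1, cellMinor, cellMinor, ← Matrix.det_transpose (Matrix.submatrix _
    ((splitRows Q).symm ∘ Q') id), ← Matrix.det_mul, ← Matrix.det_mul]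
  rfl

/-- The first columns of the identity matrix. -/
def idColumns (k a : ℕ) : Matrix (Fin k ⊕ Fin a) (Fin k) ℂ := Matrix.fromRows 1 0

theorem transpose_idColumns_mul (k a : ℕ) : (idColumns k a).transpose * idColumns k a = 1 := by
  rw [idColumns, Matrix.transpose_fromRows, Matrix.fromCols_mul_fromRows]
  simp

theorem idColumns_mul_transpose (k a b : ℕ) : idColumns k a * (idColumns k b).transpose =
    Matrix.fromBlocks 1 0 0 0 := by
  rw [idColumns, idColumns, Matrix.transpose_fromRows, Matrix.fromRows_mul_fromCols]
  simp

theorem exists_minor_mul_idColumns_ne_zero {k a : ℕ} {u : Matrix (Fin k ⊕ Fin a) (Fin k ⊕ Fin a) ℂ}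
    (hu : IsUnit u) :
    ∃ i, ((u * idColumns k a).submatrix
      (finSumFinEquiv.symm ∘ minorEnum k (k + a) i) id).det ≠ 0 := by
  have h := exists_minor_ne_zero ((u * idColumns k a).submatrix finSumFinEquiv.symm id)
    (N := ((idColumns k a).transpose * Ring.inverse u).submatrix id finSumFinEquiv.symm) (by
      rw [Matrix.submatrix_mul_equiv, Matrix.mul_assoc, ← Matrix.mul_assoc (Ring.inverse u),
        Ring.inverse_mul_cancel _ hu, Matrix.one_mul, transpose_idColumns_mul]
      simp)
  exact h

/-- The reduction is a product of the first `k` columns of one invertible matrix and the first `k`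
rows of another. Each factor has a nonzero maximal minor, and these multiply. -/
theorem exists_reducedMinor_ne_zero {T : Matrix (Fin m) (Fin n) R} (hT : T.map ε = 0)
    {A : Matrix (Fin (k + m)) (Fin (k + n)) R} (hA : A ∈ blockOrbit k T) :
    ∃ i j, reducedMinor ε (minorEnum k (k + m) i) (minorEnum k (k + n) j) A ≠ 0 := by
  obtain ⟨g, h, hg, hh, H⟩ := hA
  have h1 : A.map ε = ((g.map ε * idColumns k m) *
      ((h.map ε).transpose * idColumns k n).transpose).submatrix
        (finSumFinEquiv (m := k) (n := m)).symm (finSumFinEquiv (m := k) (n := n)).symm := by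
    have h2 : A = (A.submatrix (finSumFinEquiv (m := k) (n := m))
        (finSumFinEquiv (m := k) (n := n))).submatrix finSumFinEquiv.symm
          finSumFinEquiv.symm := by
      ext i j
      simp
    rw [h2, H, ← Matrix.submatrix_map, Matrix.map_mul, Matrix.map_mul, Matrix.fromBlocks_map, hT,
      Matrix.transpose_mul, Matrix.transpose_transpose,
      Matrix.mul_assoc, Matrix.mul_assoc, ← Matrix.mul_assoc (idColumns k m),
      idColumns_mul_transpose]
    simp
  obtain ⟨i, hi⟩ := exists_minor_mul_idColumns_ne_zero (hg.map ε.toRingHom.mapMatrix)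
  have hh' : IsUnit (h.map ε).transpose := by
    have h3 : IsUnit (h.map ε) := hh.map ε.toRingHom.mapMatrix
    rw [Matrix.isUnit_iff_isUnit_det] at h3 ⊢
    rwa [Matrix.det_transpose]
  obtain ⟨j, hj⟩ := exists_minor_mul_idColumns_ne_zero hh'
  refine ⟨i, j, ?_⟩
  have h4 : (A.map ε).submatrix (minorEnum k (k + m) i) (minorEnum k (k + n) j) =
      (g.map ε * idColumns k m).submatrix (finSumFinEquiv.symm ∘ minorEnum k (k + m) i) id *
        (((h.map ε).transpose * idColumns k n).submatrix
          (finSumFinEquiv.symm ∘ minorEnum k (k + n) j) id).transpose := by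
    rw [h1]
    rfl
  rw [reducedMinor, h4, Matrix.det_mul, Matrix.det_transpose]
  exact mul_ne_zero hi hj

/-- The Schur complement of a minor. -/
def schur (P : MinorIdx k (k + m)) (Q : MinorIdx k (k + n))
    (A : Matrix (Fin (k + m)) (Fin (k + n)) R) : Matrix (Fin m) (Fin n) R :=
  (splitMatrix P Q A).toBlocks₂₂ - (splitMatrix P Q A).toBlocks₂₁ *
    Ring.inverse (splitMatrix P Q A).toBlocks₁₁ * (splitMatrix P Q A).toBlocks₁₂

theorem splitMatrix_eq {P : MinorIdx k (k + m)} {Q : MinorIdx k (k + n)}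
    {A : Matrix (Fin (k + m)) (Fin (k + n)) R} (h : IsUnit (splitMatrix P Q A).toBlocks₁₁) :
    splitMatrix P Q A = Matrix.fromBlocks (splitMatrix P Q A).toBlocks₁₁
      ((splitMatrix P Q A).toBlocks₁₁ *
        (Ring.inverse (splitMatrix P Q A).toBlocks₁₁ * (splitMatrix P Q A).toBlocks₁₂))
      ((splitMatrix P Q A).toBlocks₂₁ * Ring.inverse (splitMatrix P Q A).toBlocks₁₁ *
        (splitMatrix P Q A).toBlocks₁₁)
      ((splitMatrix P Q A).toBlocks₂₁ * Ring.inverse (splitMatrix P Q A).toBlocks₁₁ *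
        (splitMatrix P Q A).toBlocks₁₁ *
          (Ring.inverse (splitMatrix P Q A).toBlocks₁₁ * (splitMatrix P Q A).toBlocks₁₂) +
        schur P Q A) := by
  have h1 : (splitMatrix P Q A).toBlocks₂₁ * Ring.inverse (splitMatrix P Q A).toBlocks₁₁ *
        (splitMatrix P Q A).toBlocks₁₁ = (splitMatrix P Q A).toBlocks₂₁ := by
    rw [Matrix.mul_assoc, Ring.inverse_mul_cancel _ h, Matrix.mul_one]
  rw [h1, ← Matrix.mul_assoc, Ring.mul_inverse_cancel _ h, Matrix.one_mul, schur,
    ← Matrix.mul_assoc, add_sub_cancel, Matrix.fromBlocks_toBlocks]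

theorem reducedMinor_self (P : MinorIdx k (k + m)) (Q : MinorIdx k (k + n))
    (A : Matrix (Fin (k + m)) (Fin (k + n)) R) :
    reducedMinor ε P Q A = ((splitMatrix P Q A).toBlocks₁₁.map ε).det := by
  rw [reducedMinor]
  congr 1

variable [IsLocalHom (ε : R →+* ℂ)]

theorem isUnit_toBlocks_of_reducedMinor_ne_zero {P : MinorIdx k (k + m)} {Q : MinorIdx k (k + n)}
    {A : Matrix (Fin (k + m)) (Fin (k + n)) R} (h : reducedMinor ε P Q A ≠ 0) :
    IsUnit (splitMatrix P Q A).toBlocks₁₁ := by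
  rw [← isUnit_matrix_map_iff (ε : R →+* ℂ), Matrix.isUnit_iff_isUnit_det, isUnit_iff_ne_zero]
  rw [reducedMinor_self] at h
  exact h

theorem mem_blockOrbit_iff_schur {T : Matrix (Fin m) (Fin n) R} (hT : T.map ε = 0)
    {P : MinorIdx k (k + m)} {Q : MinorIdx k (k + n)}
    {A : Matrix (Fin (k + m)) (Fin (k + n)) R} (h : reducedMinor ε P Q A ≠ 0) :
    A ∈ blockOrbit k T ↔ schur P Q A ∈ equivOrbit T := by
  have hu := isUnit_toBlocks_of_reducedMinor_ne_zero ε h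
  rw [mem_blockOrbit_iff P Q, splitMatrix_eq hu]
  exact fromBlocks_mem_equivOrbit_iff (ε : R →+* ℂ) hT hu _ _ _

variable [Module.Finite ℂ R]

theorem regMap_schur {P : MinorIdx k (k + m)} {Q : MinorIdx k (k + n)}
    {S : Set (Matrix (Fin (k + m)) (Fin (k + n)) R)} (h : ∀ A ∈ S, reducedMinor ε P Q A ≠ 0) :
    RegMap S (schur P Q) := by
  have hW : RegMap S (splitMatrix P Q) := (regMap_id S).submatrix _ _
  exact (hW.submatrix Sum.inr Sum.inr).sub (((hW.submatrix Sum.inr Sum.inl).matrix_mul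
    ((hW.submatrix Sum.inl Sum.inl).ringInverse fun A hA =>
      isUnit_toBlocks_of_reducedMinor_ne_zero ε (h A hA))).matrix_mul
        (hW.submatrix Sum.inl Sum.inr))

/-- Where a fixed reduced minor is nonzero, the orbit is the preimage of the orbit of `T` under the
regular map `schur`. These open sets cover it. -/
theorem locClosed_blockOrbit {T : Matrix (Fin m) (Fin n) R} (hT : T.map ε = 0)
    (hl : LocClosed (equivOrbit T)) : LocClosed (blockOrbit k T) := by
  refine locClosed_of_cover (q := fun p : MinorIdx k (k + m) × MinorIdx k (k + n) =>
    reducedMinor ε p.1 p.2) (fun p => reducedMinor_mem_polyFun ε p.1 p.2) ?_ ?_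
  · intro A hA
    obtain ⟨i, j, h⟩ := exists_reducedMinor_ne_zero ε hT hA
    exact ⟨(_, _), h⟩
  · rintro ⟨P, Q⟩
    have h1 : {A | reducedMinor ε P Q A ≠ 0} ∩ blockOrbit k T =
        {A | reducedMinor ε P Q A ≠ 0} ∩ schur P Q ⁻¹' equivOrbit T := by
      ext A
      exact and_congr_right fun h => mem_blockOrbit_iff_schur ε hT h
    rw [h1]
    exact (locClosed_ne_zero (reducedMinor_mem_polyFun ε P Q)).inter_preimage hl
      (regMap_schur ε fun A hA => hA)

end BlockOrbit

/-! ### The class of the orbit of a block matrix -/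

section BlockOrbitClass

variable {R : Type} [CommRing R] [Algebra ℂ R] [Module.Finite ℂ R]
variable (ε : R →ₐ[ℂ] ℂ) {k m n : ℕ}

/-- Matrices over `R` that reduce to a point of a cell. -/
def liftedCell (i : Fin (Nat.card (MinorIdx k (k + m)))) : Set (Matrix (Fin m) (Fin k) R) :=
  {X | X.map ε ∈ cell i}

/-- Matrices over `R` whose transpose reduces to a point of a cell. -/
def liftedCellT (j : Fin (Nat.card (MinorIdx k (k + n)))) : Set (Matrix (Fin k) (Fin n) R) :=
  {Y | (Y.map ε).transpose ∈ cell j}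

theorem zClosed_transpose_cell (j : Fin (Nat.card (MinorIdx k (k + n)))) :
    ZClosed {Y : Matrix (Fin k) (Fin n) ℂ | Y.transpose ∈ cell j} :=
  (zClosed_cell j).preimage
    (polyMap_linear (Matrix.transposeLinearEquiv (Fin k) (Fin n) ℂ ℂ).toLinearMap)

theorem mu_liftedCell {c : ℕ} (hc : Module.finrank ℂ R = 1 + c)
    (i : Fin (Nat.card (MinorIdx k (k + m)))) :
    mu (liftedCell ε i) = mu (cell i) * lef ^ (m * k * c) :=
  mu_preimage_map ε hc (zClosed_cell i).locClosed

theorem mu_liftedCellT {c : ℕ} (hc : Module.finrank ℂ R = 1 + c)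
    (j : Fin (Nat.card (MinorIdx k (k + n)))) :
    mu (liftedCellT ε j) = mu (cell j) * lef ^ (k * n * c) := by
  refine (mu_preimage_map ε hc (zClosed_transpose_cell j).locClosed).trans ?_
  congr 1
  exact mu_congr_polyMap (fun Y => Y.transpose) (fun Y => Y.transpose)
    (polyMap_linear (Matrix.transposeLinearEquiv (Fin k) (Fin n) ℂ ℂ).toLinearMap)
    (polyMap_linear (Matrix.transposeLinearEquiv (Fin n) (Fin k) ℂ ℂ).toLinearMap)
    (fun Y hY => hY) (fun Y hY => hY) (fun _ _ => rfl) (fun _ _ => rfl)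

theorem locClosed_liftedCell (i : Fin (Nat.card (MinorIdx k (k + m)))) :
    LocClosed (liftedCell ε i) := locClosed_preimage_map ε (zClosed_cell i).locClosed

theorem locClosed_liftedCellT (j : Fin (Nat.card (MinorIdx k (k + n)))) :
    LocClosed (liftedCellT ε j) := locClosed_preimage_map ε (zClosed_transpose_cell j).locClosed

variable [IsLocalHom (ε : R →+* ℂ)]

theorem setOf_isUnit_eq_preimage (k : ℕ) : {B : Matrix (Fin k) (Fin k) R | IsUnit B} =
    {B | B.map ε ∈ {M : Matrix (Fin k) (Fin k) ℂ | IsUnit M}} := by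
  ext B
  exact (isUnit_matrix_map_iff (ε : R →+* ℂ) B).symm

theorem locClosed_setOf_isUnit (ε : R →ₐ[ℂ] ℂ) [IsLocalHom (ε : R →+* ℂ)] (k : ℕ) :
    LocClosed {B : Matrix (Fin k) (Fin k) R | IsUnit B} := by
  rw [setOf_isUnit_eq_preimage ε]
  exact locClosed_preimage_map ε (locClosed_isUnit k)

theorem mu_setOf_isUnit (ε : R →ₐ[ℂ] ℂ) [IsLocalHom (ε : R →+* ℂ)]
    {c : ℕ} (hc : Module.finrank ℂ R = 1 + c) (k : ℕ) :
    mu {B : Matrix (Fin k) (Fin k) R | IsUnit B} = glCls k * lef ^ (k * k * c) := by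
  rw [setOf_isUnit_eq_preimage ε, mu_preimage_map ε hc (locClosed_isUnit k), glCls_eq_mu]

/-- On the stratum of a minor `(P, Q)` the coordinates are `B`, `X`, `Y` and the Schur complement.
The lexicographic order makes the conditions on `X` and on `Y` independent. -/
theorem mu_blockOrbit_stratum {T : Matrix (Fin m) (Fin n) R} (hT : T.map ε = 0)
    (hl : LocClosed (equivOrbit T))
    (p : Fin (Nat.card (MinorIdx k (k + m))) ×ₗ Fin (Nat.card (MinorIdx k (k + n)))) :
    mu {A | A ∈ blockOrbit k T ∧
      reducedMinor ε (minorEnum k (k + m) (ofLex p).1) (minorEnum k (k + n) (ofLex p).2) A ≠ 0 ∧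
      ∀ p' < p, reducedMinor ε (minorEnum k (k + m) (ofLex p').1)
        (minorEnum k (k + n) (ofLex p').2) A = 0} =
      mu ({B : Matrix (Fin k) (Fin k) R | IsUnit B} ×ˢ
        (liftedCell ε (ofLex p).1 ×ˢ (liftedCellT ε (ofLex p).2 ×ˢ equivOrbit T))) := by
  have hstr := (locClosed_blockOrbit (k := k) ε hT hl).stratum
    (q := fun p : Fin (Nat.card (MinorIdx k (k + m))) ×ₗ Fin (Nat.card (MinorIdx k (k + n))) =>
      reducedMinor ε (minorEnum k (k + m) (ofLex p).1) (minorEnum k (k + n) (ofLex p).2))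
    (fun p => reducedMinor_mem_polyFun ε _ _) p
  obtain ⟨i, j⟩ := p
  change mu {A | A ∈ blockOrbit k T ∧
      reducedMinor ε (minorEnum k (k + m) i) (minorEnum k (k + n) j) A ≠ 0 ∧
      ∀ p' < toLex (i, j), reducedMinor ε (minorEnum k (k + m) (ofLex p').1)
        (minorEnum k (k + n) (ofLex p').2) A = 0} =
      mu ({B : Matrix (Fin k) (Fin k) R | IsUnit B} ×ˢ
        (liftedCell ε i ×ˢ (liftedCellT ε j ×ˢ equivOrbit T)))
  change LocClosed {A | A ∈ blockOrbit k T ∧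
      reducedMinor ε (minorEnum k (k + m) i) (minorEnum k (k + n) j) A ≠ 0 ∧
      ∀ p' < toLex (i, j), reducedMinor ε (minorEnum k (k + m) (ofLex p').1)
        (minorEnum k (k + n) (ofLex p').2) A = 0} at hstr
  set S := {A | A ∈ blockOrbit k T ∧
      reducedMinor ε (minorEnum k (k + m) i) (minorEnum k (k + n) j) A ≠ 0 ∧
      ∀ p' < toLex (i, j), reducedMinor ε (minorEnum k (k + m) (ofLex p').1)
        (minorEnum k (k + n) (ofLex p').2) A = 0}
  set P := minorEnum k (k + m) i with hP
  set Q := minorEnum k (k + n) j with hQ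
  have hu : ∀ A ∈ S, IsUnit (splitMatrix P Q A).toBlocks₁₁ := fun A hA =>
    isUnit_toBlocks_of_reducedMinor_ne_zero ε hA.2.1
  have hrW : RegMap S (splitMatrix P Q) := (regMap_id S).submatrix _ _
  have hr11 : RegMap S fun A => (splitMatrix P Q A).toBlocks₁₁ := hrW.submatrix Sum.inl Sum.inl
  have hrI := hr11.ringInverse hu
  have hr12 : RegMap S fun A => (splitMatrix P Q A).toBlocks₁₂ := hrW.submatrix Sum.inl Sum.inr
  have hr21 : RegMap S fun A => (splitMatrix P Q A).toBlocks₂₁ := hrW.submatrix Sum.inr Sum.inl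
  have hWg : ∀ (B : Matrix (Fin k) (Fin k) R) (X : Matrix (Fin m) (Fin k) R)
      (Y : Matrix (Fin k) (Fin n) R) (D : Matrix (Fin m) (Fin n) R),
      splitMatrix P Q ((Matrix.fromBlocks B (B * Y) (X * B) (X * B * Y + D)).submatrix
        (splitRows P).symm (splitRows Q).symm) =
          Matrix.fromBlocks B (B * Y) (X * B) (X * B * Y + D) := by
    intro B X Y D
    simp [splitMatrix]
  refine mu_congr hstr ((locClosed_setOf_isUnit ε k).prod ((locClosed_liftedCell ε i).prod
      ((locClosed_liftedCellT ε j).prod hl)))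
    (fun A => ((splitMatrix P Q A).toBlocks₁₁,
      (splitMatrix P Q A).toBlocks₂₁ * Ring.inverse (splitMatrix P Q A).toBlocks₁₁,
      Ring.inverse (splitMatrix P Q A).toBlocks₁₁ * (splitMatrix P Q A).toBlocks₁₂, schur P Q A))
    (fun z => (Matrix.fromBlocks z.1 (z.1 * z.2.2.1) (z.2.1 * z.1)
      (z.2.1 * z.1 * z.2.2.1 + z.2.2.2)).submatrix (splitRows P).symm (splitRows Q).symm)
    ?_ ?_ ?_ ?_ ?_ ?_
  · exact hr11.prodMk ((hr21.matrix_mul hrI).prodMk ((hrI.matrix_mul hr12).prodMk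
      (regMap_schur ε fun A hA => hA.2.1)))
  · have hz := regMap_id ({B : Matrix (Fin k) (Fin k) R | IsUnit B} ×ˢ
        (liftedCell ε i ×ˢ (liftedCellT ε j ×ˢ equivOrbit T)))
    exact (RegMap.fromBlocks hz.fst (hz.fst.matrix_mul hz.snd.snd.fst)
      (hz.snd.fst.matrix_mul hz.fst) (((hz.snd.fst.matrix_mul hz.fst).matrix_mul
        hz.snd.snd.fst).add hz.snd.snd.snd)).submatrix _ _
  · intro A hA
    have hB := hu A hA
    have hD := (mem_blockOrbit_iff_schur ε hT hA.2.1).mp hA.1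
    have hD0 := map_eq_zero_of_mem_equivOrbit (ε : R →+* ℂ) hT hD
    have hq := reducedMinor_eq ε (splitMatrix_eq hB) hD0
    have hdet := reducedMinor_self ε P Q A ▸ hA.2.1
    -- The pairs `(i', j)` and `(i, j')` precede `(i, j)`. Their minors isolate the factor of `X`
    -- and that of `Y`, because the other one is `cellMinor_self`.
    refine ⟨hB, fun i' hi' => ?_, fun j' hj' => ?_, hD⟩
    · have h1 := (hq (minorEnum k (k + m) i') Q).symm.trans
        (hA.2.2 (toLex (i', j)) (Prod.Lex.toLex_lt_toLex.mpr (Or.inl hi')))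
      rw [cellMinor_self, mul_one] at h1
      exact (mul_eq_zero.mp h1).resolve_right hdet
    · have h1 := (hq P (minorEnum k (k + n) j')).symm.trans
        (hA.2.2 (toLex (i, j')) (Prod.Lex.toLex_lt_toLex.mpr (Or.inr ⟨rfl, hj'⟩)))
      rw [cellMinor_self, one_mul] at h1
      exact (mul_eq_zero.mp h1).resolve_left hdet
  · rintro ⟨B, X, Y, D⟩ ⟨hB, hX, hY, hD⟩
    have hD0 := map_eq_zero_of_mem_equivOrbit (ε : R →+* ℂ) hT hD
    have hq := reducedMinor_eq ε (hWg B X Y D) hD0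
    have hdet : (B.map ε).det ≠ 0 := by
      have h1 := (isUnit_matrix_map_iff (ε : R →+* ℂ) B).mpr hB
      rw [Matrix.isUnit_iff_isUnit_det, isUnit_iff_ne_zero] at h1
      exact h1
    refine ⟨?_, ?_, ?_⟩
    · rw [mem_blockOrbit_iff P Q, hWg]
      exact (fromBlocks_mem_equivOrbit_iff (ε : R →+* ℂ) hT hB X Y D).mpr hD
    · rw [hq, cellMinor_self, cellMinor_self, one_mul, mul_one]
      exact hdet
    -- An earlier pair has a smaller first index, or the same first and a smaller second one, so one
    -- of the two factors vanishes.
    · rintro ⟨i', j'⟩ hp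
      change reducedMinor ε (minorEnum k (k + m) i') (minorEnum k (k + n) j') _ = 0
      rw [hq]
      rcases Prod.Lex.toLex_lt_toLex.mp hp with h | ⟨h, h'⟩
      · rw [hX i' h, zero_mul, zero_mul]
      · rw [hY j' h', mul_zero]
  · intro A hA
    dsimp only
    rw [← splitMatrix_eq (hu A hA)]
    ext a b
    simp [splitMatrix]
  · rintro ⟨B, X, Y, D⟩ ⟨hB, hX, hY, hD⟩
    have hB' : IsUnit B := hB
    dsimp only
    rw [schur, hWg B X Y D]
    simp only [Matrix.toBlocks_fromBlocks₁₁, Matrix.toBlocks_fromBlocks₁₂,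
      Matrix.toBlocks_fromBlocks₂₁, Matrix.toBlocks_fromBlocks₂₂]
    rw [Matrix.mul_assoc X B, Ring.mul_inverse_cancel _ hB', Matrix.mul_one, ← Matrix.mul_assoc,
      Ring.inverse_mul_cancel _ hB', Matrix.one_mul, Matrix.mul_assoc, add_sub_cancel_left]

/-- Each entry of `B`, `X` and `Y` contributes `𝕃^c` from the kernel of the reduction; the
reductions contribute `GL_k` and the two cells. -/
theorem mu_blockOrbit {c : ℕ} (hc : Module.finrank ℂ R = 1 + c) {T : Matrix (Fin m) (Fin n) R}
    (hT : T.map ε = 0) (hl : LocClosed (equivOrbit T)) :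
    mu (blockOrbit k T) = glCls k * lef ^ ((k * k + m * k + k * n) * c) *
      (cellSum k m * cellSum k n) * mu (equivOrbit T) := by
  rw [mu_eq_sum (locClosed_blockOrbit (k := k) ε hT hl)
    (q := fun p : Fin (Nat.card (MinorIdx k (k + m))) ×ₗ Fin (Nat.card (MinorIdx k (k + n))) =>
      reducedMinor ε (minorEnum k (k + m) (ofLex p).1) (minorEnum k (k + n) (ofLex p).2))
    (fun p => reducedMinor_mem_polyFun ε _ _)]
  · rw [Finset.sum_congr rfl fun p _ => mu_blockOrbit_stratum ε hT hl p]
    have h1 : ∀ p : Fin (Nat.card (MinorIdx k (k + m))) ×ₗ Fin (Nat.card (MinorIdx k (k + n))),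
        mu ({B : Matrix (Fin k) (Fin k) R | IsUnit B} ×ˢ
          (liftedCell ε (ofLex p).1 ×ˢ (liftedCellT ε (ofLex p).2 ×ˢ equivOrbit T))) =
        glCls k * lef ^ ((k * k + m * k + k * n) * c) *
          (mu (cell (ofLex p).1) * mu (cell (ofLex p).2)) * mu (equivOrbit T) := by
      intro p
      have l1 := (locClosed_liftedCellT ε (ofLex p).2).prod hl
      have l2 := (locClosed_liftedCell ε (ofLex p).1).prod l1
      rw [mu_prod (locClosed_setOf_isUnit ε k) l2, mu_prod (locClosed_liftedCell ε _) l1,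
        mu_prod (locClosed_liftedCellT ε _) hl, mu_setOf_isUnit ε hc, mu_liftedCell ε hc,
        mu_liftedCellT ε hc]
      ring
    rw [Finset.sum_congr rfl fun p _ => h1 p, ← Finset.sum_mul, ← Finset.mul_sum, cellSum, cellSum,
      Finset.sum_mul_sum, ← Fintype.sum_prod_type']
    rfl
  · intro A hA
    obtain ⟨i, j, h⟩ := exists_reducedMinor_ne_zero ε hT hA
    exact ⟨toLex (i, j), h⟩

end BlockOrbitClass

/-! ### Truncated polynomial rings -/

section TruncRing

open Polynomial (X C)

variable {N m n k : ℕ}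

/-- The ring `ℂ[t]/(t^N)`. -/
abbrev TruncRing (N : ℕ) : Type := Polynomial ℂ ⧸ Ideal.span {(X : Polynomial ℂ) ^ N}

/-- The class of a polynomial in the truncated polynomial ring. -/
abbrev truncMk (N : ℕ) : Polynomial ℂ →ₐ[ℂ] TruncRing N := Ideal.Quotient.mkₐ ℂ _

theorem truncMk_surjective (N : ℕ) : Function.Surjective (truncMk N) :=
  Ideal.Quotient.mkₐ_surjective _ _

theorem truncMk_eq_zero_iff {p : Polynomial ℂ} : truncMk N p = 0 ↔ X ^ N ∣ p := by
  rw [Ideal.Quotient.mkₐ_eq_mk, Ideal.Quotient.eq_zero_iff_mem, Ideal.mem_span_singleton]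

theorem truncMk_X_pow : truncMk N X ^ N = 0 := by
  rw [← map_pow, truncMk_eq_zero_iff]

/-- The powers of `t` form a basis. -/
def truncBasis (N : ℕ) : Module.Basis (Fin N) ℂ (TruncRing N) :=
  (AdjoinRoot.powerBasis' (Polynomial.monic_X_pow (R := ℂ) N)).basis.reindex
    (finCongr (by rw [AdjoinRoot.powerBasis'_dim, Polynomial.natDegree_X_pow]))

theorem truncBasis_apply (i : Fin N) : truncBasis N i = truncMk N X ^ (i : ℕ) := by
  have h : (AdjoinRoot.powerBasis' (Polynomial.monic_X_pow (R := ℂ) N)).basis.reindex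
      (finCongr (by rw [AdjoinRoot.powerBasis'_dim, Polynomial.natDegree_X_pow])) i =
        AdjoinRoot.root ((X : Polynomial ℂ) ^ N) ^ (i : ℕ) := by
    rw [Module.Basis.reindex_apply, PowerBasis.basis_eq_pow, AdjoinRoot.powerBasis'_gen]
    rfl
  exact h

instance finite_truncRing (N : ℕ) : Module.Finite ℂ (TruncRing N) :=
  Module.Finite.of_basis (truncBasis N)

instance free_truncRing (N : ℕ) : Module.Free ℂ (TruncRing N) :=
  Module.Free.of_basis (truncBasis N)

theorem finrank_truncRing (N : ℕ) : Module.finrank ℂ (TruncRing N) = N := by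
  rw [Module.finrank_eq_card_basis (truncBasis N), Fintype.card_fin]

/-- The reduction modulo `t`. -/
def truncEval (N : ℕ) : TruncRing (N + 1) →ₐ[ℂ] ℂ :=
  Ideal.Quotient.liftₐ _ (Polynomial.aeval 0) fun p hp => by
    obtain ⟨q, rfl⟩ := Ideal.mem_span_singleton.mp hp
    simp

@[simp]
theorem truncEval_mk (p : Polynomial ℂ) : truncEval N (truncMk (N + 1) p) = p.eval 0 := by
  rw [← Polynomial.coe_aeval_eq_eval]
  rfl

instance isLocalHom_truncEval : IsLocalHom (truncEval N : TruncRing (N + 1) →+* ℂ) := by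
  constructor
  intro x hx
  obtain ⟨p, rfl⟩ := truncMk_surjective _ x
  have hp : p.eval 0 ≠ 0 := by
    rw [← truncEval_mk (N := N)]
    exact hx.ne_zero
  have h1 : IsCoprime (X : Polynomial ℂ) p := by
    rw [Polynomial.irreducible_X.coprime_iff_not_dvd, Polynomial.X_dvd_iff,
      Polynomial.coeff_zero_eq_eval_zero]
    exact hp
  obtain ⟨a, b, hab⟩ := h1.pow_left (m := N + 1)
  refine IsUnit.of_mul_eq_one (truncMk (N + 1) b) ?_
  have h2 := congrArg (truncMk (N + 1)) hab
  rw [map_add, map_mul, map_pow, truncMk_X_pow, mul_zero, zero_add, map_mul, map_one] at h2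
  rw [mul_comm]
  exact h2

/-- The projection between truncated polynomial rings. -/
def truncProj (N : ℕ) : TruncRing (N + 1) →ₐ[ℂ] TruncRing N :=
  Ideal.Quotient.liftₐ _ (truncMk N) fun p hp => by
    obtain ⟨q, rfl⟩ := Ideal.mem_span_singleton.mp hp
    rw [truncMk_eq_zero_iff]
    exact (pow_dvd_pow X N.le_succ).mul_right q

@[simp]
theorem truncProj_mk (p : Polynomial ℂ) : truncProj N (truncMk (N + 1) p) = truncMk N p := rfl

/-- Multiplication by `t` as a map between truncated polynomial rings. -/
def mulT (N : ℕ) : TruncRing N →ₗ[ℂ] TruncRing (N + 1) :=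
  Submodule.liftQ ((Ideal.span {(X : Polynomial ℂ) ^ N}).restrictScalars ℂ)
    ((truncMk (N + 1)).toLinearMap ∘ₗ LinearMap.mulLeft ℂ (X : Polynomial ℂ)) fun p hp => by
      obtain ⟨q, rfl⟩ := Ideal.mem_span_singleton.mp hp
      change truncMk (N + 1) (X * (X ^ N * q)) = 0
      rw [truncMk_eq_zero_iff, ← mul_assoc, ← pow_succ']
      exact dvd_mul_right _ _

@[simp]
theorem mulT_mk (p : Polynomial ℂ) : mulT N (truncMk N p) = truncMk (N + 1) (X * p) := rfl

theorem mulT_injective : Function.Injective (mulT N) := by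
  rw [injective_iff_map_eq_zero]
  intro x hx
  obtain ⟨p, rfl⟩ := truncMk_surjective _ x
  rw [mulT_mk, truncMk_eq_zero_iff, pow_succ'] at hx
  rw [truncMk_eq_zero_iff]
  exact (mul_dvd_mul_iff_left Polynomial.X_ne_zero).mp hx

/-- `mulT` is linear over `ℂ[t]/(t^(N+1))`, which acts on its source through the projection. -/
theorem mulT_truncProj_mul (a : TruncRing (N + 1)) (x : TruncRing N) :
    mulT N (truncProj N a * x) = a * mulT N x := by
  obtain ⟨p, rfl⟩ := truncMk_surjective _ a
  obtain ⟨q, rfl⟩ := truncMk_surjective _ x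
  rw [truncProj_mk, ← map_mul, mulT_mk, mulT_mk, ← map_mul]
  congr 1
  ring

theorem truncEval_mulT (x : TruncRing N) : truncEval N (mulT N x) = 0 := by
  obtain ⟨q, rfl⟩ := truncMk_surjective _ x
  rw [mulT_mk, truncEval_mk]
  simp

/-- For `N > 0` any lift works, since invertibility is decided modulo `t`. For `N = 0` the ring is
zero and the identity is a lift. -/
theorem exists_isUnit_map_truncProj {ι : Type} [Fintype ι] [DecidableEq ι]
    {g : Matrix ι ι (TruncRing N)} (hg : IsUnit g) :
    ∃ g' : Matrix ι ι (TruncRing (N + 1)), IsUnit g' ∧ g'.map (truncProj N) = g := by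
  rcases N with _ | N
  · have : Subsingleton (TruncRing 0) := by
      refine ⟨fun x y => ?_⟩
      obtain ⟨p, rfl⟩ := truncMk_surjective _ x
      obtain ⟨q, rfl⟩ := truncMk_surjective _ y
      rw [← sub_eq_zero, ← map_sub, truncMk_eq_zero_iff]
      simp
    exact ⟨1, isUnit_one, Subsingleton.elim _ _⟩
  · have hs : Function.Surjective (truncProj (N + 1)) := fun x => by
      obtain ⟨p, rfl⟩ := truncMk_surjective _ x
      exact ⟨_, truncProj_mk p⟩
    choose s hs using hs
    have h1 : (g.map s).map (truncProj (N + 1)) = g := by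
      ext i j
      simp [hs]
    refine ⟨g.map s, ?_, h1⟩
    rw [← isUnit_matrix_map_iff (truncEval (N + 1) : TruncRing (N + 1 + 1) →+* ℂ)]
    rw [← isUnit_matrix_map_iff (truncEval N : TruncRing (N + 1) →+* ℂ), ← h1] at hg
    have h2 : (g.map s).map (truncEval (N + 1) : TruncRing (N + 1 + 1) →+* ℂ) =
        ((g.map s).map (truncProj (N + 1))).map (truncEval N : TruncRing (N + 1) →+* ℂ) := by
      ext i j
      obtain ⟨p, hp⟩ := truncMk_surjective _ ((g.map s) i j)
      simp only [Matrix.map_apply] at hp ⊢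
      rw [← hp, truncProj_mk]
      exact (truncEval_mk p).trans (truncEval_mk p).symm
    rw [h2]
    exact hg

/-- The `m × n` diagonal matrix with diagonal entries `t^(lam 0), t^(lam 1), …`. -/
def truncDiag (N m n : ℕ) (lam : ℕ → ℕ) : Matrix (Fin m) (Fin n) (TruncRing N) :=
  Matrix.of fun i j => if (i : ℕ) = j then truncMk N X ^ lam i else 0

theorem truncDiag_succ (N m n : ℕ) (lam : ℕ → ℕ) :
    truncDiag (N + 1) m n (fun j => lam j + 1) = (truncDiag N m n lam).map (mulT N) := by
  ext i j
  simp only [truncDiag, Matrix.of_apply, Matrix.map_apply]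
  split_ifs with h
  · rw [← map_pow, ← map_pow, mulT_mk]
    exact congrArg _ (pow_succ' _ _)
  · rw [map_zero]

/-- In a product `g (tT) h` only `g` and `h` modulo `t^N` matter, and every invertible matrix modulo
`t^N` lifts to an invertible one. -/
theorem equivOrbit_map_mulT (T : Matrix (Fin m) (Fin n) (TruncRing N)) :
    equivOrbit (T.map (mulT N)) = (fun A => A.map (mulT N)) '' equivOrbit T := by
  have key : ∀ (g : Matrix (Fin m) (Fin m) (TruncRing (N + 1)))
      (h : Matrix (Fin n) (Fin n) (TruncRing (N + 1))),
      (g.map (truncProj N) * T * h.map (truncProj N)).map (mulT N) = g * T.map (mulT N) * h := by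
    intro g h
    ext i j
    simp only [Matrix.map_apply, Matrix.mul_apply, map_sum, Finset.sum_mul]
    refine Finset.sum_congr rfl fun a _ => Finset.sum_congr rfl fun b _ => ?_
    rw [mul_comm _ (truncProj N (h a j)), mulT_truncProj_mul, mulT_truncProj_mul, mul_comm]
  ext A
  constructor
  · rintro ⟨g, h, hg, hh, rfl⟩
    exact ⟨_, ⟨_, _, hg.map (truncProj N).mapMatrix, hh.map (truncProj N).mapMatrix, rfl⟩, key g h⟩
  · rintro ⟨_, ⟨g, h, hg, hh, rfl⟩, rfl⟩
    obtain ⟨g', hg', rfl⟩ := exists_isUnit_map_truncProj hg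
    obtain ⟨h', hh', rfl⟩ := exists_isUnit_map_truncProj hh
    exact ⟨g', h', hg', hh', key g' h'⟩

end TruncRing

/-! ### Images under injective linear maps -/

section LinearImage

variable {E F : Type} [AddCommGroup E] [Module ℂ E] [Module.Finite ℂ E] [AddCommGroup F]
  [Module ℂ F] [Module.Finite ℂ F]

theorem zClosed_singleton_zero : ZClosed ({0} : Set E) := by
  have : ({0} : Set E) = ⋂ φ : Module.Dual ℂ E, {x | φ x = 0} := by
    ext x
    simp only [Set.mem_singleton_iff, Set.mem_iInter]
    exact (Module.forall_dual_apply_eq_zero_iff ℂ x).symm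
  rw [this]
  exact ZClosed.iInter fun φ => zClosed_setOf_eq_zero (polyFun_dual φ)

theorem locClosed_image_linear {f : E →ₗ[ℂ] F} (hf : Function.Injective f) {S : Set E}
    (hS : LocClosed S) : LocClosed (f '' S) := by
  obtain ⟨s, hs⟩ := f.exists_leftInverse_of_injective (LinearMap.ker_eq_bot.mpr hf)
  have hs' : ∀ x, s (f x) = x := fun x => LinearMap.congr_fun hs x
  have h : f '' S = s ⁻¹' S ∩ (LinearMap.id - f ∘ₗ s : F →ₗ[ℂ] F) ⁻¹' {0} := by
    ext y
    constructor
    · rintro ⟨x, hx, rfl⟩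
      simp [hs', hx]
    · rintro ⟨hy, hy'⟩
      exact ⟨s y, hy, (sub_eq_zero.mp hy').symm⟩
  rw [h]
  exact (hS.preimage (polyMap_linear s)).inter
    (zClosed_singleton_zero.preimage (polyMap_linear (LinearMap.id - f ∘ₗ s))).locClosed

theorem mu_image_linear {f : E →ₗ[ℂ] F} (hf : Function.Injective f) (S : Set E) :
    mu (f '' S) = mu S := by
  obtain ⟨s, hs⟩ := f.exists_leftInverse_of_injective (LinearMap.ker_eq_bot.mpr hf)
  have hs' : ∀ x, s (f x) = x := fun x => LinearMap.congr_fun hs x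
  refine (mu_congr_polyMap (fun x => f x) (fun y => s y) (polyMap_linear f) (polyMap_linear s)
    (fun x hx => Set.mem_image_of_mem f hx) ?_ (fun x _ => hs' x) ?_).symm
  · rintro _ ⟨x, hx, rfl⟩
    beta_reduce
    rwa [hs']
  · rintro _ ⟨x, -, rfl⟩
    rw [hs']

end LinearImage

/-! ### The recursion for orbits of diagonal matrices -/

section OrbitStep

variable {N m n k : ℕ}

/-- The orbit of a diagonal matrix over a truncated polynomial ring. -/
def truncOrbit (N m n : ℕ) (lam : ℕ → ℕ) : Set (Matrix (Fin m) (Fin n) (TruncRing N)) :=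
  equivOrbit (truncDiag N m n lam)

/-- Multiplication of matrices by `t`. -/
def matrixMulT (N m n : ℕ) :
    Matrix (Fin m) (Fin n) (TruncRing N) →ₗ[ℂ] Matrix (Fin m) (Fin n) (TruncRing (N + 1)) where
  toFun A := A.map (mulT N)
  map_add' A B := by ext; simp
  map_smul' c A := by ext; simp

theorem matrixMulT_injective : Function.Injective (matrixMulT N m n) := fun A B h => by
  ext i j
  exact mulT_injective (congrFun (congrFun h i) j)

theorem truncOrbit_eq_image (lam : ℕ → ℕ) :
    truncOrbit (N + 1) m n (fun j => lam j + 1) = matrixMulT N m n '' truncOrbit N m n lam := by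
  rw [truncOrbit, truncDiag_succ, equivOrbit_map_mulT]
  rfl

theorem truncOrbit_eq_blockOrbit {lam lam' : ℕ → ℕ} (h0 : ∀ j < k, lam j = 0)
    (h1 : ∀ j < m, lam (k + j) = lam' j) :
    truncOrbit N (k + m) (k + n) lam = blockOrbit k (truncDiag N m n lam') := by
  have h : (truncDiag N (k + m) (k + n) lam).submatrix finSumFinEquiv finSumFinEquiv =
      Matrix.fromBlocks 1 0 0 (truncDiag N m n lam') := by
    ext (i | i) (j | j)
    · simp [truncDiag, Matrix.one_apply, h0 i i.2, Fin.ext_iff]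
    · simp [truncDiag]
      omega
    · simp [truncDiag]
      omega
    · simp [truncDiag, h1 i i.2]
  ext A
  change _ ↔ A.submatrix finSumFinEquiv finSumFinEquiv ∈ equivOrbit _
  rw [← h, submatrix_mem_equivOrbit_submatrix_iff]
  rfl

/-- The `k` zero exponents form the identity block. The remaining block is divisible by `t`, and
division by `t` lowers both its exponents and the truncation order. The factor `N` in the exponent
is the dimension of the kernel of reduction modulo `t`. -/
theorem truncOrbit_step {lam lam' : ℕ → ℕ} (h0 : ∀ j < k, lam j = 0)
    (h1 : ∀ j < m, lam (k + j) = lam' j + 1) (hl : LocClosed (truncOrbit N m n lam')) :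
    LocClosed (truncOrbit (N + 1) (k + m) (k + n) lam) ∧
      mu (truncOrbit (N + 1) (k + m) (k + n) lam) =
        glCls k * lef ^ ((k * k + m * k + k * n) * N) * (cellSum k m * cellSum k n) *
          mu (truncOrbit N m n lam') := by
  have hT : (truncDiag (N + 1) m n (fun j => lam' j + 1)).map (truncEval N) = 0 := by
    rw [truncDiag_succ]
    ext i j
    simp [truncEval_mulT]
  have hl' : LocClosed (equivOrbit (truncDiag (N + 1) m n (fun j => lam' j + 1))) := by
    change LocClosed (truncOrbit (N + 1) m n (fun j => lam' j + 1))
    rw [truncOrbit_eq_image]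
    exact locClosed_image_linear matrixMulT_injective hl
  rw [truncOrbit_eq_blockOrbit h0 h1]
  refine ⟨locClosed_blockOrbit (truncEval N) hT hl', ?_⟩
  rw [mu_blockOrbit (truncEval N) (by rw [finrank_truncRing, add_comm]) hT hl']
  congr 1
  change mu (truncOrbit (N + 1) m n (fun j => lam' j + 1)) = _
  rw [truncOrbit_eq_image]
  exact mu_image_linear (f := matrixMulT N m n) matrixMulT_injective _

theorem truncOrbit_zero (m n : ℕ) (lam : ℕ → ℕ) : truncOrbit 0 m n lam = Set.univ := by
  have : Subsingleton (TruncRing 0) := by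
    refine ⟨fun x y => ?_⟩
    obtain ⟨p, rfl⟩ := truncMk_surjective _ x
    obtain ⟨q, rfl⟩ := truncMk_surjective _ y
    rw [← sub_eq_zero, ← map_sub, truncMk_eq_zero_iff]
    simp
  refine Set.eq_univ_of_forall fun A => ⟨1, 1, isUnit_one, isUnit_one, Subsingleton.elim _ _⟩

theorem mu_truncOrbit_zero (m n : ℕ) (lam : ℕ → ℕ) : mu (truncOrbit 0 m n lam) = 1 := by
  rw [truncOrbit_zero, mu_univ, Module.finrank_matrix, finrank_truncRing]
  simp

end OrbitStep

/-! ### The class of an orbit -/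

section Formula

theorem grCls_eq_cellSum (k m : ℕ) : grCls k (k + m) = cellSum k m := grCls_eq_sum k m

theorem glCls_add (k m : ℕ) :
    glCls (k + m) = grCls k (k + m) * glCls k * glCls m * lef ^ (k * m) := by
  rw [grCls_eq_cellSum, ← cellSum_mul_glCls]
  ring

theorem glCls_zero : glCls 0 = 1 := by
  have h : {M : Matrix (Fin 0) (Fin 0) ℂ | IsUnit M} = Set.univ :=
    Set.eq_univ_of_forall fun M => by
      rw [Subsingleton.elim M 1]
      exact isUnit_one
  rw [glCls_eq_mu, h, mu_univ, Module.finrank_matrix]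
  simp

/-- Needed for the values that no exponent attains. There is a single empty minor, and its cell is a
point. -/
theorem grCls_zero (k : ℕ) : grCls 0 k = 1 := by
  have hu : ∀ i : Fin (Nat.card (MinorIdx 0 (0 + k))), mu (cell i) = 1 := by
    intro i
    have h : cell i = Set.univ := Set.eq_univ_of_forall fun X j hj => by
      have : j = i := (minorEnum 0 (0 + k)).injective (RelEmbedding.ext fun a => a.elim0)
      exact absurd hj (this ▸ lt_irrefl _)
    rw [h, mu_univ, Module.finrank_matrix]
    simp
  have hc : Nat.card (MinorIdx 0 (0 + k)) = 1 := by
    rw [Nat.card_eq_one_iff_unique]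
    exact ⟨⟨fun a b => RelEmbedding.ext fun a => a.elim0⟩, ⟨Fin.castAddOrderEmb k⟩⟩
  have h := grCls_eq_sum 0 k
  rw [Finset.sum_congr rfl fun i _ => hu i] at h
  simp only [Finset.sum_const, Finset.card_univ, Fintype.card_fin, hc, one_smul] at h
  rwa [zero_add] at h

/-- The exponent of `𝕃` in the formula for the class of an orbit. -/
def orbitExp (N m n s : ℕ) (lam : ℕ → ℕ) : ℤ :=
  (s : ℤ) ^ 2 * (N - 1) - ((m : ℤ) + n) * s * (N - 1) + (s : ℤ) * ((m : ℤ) + n - 2 * s) +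
    ∑ j ∈ Finset.range s, ((m : ℤ) + n - 1 - 2 * j) * (lam j : ℤ)

theorem sum_range_linear (s : ℕ) (c : ℤ) :
    ∑ j ∈ Finset.range s, (c - 2 * (j : ℤ)) = s * (c + 1 - s) := by
  induction s with
  | zero => simp
  | succ s ih =>
    rw [Finset.sum_range_succ, ih]
    push_cast
    ring

/-- The corrections are the powers of `𝕃` in `glCls_add`: `km + kn` from the two numerator groups
and `2ks` from the square of the group of size `k + s`, together with the power in
`truncOrbit_step`. -/
theorem orbitExp_succ (N m n s k : ℕ) {lam lam' : ℕ → ℕ} (h0 : ∀ j < k, lam j = 0)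
    (h1 : ∀ j < s, lam (k + j) = lam' j + 1) :
    orbitExp (N + 1) (k + m) (k + n) (k + s) lam = orbitExp N m n s lam' +
      ((k * m + k * n : ℕ) : ℤ) - ((2 * (k * s) + (k * k + m * k + k * n) * N : ℕ) : ℤ) := by
  unfold orbitExp
  have h2 : ∑ j ∈ Finset.range (k + s), (((k + m : ℕ) : ℤ) + ((k + n : ℕ) : ℤ) - 1 - 2 * j) *
      (lam j : ℤ) = ∑ j ∈ Finset.range s, ((m : ℤ) + n - 1 - 2 * j) * (lam' j : ℤ) +
        s * ((m : ℤ) + n - s) := by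
    rw [Finset.sum_range_add, Finset.sum_eq_zero fun j hj => by
      rw [h0 j (Finset.mem_range.mp hj)]; simp, zero_add]
    have h3 := sum_range_linear s ((m : ℤ) + n - 1)
    rw [sub_add_cancel] at h3
    rw [← h3, ← Finset.sum_add_distrib]
    refine Finset.sum_congr rfl fun j hj => ?_
    rw [h1 j (Finset.mem_range.mp hj)]
    push_cast
    ring
  rw [h2]
  push_cast
  ring

theorem coe_lefUnit : (lefUnit : K0L) = toK0L lef := rfl

/-- The induction step of `truncOrbit_formula` as pure algebra. `C` and `C'` are the orbit classes,
`K` is `[GL_k]`, `gm`, `gn`, `gs` are Grassmannians, `E` and `E'` are the powers with exponent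
`orbitExp`, and `Li` is the inverse of `L`. -/
theorem peel_identity {A : Type*} [CommRing A] {C C' K S S' M M₁ N N₁ a b E E' L Li gm gn gs P : A}
    {c p q r : ℕ} (hC : C = K * L ^ c * (gm * gn) * C')
    (hC' : C' * (S' ^ 2 * a * b * E') = M₁ * N₁ * P) (hM : M = gm * K * M₁ * L ^ p)
    (hN : N = gn * K * N₁ * L ^ q) (hS : S = gs * K * S' * L ^ r)
    (hE : E = E' * L ^ (p + q) * Li ^ (2 * r + c)) (hL : L ^ (2 * r + c) * Li ^ (2 * r + c) = 1) :
    C * (S ^ 2 * a * b * E) = M * N * (P * (gs ^ 2 * K)) := by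
  subst hC hM hN hS hE
  have h1 : K * L ^ c * (gm * gn) * C' *
      ((gs * K * S' * L ^ r) ^ 2 * a * b * (E' * L ^ (p + q) * Li ^ (2 * r + c))) =
      K ^ 3 * gm * gn * gs ^ 2 * L ^ (p + q) * (C' * (S' ^ 2 * a * b * E')) *
        (L ^ (2 * r + c) * Li ^ (2 * r + c)) := by
    ring
  rw [h1, hC', hL]
  ring

/-- Here `b v` is the multiplicity of the exponent `v`. The first hypothesis says that exponents
below `N` are sorted with these multiplicities and that all others are at least `N`. In this form a
recursion step just shifts `b`. -/
theorem truncOrbit_formula (N : ℕ) : ∀ (m n s : ℕ) (lam b : ℕ → ℕ),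
    (∀ j < m, ∀ v < N, lam j ≤ v ↔ j < ∑ u ∈ Finset.range (v + 1), b u) →
    s = ∑ u ∈ Finset.range N, b u → s ≤ m → s ≤ n →
    LocClosed (truncOrbit N m n lam) ∧
      toK0L (mu (truncOrbit N m n lam)) *
        (toK0L (glCls s) ^ 2 * toK0L (glCls (m - s)) * toK0L (glCls (n - s)) *
          ((lefUnit ^ orbitExp N m n s lam : K0Lˣ) : K0L)) =
        toK0L (glCls m) * toK0L (glCls n) * ∏ v ∈ Finset.range N,
          (toK0L (grCls (b v) (s - ∑ u ∈ Finset.range v, b u)) ^ 2 * toK0L (glCls (b v))) := by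
  induction N with
  | zero =>
    intro m n s lam b _ hs _ _
    obtain rfl : s = 0 := by simpa using hs
    refine ⟨truncOrbit_zero m n lam ▸ zClosed_univ.locClosed, ?_⟩
    rw [mu_truncOrbit_zero]
    simp [glCls_zero, orbitExp]
  | succ N ih =>
    intro m n s lam b hb hs hsm hsn
    -- The multiplicity `b 0` is split off: it is the size `k` of the block peeled in this step.
    rw [Finset.sum_range_succ'] at hs
    obtain ⟨s', hs'⟩ : ∃ s', s' = ∑ u ∈ Finset.range N, b (u + 1) := ⟨_, rfl⟩
    obtain ⟨k, hk⟩ : ∃ k, k = b 0 := ⟨_, rfl⟩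
    rw [← hs', ← hk, add_comm] at hs
    obtain ⟨m', rfl⟩ := Nat.exists_eq_add_of_le (show k ≤ m by omega)
    obtain ⟨n', rfl⟩ := Nat.exists_eq_add_of_le (show k ≤ n by omega)
    subst hs
    have hlam0 : ∀ j < k, lam j = 0 := by
      intro j hj
      have := (hb j (by omega) 0 (by omega)).mpr (by simpa [← hk] using hj)
      omega
    have hlam1 : ∀ j < m', lam (k + j) = (lam (k + j) - 1) + 1 := by
      intro j hj
      have := (hb (k + j) (by omega) 0 (by omega)).not.mpr (by simp [← hk])
      omega
    have hb' : ∀ j < m', ∀ v < N, lam (k + j) - 1 ≤ v ↔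
        j < ∑ u ∈ Finset.range (v + 1), b (u + 1) := by
      intro j hj v hv
      have h1 := hb (k + j) (by omega) (v + 1) (by omega)
      rw [Finset.sum_range_succ', ← hk] at h1
      have h2 : lam (k + j) - 1 ≤ v ↔ lam (k + j) ≤ v + 1 := by omega
      rw [h2, h1]
      omega
    -- The truncated subtraction is harmless, as exponents from index `k` up to the matrix size are
    -- positive.
    obtain ⟨hl, hf⟩ := ih m' n' s' (fun j => lam (k + j) - 1) (fun u => b (u + 1)) hb' hs'
      (by omega) (by omega)
    obtain ⟨hl', hC⟩ := truncOrbit_step (n := n') hlam0 hlam1 hl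
    refine ⟨hl', ?_⟩
    rw [Nat.add_sub_add_left, Nat.add_sub_add_left, Finset.prod_range_succ',
      Finset.range_zero, Finset.sum_empty, Nat.sub_zero, ← hk]
    have hprod : ∀ v ∈ Finset.range N, k + s' - ∑ u ∈ Finset.range (v + 1), b u =
        s' - ∑ u ∈ Finset.range v, b (u + 1) := by
      intro v _
      rw [Finset.sum_range_succ', ← hk]
      omega
    rw [Finset.prod_congr rfl fun v hv => by rw [hprod v hv]]
    have hC2 := congrArg toK0L hC
    simp only [map_mul, map_pow, ← grCls_eq_cellSum] at hC2
    have hG : ∀ a, toK0L (glCls (k + a)) = toK0L (grCls k (k + a)) * toK0L (glCls k) *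
        toK0L (glCls a) * toK0L lef ^ (k * a) := by
      intro a
      rw [glCls_add]
      simp only [map_mul, map_pow]
    refine peel_identity (Li := ((lefUnit⁻¹ : K0Lˣ) : K0L)) hC2 hf (hG m') (hG n') (hG s') ?_ ?_
    · rw [orbitExp_succ N m' n' s' k hlam0 fun j hj => hlam1 j (by omega), sub_eq_add_neg,
        zpow_add, zpow_add, zpow_neg, ← inv_zpow, zpow_natCast, zpow_natCast]
      simp only [Units.val_mul, Units.val_pow_eq_pow_val, coe_lefUnit]
    · rw [← coe_lefUnit, ← mul_pow, Units.mul_inv, one_pow]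

end Formula

/-! ### Comparison with the invariants of the sequence -/

section Jumps

variable {s p l : ℕ} {a idx : ℕ → ℕ}

/-- The partial sums of the increments. -/
def partialSum (a : ℕ → ℕ) (t : ℕ) : ℕ := ∑ k ∈ Finset.Icc 1 t, a k

theorem partialSum_succ (a : ℕ → ℕ) (t : ℕ) :
    partialSum a (t + 1) = partialSum a t + a (t + 1) :=
  Finset.sum_Icc_succ_top (by omega) _

theorem partialSum_mono (a : ℕ → ℕ) : Monotone (partialSum a) :=
  monotone_nat_of_le_succ fun t => by
    rw [partialSum_succ]
    exact Nat.le_add_right _ _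

/-- The number of indices at which the partial sum has a given value. -/
def multiplicity (a : ℕ → ℕ) (s v : ℕ) : ℕ := {t ∈ Finset.Icc 1 s | partialSum a t = v}.card

theorem sum_multiplicity (a : ℕ → ℕ) (s v : ℕ) :
    ∑ u ∈ Finset.range v, multiplicity a s u =
      {t ∈ Finset.Icc 1 s | partialSum a t < v}.card := by
  rw [Finset.card_eq_sum_card_fiberwise (f := partialSum a) (t := Finset.range v)]
  · refine Finset.sum_congr rfl fun u hu => ?_
    rw [multiplicity, Finset.filter_filter]
    congr 1
    refine Finset.filter_congr fun t _ => ?_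
    have := Finset.mem_range.mp hu
    omega
  · intro t ht
    simpa using (Finset.mem_filter.mp ht).2

/-- By monotonicity, the indices with partial sum at most `v` form an initial segment, so counting
them decides membership. -/
theorem partialSum_le_iff {j v : ℕ} (hj : j < s) : partialSum a (j + 1) ≤ v ↔
    j < ∑ u ∈ Finset.range (v + 1), multiplicity a s u := by
  rw [sum_multiplicity]
  constructor
  · intro h
    have h1 : Finset.Icc 1 (j + 1) ⊆ {t ∈ Finset.Icc 1 s | partialSum a t < v + 1} := by
      intro t ht
      rw [Finset.mem_Icc] at ht
      rw [Finset.mem_filter, Finset.mem_Icc]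
      have := partialSum_mono a ht.2
      omega
    have h2 := Finset.card_le_card h1
    rw [Nat.card_Icc] at h2
    omega
  · intro h
    by_contra hn
    have h1 : {t ∈ Finset.Icc 1 s | partialSum a t < v + 1} ⊆ Finset.Icc 1 j := by
      intro t ht
      rw [Finset.mem_filter, Finset.mem_Icc] at ht
      rw [Finset.mem_Icc]
      refine ⟨ht.1.1, ?_⟩
      by_contra hjt
      have := partialSum_mono a (show j + 1 ≤ t by omega)
      omega
    have h2 := Finset.card_le_card h1
    rw [Nat.card_Icc] at h2
    omega

/-- The sequence `idx` lists `1` and the indices of the nonzero increments in decreasing order. -/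
structure IsJumpSequence (s p : ℕ) (a idx : ℕ → ℕ) : Prop where
  pos : 1 ≤ s
  idx_zero : idx 0 = s + 1
  idx_lt : ∀ j, 1 ≤ j → j < p → idx (j + 1) < idx j
  image_eq : (Finset.Icc 1 p).image idx = {k ∈ Finset.Icc 2 s | a k ≠ 0} ∪ {1}

theorem exists_idx_eq_iff (H : IsJumpSequence s p a idx) (t : ℕ) :
    (∃ j, 1 ≤ j ∧ j ≤ p ∧ idx j = t) ↔ t = 1 ∨ 2 ≤ t ∧ t ≤ s ∧ a t ≠ 0 := by
  have := Finset.ext_iff.mp H.image_eq t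
  simp only [Finset.mem_image, Finset.mem_Icc, Finset.mem_union, Finset.mem_filter,
    Finset.mem_singleton] at this
  rw [or_comm, ← and_assoc, ← this]
  simp only [and_assoc]

/-- The descent from `idx 0 = s + 1` is not part of `idx_lt`; it holds because all listed indices
are at most `s`. -/
theorem idx_lt_idx (H : IsJumpSequence s p a idx) {j j' : ℕ} (hj : j < j') (hp : j' ≤ p) :
    idx j' < idx j := by
  have step : ∀ i, i < p → idx (i + 1) < idx i := by
    intro i hi
    rcases Nat.eq_zero_or_pos i with rfl | h
    · have := (exists_idx_eq_iff H (idx 1)).mp ⟨1, le_rfl, hi, rfl⟩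
      have hpos := H.pos
      have h2 : idx 1 ≤ s := by omega
      rw [H.idx_zero]
      exact Nat.lt_succ_of_le h2
    · exact H.idx_lt i h hi
  induction j', hj using Nat.le_induction with
  | base => exact step j (by omega)
  | succ i hi ih => exact (step i (by omega)).trans (ih (by omega))

/-- The partial sums are constant from `idx j` up to just before `idx (j - 1)` and increase strictly
at each jump. The listed index `1` need not be a jump, but no index `t ≥ 1` lies below it. -/
theorem partialSum_idx_compare (H : IsJumpSequence s p a idx) {j t : ℕ} (hj : 1 ≤ j)
    (hp : j ≤ p) (ht : 1 ≤ t) (hts : t ≤ s) :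
    (partialSum a t < partialSum a (idx j) ↔ t < idx j) ∧
      (partialSum a t = partialSum a (idx j) ↔ idx j ≤ t ∧ t < idx (j - 1)) := by
  have below : ∀ i, 1 ≤ i → i ≤ p → ∀ t, 1 ≤ t → t < idx i →
      partialSum a t < partialSum a (idx i) := by
    intro i hi hip t ht hti
    have h1 := (exists_idx_eq_iff H (idx i)).mp ⟨i, hi, hip, rfl⟩
    obtain ⟨c, hc⟩ : ∃ c, idx i = c + 1 := ⟨idx i - 1, by omega⟩
    rw [hc] at h1 hti ⊢
    rw [partialSum_succ]
    have h2 := partialSum_mono a (show t ≤ c by omega)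
    omega
  have inside : ∀ t, idx j ≤ t → t < idx (j - 1) → partialSum a t = partialSum a (idx j) := by
    intro t hjt
    induction t, hjt using Nat.le_induction with
    | base => intro _; rfl
    | succ t hjt ih =>
      intro h
      rw [← ih (by omega), partialSum_succ]
      have h1 := (exists_idx_eq_iff H (t + 1)).not.mp
      -- `t + 1` lies strictly between two consecutive members of a decreasing list.
      have h2 : ¬∃ i, 1 ≤ i ∧ i ≤ p ∧ idx i = t + 1 := by
        rintro ⟨i, hi, hip, hit⟩
        rcases lt_trichotomy i (j - 1) with h3 | h3 | h3
        · have := idx_lt_idx H h3 (by omega)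
          omega
        · subst h3
          omega
        · rcases Nat.lt_or_ge j i with h4 | h4
          · have := idx_lt_idx H h4 hip
            omega
          · obtain rfl : i = j := by omega
            omega
      have h3 := h1 h2
      have h4 := (exists_idx_eq_iff H (idx j)).mp ⟨j, hj, hp, rfl⟩
      have h5 : t + 1 ≤ s := by
        rcases Nat.eq_zero_or_pos (j - 1) with h6 | h6
        · rw [h6, H.idx_zero] at h
          omega
        · have h7 := idx_lt_idx H h6 (by omega)
          rw [H.idx_zero] at h7
          omega
      have h6 : a (t + 1) = 0 := by
        by_contra h7
        exact h3 (Or.inr ⟨by omega, h5, h7⟩)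
      omega
  have above : idx (j - 1) ≤ t → partialSum a (idx j) < partialSum a t := by
    intro h
    rcases Nat.eq_zero_or_pos (j - 1) with h6 | h6
    · rw [h6, H.idx_zero] at h
      omega
    · have h4 := (exists_idx_eq_iff H (idx j)).mp ⟨j, hj, hp, rfl⟩
      exact (below (j - 1) h6 (by omega) (idx j) (by omega)
        (idx_lt_idx H (by omega) hp)).trans_le (partialSum_mono a h)
  have hb := below j hj hp t ht
  have hi := inside t
  constructor
  · refine ⟨fun h => ?_, hb⟩
    by_contra hn
    have := partialSum_mono a (not_lt.mp hn)
    omega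
  · refine ⟨fun h => ⟨?_, ?_⟩, fun h => hi h.1 h.2⟩
    · by_contra hn
      have := hb (not_le.mp hn)
      omega
    · by_contra hn
      have := above (not_lt.mp hn)
      omega

/-- The map from `j` to the value of the partial sums at `idx j` is injective and hits every
attained value. Values that are not attained have multiplicity zero and give a trivial factor by
`hF`. -/
theorem prod_multiplicity (H : IsJumpSequence s p a idx) {A : Type*} [CommMonoid A]
    (F : ℕ → ℕ → A) (hF : ∀ k, F 0 k = 1)
    (hl : ∀ t, 1 ≤ t → t ≤ s → partialSum a t ≤ l) :
    ∏ v ∈ Finset.range (l + 1),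
        F (multiplicity a s v) (s - ∑ u ∈ Finset.range v, multiplicity a s u) =
      ∏ j ∈ Finset.Icc 1 p, F (idx (j - 1) - idx j) (s + 1 - idx j) := by
  symm
  have hidx : ∀ j, 1 ≤ j → j ≤ p → 1 ≤ idx j ∧ idx j ≤ s := by
    intro j hj hp
    have := (exists_idx_eq_iff H (idx j)).mp ⟨j, hj, hp, rfl⟩
    have hpos := H.pos
    omega
  have hidx' : ∀ j, 1 ≤ j → j ≤ p → idx (j - 1) ≤ s + 1 := by
    intro j hj hp
    rcases Nat.eq_zero_or_pos (j - 1) with h6 | h6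
    · rw [h6, H.idx_zero]
    · have := hidx (j - 1) h6 (by omega)
      omega
  refine Finset.prod_of_injOn (fun j => partialSum a (idx j)) ?_ ?_ ?_ ?_
  · have key : ∀ j ∈ (Finset.Icc 1 p : Finset ℕ), ∀ j' ∈ (Finset.Icc 1 p : Finset ℕ), j < j' →
        partialSum a (idx j') < partialSum a (idx j) := by
      intro j hj j' hj' hjj
      rw [Finset.mem_Icc] at hj hj'
      have h1 := hidx j' hj'.1 hj'.2
      exact (partialSum_idx_compare H hj.1 hj.2 h1.1 h1.2).1.mpr
        (idx_lt_idx H hjj hj'.2)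
    intro j hj j' hj' h
    rcases lt_trichotomy j j' with h1 | h1 | h1
    · exact absurd h (key j hj j' hj' h1).ne'
    · exact h1
    · exact absurd h (key j' hj' j hj h1).ne
  · intro j hj
    rw [Finset.mem_coe, Finset.mem_Icc] at hj
    have h1 := hidx j hj.1 hj.2
    have := hl (idx j) h1.1 h1.2
    rw [Finset.mem_coe, Finset.mem_range]
    beta_reduce
    omega
  · intro v hv hv'
    have : multiplicity a s v = 0 := by
      rw [multiplicity, Finset.card_eq_zero, Finset.filter_eq_empty_iff]
      intro t ht htv
      rw [Finset.mem_Icc] at ht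
      apply hv'
      have hex : ∃ j, 1 ≤ j ∧ j ≤ p ∧ idx j ≤ t := by
        obtain ⟨j, hj, hp, hj1⟩ := (exists_idx_eq_iff H 1).mpr (Or.inl rfl)
        exact ⟨j, hj, hp, by omega⟩
      classical
      -- The least `j` with `idx j ≤ t` gives the block containing `t`.
      obtain ⟨hj, hp, hjt⟩ := Nat.find_spec hex
      have hmin := fun i => Nat.find_min hex (m := i)
      set j := Nat.find hex
      refine ⟨j, by simp [hj, hp], ?_⟩
      rw [← htv]
      symm
      refine (partialSum_idx_compare H hj hp ht.1 ht.2).2.mpr ⟨hjt, ?_⟩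
      rcases Nat.eq_zero_or_pos (j - 1) with h6 | h6
      · rw [h6, H.idx_zero]
        omega
      · have := hmin (j - 1) (by omega)
        by_contra hn
        exact this ⟨h6, by omega, by omega⟩
    rw [this, hF]
  · intro j hj
    rw [Finset.mem_Icc] at hj
    have h1 := hidx j hj.1 hj.2
    have h2 := hidx' j hj.1 hj.2
    have hm : multiplicity a s (partialSum a (idx j)) = idx (j - 1) - idx j := by
      have : {t ∈ Finset.Icc 1 s | partialSum a t = partialSum a (idx j)} =
          Finset.Ico (idx j) (idx (j - 1)) := by
        ext t
        rw [Finset.mem_filter, Finset.mem_Icc, Finset.mem_Ico]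
        constructor
        · rintro ⟨ht, h⟩
          exact (partialSum_idx_compare H hj.1 hj.2 ht.1 ht.2).2.mp h
        · intro h
          have ht : 1 ≤ t ∧ t ≤ s := by omega
          exact ⟨ht, (partialSum_idx_compare H hj.1 hj.2 ht.1 ht.2).2.mpr h⟩
      rw [multiplicity, this, Nat.card_Ico]
    have hc : ∑ u ∈ Finset.range (partialSum a (idx j)), multiplicity a s u = idx j - 1 := by
      have : {t ∈ Finset.Icc 1 s | partialSum a t < partialSum a (idx j)} =
          Finset.Ico 1 (idx j) := by
        ext t
        rw [Finset.mem_filter, Finset.mem_Icc, Finset.mem_Ico]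
        constructor
        · rintro ⟨ht, h⟩
          exact ⟨ht.1, (partialSum_idx_compare H hj.1 hj.2 ht.1 ht.2).1.mp h⟩
        · intro h
          have ht : 1 ≤ t ∧ t ≤ s := by omega
          exact ⟨ht, (partialSum_idx_compare H hj.1 hj.2 ht.1 ht.2).1.mpr h.2⟩
      rw [sum_multiplicity, this, Nat.card_Ico]
    -- The second arguments agree because `s - (idx j - 1) = s + 1 - idx j`, where `idx j ≥ 1`.
    rw [hm, hc]
    congr 1
    omega

end Jumps

/-! ### Jet coordinates and truncated matrices -/

section JetCoordinates

variable {m n l : ℕ}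

/-- The matrix of a jet as a linear map of its coordinates. -/
def jetMatrixₗ (m n l : ℕ) : (JetIdx m n l → ℂ) →ₗ[ℂ] Matrix (Fin m) (Fin n) (JetRing l) where
  toFun a := jetMatrix a
  map_add' a b := by
    ext i j
    simp [jetMatrix, add_mul, Finset.sum_add_distrib]
  map_smul' c a := by
    ext i j
    simp only [jetMatrix, Matrix.of_apply, Matrix.smul_apply, Finset.smul_sum, Pi.smul_apply,
      smul_eq_mul, map_mul, mul_assoc, RingHom.id_apply]
    exact Finset.sum_congr rfl fun x _ => (Algebra.smul_def _ _).symm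

theorem jetMatrixₗ_bijective : Function.Bijective (jetMatrixₗ m n l) := by
  have hsurj : Function.Surjective (jetMatrixₗ m n l) := by
    intro A
    refine ⟨fun q => (truncBasis (l + 1)).repr (A q.1 q.2.1) q.2.2, ?_⟩
    ext i j
    have h := (truncBasis (l + 1)).sum_repr (A i j)
    refine Eq.trans ?_ h
    change ∑ k : Fin (l + 1), _ = _
    refine Finset.sum_congr rfl fun k _ => ?_
    rw [truncBasis_apply]
    exact (Algebra.smul_def _ _).symm
  have hrank : Module.finrank ℂ (JetIdx m n l → ℂ) =
      Module.finrank ℂ (Matrix (Fin m) (Fin n) (TruncRing (l + 1))) := by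
    rw [Module.finrank_matrix, finrank_truncRing]
    simp [mul_assoc]
  exact ⟨(LinearMap.injective_iff_surjective_of_finrank_eq_finrank
    (f := (jetMatrixₗ m n l : (JetIdx m n l → ℂ) →ₗ[ℂ]
      Matrix (Fin m) (Fin n) (TruncRing (l + 1)))) hrank).mpr hsurj, hsurj⟩

/-- The exponents of the diagonal matrix, where infinite ones are replaced by a large number. -/
def truncExp (l : ℕ) (lam : ℕ → ℕ∞) (j : ℕ) : ℕ :=
  if lam (j + 1) = ⊤ then l + 1 else (lam (j + 1)).toNat

theorem deltaMatrix_eq (lam : ℕ → ℕ∞) :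
    (deltaMatrix lam : Matrix (Fin m) (Fin n) (JetRing l)) =
      truncDiag (l + 1) m n (truncExp l lam) := by
  ext i j
  simp only [deltaMatrix, truncDiag, Matrix.of_apply, tPow, truncExp]
  split_ifs
  · exact (truncMk_X_pow (N := l + 1)).symm
  · rfl
  · rfl

theorem jetMatrix_mem_truncOrbit_iff (lam : ℕ → ℕ∞) (a : JetIdx m n l → ℂ) :
    jetMatrixₗ m n l a ∈ truncOrbit (l + 1) m n (truncExp l lam) ↔ a ∈ orbitPoints m n l lam := by
  rw [truncOrbit, ← deltaMatrix_eq]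
  constructor
  · rintro ⟨g, h, hg, hh, H⟩
    refine ⟨hg.unit, hh.unit⁻¹, ?_⟩
    rw [inv_inv]
    exact H
  · rintro ⟨g, h, H⟩
    exact ⟨g.val, (h⁻¹).val, g.isUnit, (h⁻¹).isUnit, H⟩

theorem orbitCls_eq_mu (m n l : ℕ) (lam : ℕ → ℕ∞) :
    orbitCls m n l lam = mu (truncOrbit (l + 1) m n (truncExp l lam)) := by
  have h : jetMatrixₗ m n l '' orbitPoints m n l lam =
      truncOrbit (l + 1) m n (truncExp l lam) := by
    ext A
    constructor
    · rintro ⟨a, ha, rfl⟩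
      exact (jetMatrix_mem_truncOrbit_iff lam a).mpr ha
    · intro hA
      obtain ⟨a, rfl⟩ := jetMatrixₗ_bijective.2 A
      exact ⟨a, (jetMatrix_mem_truncOrbit_iff lam a).mp hA, rfl⟩
  rw [orbitCls, cls_locallyClosedVar, ← h]
  exact (mu_image_linear (F := Matrix (Fin m) (Fin n) (TruncRing (l + 1)))
    (f := jetMatrixₗ m n l) jetMatrixₗ_bijective.1 _).symm

end JetCoordinates

/-! ### The formula in terms of the jump sequence -/

section Conclusion

variable {m n l s : ℕ} {lam : ℕ → ℕ∞} {a : ℕ → ℕ}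

theorem truncExp_eq (h : lam (s + 1) = (partialSum a (s + 1) : ℕ∞)) :
    truncExp l lam s = partialSum a (s + 1) := by
  rw [truncExp, h, if_neg (ENat.natCast_ne_top _), ENat.toNat_natCast]

theorem lefExponent_eq (ha : ∀ j, 1 ≤ j → j ≤ s → lam j = (partialSum a j : ℕ∞)) :
    lefExponent m n l s lam = orbitExp (l + 1) m n s (truncExp l lam) := by
  rw [lefExponent, orbitExp]
  have h : ∑ j ∈ Finset.Icc 1 s, ((m : ℤ) + n + 1 - 2 * j) * ((lam j).toNat : ℤ) =
      ∑ j ∈ Finset.range s, ((m : ℤ) + n - 1 - 2 * j) * (truncExp l lam j : ℤ) := by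
    refine (Finset.sum_nbij' (fun j => j + 1) (fun j => j - 1) ?_ ?_ ?_ ?_ ?_).symm
    · intro j hj
      rw [Finset.mem_range] at hj
      rw [Finset.mem_Icc]
      omega
    · intro j hj
      rw [Finset.mem_Icc] at hj
      rw [Finset.mem_range]
      omega
    · intro j _
      rfl
    · intro j hj
      rw [Finset.mem_Icc] at hj
      omega
    · intro j hj
      rw [Finset.mem_range] at hj
      have h1 := ha (j + 1) (by omega) (by omega)
      rw [truncExp_eq h1, h1, ENat.toNat_natCast]
      push_cast
      ring
  rw [h]
  push_cast
  ring

theorem orbitCls_formula {p : ℕ} {idx : ℕ → ℕ} (H : IsJumpSequence s p a idx) (hsm : s ≤ m)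
    (hmn : m ≤ n) (ha : ∀ j, 1 ≤ j → j ≤ s → lam j = (partialSum a j : ℕ∞))
    (hle : ∀ j, 1 ≤ j → j ≤ s → lam j ≤ l) (htop : ∀ j, s < j → j ≤ m → lam j = ⊤) :
    toK0L (orbitCls m n l lam) *
        (toK0L (glCls s) ^ 2 * toK0L (glCls (m - s)) * toK0L (glCls (n - s)) *
          ((lefUnit ^ lefExponent m n l s lam : K0Lˣ) : K0L)) =
      toK0L (orbitNumerator m n s p idx) := by
  have hl : ∀ t, 1 ≤ t → t ≤ s → partialSum a t ≤ l := by
    intro t ht hts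
    have := hle t ht hts
    rw [ha t ht hts] at this
    exact_mod_cast this
  have hs : s = ∑ u ∈ Finset.range (l + 1), multiplicity a s u := by
    rw [sum_multiplicity, Finset.filter_true_of_mem, Nat.card_Icc, Nat.add_sub_cancel]
    intro t ht
    rw [Finset.mem_Icc] at ht
    exact Nat.lt_succ_of_le (hl t ht.1 ht.2)
  have hlam : ∀ j < m, ∀ v < l + 1, truncExp l lam j ≤ v ↔
      j < ∑ u ∈ Finset.range (v + 1), multiplicity a s u := by
    intro j hj v hv
    rcases Nat.lt_or_ge j s with h | h
    · rw [truncExp_eq (ha (j + 1) (by omega) (by omega))]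
      exact partialSum_le_iff h
    · rw [truncExp, if_pos (htop (j + 1) (by omega) (by omega))]
      -- Beyond index `s` both sides are false: the exponent is `l + 1 > v`, and the count on the
      -- right is at most `s ≤ j`.
      have h1 : ∑ u ∈ Finset.range (v + 1), multiplicity a s u ≤ s := by
        conv_rhs => rw [hs]
        exact Finset.sum_le_sum_of_subset (Finset.range_mono (by omega))
      omega
  have hf := (truncOrbit_formula (l + 1) m n s (truncExp l lam) (multiplicity a s) hlam hs hsm
    (hsm.trans hmn)).2
  rw [← orbitCls_eq_mu, ← lefExponent_eq ha, prod_multiplicity H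
    (fun d k => toK0L (grCls d k) ^ 2 * toK0L (glCls d))
    (fun k => by rw [grCls_zero, glCls_zero, map_one, one_pow, one_mul]) hl] at hf
  rw [hf, orbitNumerator]
  simp only [map_mul, map_prod, map_pow]

theorem coe_glUnit (d : ℕ) : (glUnit d : K0GL) = toK0GL (glCls d) := rfl

theorem coe_lefUnitGL_zpow (e : ℤ) : ((lefUnitGL ^ e : K0GLˣ) : K0GL) =
    algebraMap K0L K0GL ((lefUnit ^ e : K0Lˣ) : K0L) := by
  rw [lefUnitGL, ← map_zpow]
  rfl

end Conclusion

end

end JetOrbit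

open JetOrbit in
theorem mainTheorem7
    (m n l i r s : ℕ) (hmn : m ≤ n) (hl : 1 ≤ l)
    (hi : 1 ≤ i) (hir : i ≤ r) (hrs : r ≤ s) (hsm : s ≤ m)
    -- the sequence `λ_1, …, λ_m` (only its values at `1, …, m` matter)
    (lam : ℕ → ℕ∞)
    (hlam_zero : ∀ j, 1 ≤ j → j < i → lam j = 0)
    (hlam_one : ∀ j, i ≤ j → j ≤ r → lam j = 1)
    (hlam_mono : ∀ j, 1 ≤ j → j < m → lam j ≤ lam (j + 1))
    (hlam_le : ∀ j, 1 ≤ j → j ≤ s → lam j ≤ l)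
    (hlam_top : ∀ j, s < j → j ≤ m → lam j = ⊤)
    -- the increments: `λ_j = a_1 + ⋯ + a_j` for `1 ≤ j ≤ s`
    (a : ℕ → ℕ)
    (ha : ∀ j, 1 ≤ j → j ≤ s → lam j = ((∑ k ∈ Finset.Icc 1 j, a k : ℕ) : ℕ∞))
    -- the jumps `i_0 = s + 1 > i_1 > ⋯ > i_p` with `{i_1, …, i_p} = {2 ≤ k ≤ s | a_k ≠ 0} ∪ {1}`
    (p : ℕ) (idx : ℕ → ℕ) (hidx_zero : idx 0 = s + 1)
    (hidx_lt : ∀ j, 1 ≤ j → j < p → idx (j + 1) < idx j)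
    (hidx_image : (Finset.Icc 1 p).image idx = {k ∈ Finset.Icc 2 s | a k ≠ 0} ∪ {1}) :
    -- the formula in `K_0[Var][𝕃⁻¹]`, multiplied by the classes of general linear groups in the
    -- denominator
    (toK0L (orbitCls m n l lam) *
        (toK0L (glCls s) ^ 2 * toK0L (glCls (m - s)) * toK0L (glCls (n - s)) *
          ((lefUnit ^ lefExponent m n l s lam : K0Lˣ) : K0L)) =
      toK0L (orbitNumerator m n s p idx)) ∧
    -- the formula as a ratio, in the localization where its denominator is invertible
    (toK0GL (orbitCls m n l lam) =
      toK0GL (orbitNumerator m n s p idx) *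
        (((glUnit s ^ 2 * glUnit (m - s) * glUnit (n - s) *
          lefUnitGL ^ lefExponent m n l s lam)⁻¹ : K0GLˣ) : K0GL)) := by
  have ha' : ∀ j, 1 ≤ j → j ≤ s → lam j = (partialSum a j : ℕ∞) := ha
  have H : IsJumpSequence s p a idx :=
    ⟨hi.trans (hir.trans hrs), hidx_zero, hidx_lt, hidx_image⟩
  have hf := orbitCls_formula H hsm hmn ha' hlam_le hlam_top
  refine ⟨hf, ?_⟩
  -- Cleared of its denominator, which is a unit here, the ratio formula is the image of the first
  -- identity in the further localization.
  rw [Units.eq_mul_inv_iff_mul_eq]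
  have hg := congrArg (algebraMap K0L K0GL) hf
  simp only [map_mul, map_pow] at hg
  simp only [Units.val_mul, Units.val_pow_eq_pow_val, coe_glUnit, coe_lefUnitGL_zpow]
  exact hg
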